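/- Let $A_+$ be a finite set, $A_\pm = A_+\cup\{\bar a : a\in A_+\}$ with the fixed-point-free involution $a\leftrightarrow\bar a$, and $A=A_\pm\cup\{\#\}$ with $\bar\#=\#$; the involution extends to words by $\overline{a_1\cdots a_n}=\bar a_n\cdots\bar a_1$. Let $\mathbb M(A)$ be either the free monoid with involution $A^*$ or the group $A^*/\{a\bar a=1 : a\in A\}$ (the free product of the free group $F(A_+)$ and $\{1,\#\}\cong\mathbb Z/2\mathbb Z$), and $\pi:A^*\to\mathbb M(A)$ the canonical projection. Let $X_1,\bar X_1,\dots,X_m,\bar X_m$ be variables and $(U,V)$ an equation, i.e. a pair of words over constants from $A$ and these variables, such that for each $i$ at least one of $X_i,\bar X_i$ occurs in $UV$. Its input size is $n=|A|+|UV|$. A solution in reduced words is a map $\sigma$ from the variables to words of $A_\pm^*$ without factors $a\bar a$ ($a\in A_\pm$) such that $\sigma(\bar X)=\overline{\sigma(X)}$ for every variable $X$ and $\pi\sigma(U)=\pi\sigma(V)$, where $\sigma$ is extended to words so as to fix the constants. Consider data $(C,(c_i),\mathcal A)$ where $C\supseteq A$ is a finite alphabet with an involution extending that of $A$, $c_1,\dots,c_m\in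 C$, and $\mathcal A$ is a trim nondeterministic finite automaton whose edges are labelled by endomorphisms of $C^*$ that fix $A$ and respect the involution. The labels along an accepting path are composed, and $L(\mathcal A)$ is the set of these compositions. Say that the data describe the solutions of $(U,V)$ if $$\{(\sigma(X_1),\dots,\sigma(X_m)) : \sigma \text{ solves } (U,V) \text{ in reduced words}\}=\{(h(c_1),\dots,h(c_m)) : h\in L(\mathcal A)\},$$ $\mathcal A$ is nonempty if and only if $(U,V)$ has a solution in reduced words, and $\mathcal A$ has a directed cycle if and only if $(U,V)$ has infinitely many solutions in reduced words. Then there is a universal constant $K$ such that for every such equation: (1) there are data with $|C|\le K n$ that describe the solutions of $(U,V)$; (2) for all data that describe the solutions of $(U,V)$ and all $Z_1,\dots,Z_k\in\{X_1,\bar X_1,\dots,X_m,\bar X_m\}$ there are letters $c'_1,\dots,c'_k\in C$ with $$\{\sigma(Z_1)\#\cdots\#\sigma(Z_k) : \sigma \text{ solves } (U,V) \text{ in reduced words}\}=\{h(c'_1\#\cdots\#c'_k) : h\in L(\mathcal A)\};$$ (3) for all such $Z_1,\dots,Z_k$ the set $\{\sigma(Z_1)\#\cdots\#\sigma(Z_k)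 : \sigma \text{ solves } (U,V) \text{ in reduced words}\}\subseteq A^*$ is an EDT0L language (i.e. equal to $\{h(c) : h\in\mathcal R\}$ for some finite alphabet $C'\supseteq A$, some rational set $\mathcal R$ of endomorphisms of $C'^*$ and some letter $c\in C'$), and hence an indexed language in the sense of Aho. In particular this holds for the full solution set, where every variable occurring in $UV$ is some $Z_i$ or $\bar Z_i$. -/

import Mathlib

/-! ## Rational subsets of monoids and EDT0L languages -/

/-- A nondeterministic finite automaton over a monoid `M`: a finite directed graph whose edges
are labelled by elements of `M` (parallel edges with different labels are allowed), with
initial and final states. -/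
structure MonoidNFA (M : Type*) where
  State : Type
  [finState : Finite State]
  edges : Set (State × M × State)
  finEdges : edges.Finite
  initial : Set State
  final : Set State

namespace MonoidNFA

/-- `𝒜.Path p m q`: there is a directed path (possibly of length zero) from `p` to `q`
along which the edge labels multiply to `m`. -/
inductive Path {M : Type*} [Monoid M] (𝒜 : MonoidNFA M) : 𝒜.State → M → 𝒜.State → Prop
  | nil (p : 𝒜.State) : Path 𝒜 p 1 p
  | cons {p q r : 𝒜.State} {a m : M} :
      (p, a, q) ∈ 𝒜.edges → Path 𝒜 q m r → Path 𝒜 p (a * m) r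

/-- The accepted subset of `M`. -/
def accepted {M : Type*} [Monoid M] (𝒜 : MonoidNFA M) : Set M :=
  {m | ∃ p ∈ 𝒜.initial, ∃ q ∈ 𝒜.final, 𝒜.Path p m q}

/-- Every state is on some path from an initial to a final state. -/
def IsTrim {M : Type*} [Monoid M] (𝒜 : MonoidNFA M) : Prop :=
  ∀ q : 𝒜.State, (∃ p ∈ 𝒜.initial, ∃ m, 𝒜.Path p m q) ∧ (∃ r ∈ 𝒜.final, ∃ m, 𝒜.Path q m r)

/-- There is a directed cycle (of length at least one). -/
def HasCycle {M : Type*} [Monoid M] (𝒜 : MonoidNFA M) : Prop :=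
  ∃ (p q : 𝒜.State) (a m : M), (p, a, q) ∈ 𝒜.edges ∧ 𝒜.Path q m p

end MonoidNFA

/-- A subset of a monoid is rational if it is accepted by some NFA over that monoid. -/
def IsRationalSet {M : Type*} [Monoid M] (R : Set M) : Prop :=
  ∃ 𝒜 : MonoidNFA M, 𝒜.accepted = R

/-- EDT0L languages in `α*`, via rational control: there are a finite alphabet `C` containing `α`
(through `ι`), a rational set `R` of endomorphisms of `C*` and a letter `c` of `C` such that
the language, regarded as a subset of `C*`, is `{h(c) | h ∈ R}`. -/
def IsEDT0L {α : Type*} (L : Set (FreeMonoid α)) : Prop :=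
  ∃ (C : Type) (_ : Finite C) (ι : α ↪ C) (R : Set (Monoid.End (FreeMonoid C))) (c : C),
    IsRationalSet R ∧ FreeMonoid.map ι '' L = (fun h => h (FreeMonoid.of c)) '' R

/-! ## Indexed languages -/

/-- Aho's indexed grammars with terminal alphabet `T`: nonterminals `N`, flags `F`, a start symbol,
productions `A → w` with `w ∈ (N F* ∪ T)*`, and for each flag `f` index productions
`A f → w` with `w ∈ (N ∪ T)*`. -/
structure IndexedGrammar (T : Type*) where
  N : Type
  [finN : Finite N]
  F : Type
  [finF : Finite F]
  start : N
  rules : Set (N × List ((N × List F) ⊕ T))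
  finRules : rules.Finite
  flagRules : Set (F × N × List (N ⊕ T))
  finFlagRules : flagRules.Finite

namespace IndexedGrammar

/-- One derivation step between sentential forms, which are words over `N F* ∪ T`. A nonterminal
carrying the flag string `ζ` hands `ζ` on to every nonterminal that replaces it; an index
production removes the first flag beforehand. -/
inductive Step {T : Type*} (g : IndexedGrammar T) :
    List ((g.N × List g.F) ⊕ T) → List ((g.N × List g.F) ⊕ T) → Prop
  | rule {A : g.N} {w : List ((g.N × List g.F) ⊕ T)} (hw : (A, w) ∈ g.rules)
      (ζ : List g.F) (u v : List ((g.N × List g.F) ⊕ T)) :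
      Step g (u ++ [Sum.inl (A, ζ)] ++ v)
        (u ++ w.map (Sum.map (fun p => (p.1, p.2 ++ ζ)) id) ++ v)
  | flag {f : g.F} {A : g.N} {w : List (g.N ⊕ T)} (hw : (f, A, w) ∈ g.flagRules)
      (ζ : List g.F) (u v : List ((g.N × List g.F) ⊕ T)) :
      Step g (u ++ [Sum.inl (A, f :: ζ)] ++ v)
        (u ++ w.map (Sum.map (fun B => (B, ζ)) id) ++ v)

/-- The generated language. -/
def language {T : Type*} (g : IndexedGrammar T) : Set (FreeMonoid T) :=
  {w | Relation.ReflTransGen g.Step [Sum.inl (g.start, [])] (w.toList.map Sum.inr)}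

end IndexedGrammar

/-- Indexed languages. -/
def IsIndexed {T : Type*} (L : Set (FreeMonoid T)) : Prop :=
  ∃ g : IndexedGrammar T, g.language = L

/-! ## Words with involution, reduced words -/

/-- The extension of an involution on letters to words: `a₁ ⋯ aₙ ↦ āₙ ⋯ ā₁`. -/
def barWord {α : Type*} (bar : α → α) (w : FreeMonoid α) : FreeMonoid α :=
  (FreeMonoid.map bar w).reverse

/-- The word `w₁ s w₂ s ⋯ s wₖ` for a letter `s`; it is the empty word for `k = 0`. -/
def joinWith {α : Type*} (s : α) (ws : List (FreeMonoid α)) : FreeMonoid α :=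
  FreeMonoid.ofList ([s].intercalate (ws.map FreeMonoid.toList))

/-- The alphabet `A = A₊ ∪ {ā | a ∈ A₊} ∪ {#}` over the generators `G = A₊`:
`some (a, true)` is `a`, `some (a, false)` is `ā`, and `none` is `#`. -/
abbrev Letter (G : Type*) := Option (G × Bool)

/-- The marker `#`. -/
def marker {G : Type*} : Letter G := none

/-- The involution on `A`; it fixes `#`. -/
def Letter.bar {G : Type*} : Letter G → Letter G := Option.map fun p => (p.1, !p.2)

/-- The variables `Xᵢ = (i, true)` and `X̄ᵢ = (i, false)`. -/
abbrev Variable (I : Type*) := I × Bool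

/-- The (fixed point free) involution on variables. -/
def Variable.bar {I : Type*} (X : Variable I) : Variable I := (X.1, !X.2)

/-- Reduced words: `#` does not occur, and there is no factor `a ā`. -/
def IsReducedWord {G : Type*} (w : FreeMonoid (Letter G)) : Prop :=
  marker ∉ w.toList ∧ ∀ a : Letter G, ¬ [a, a.bar] <:+: w.toList

/-! ## Equations and their solutions in reduced words -/

/-- The two choices for the monoid `𝕄(A)` over which an equation is read: the free monoid with
involution `A*`, or the group `A* / {a ā = 1 | a ∈ A}`, which is the free product of the free group
over `A₊` and the group `{1, #}` of order two. -/
inductive Ambient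
  | freeMonoid
  | freeGroup

/-- The defining relations `a ā = 1`, for `a ∈ A`. -/
def cancelRel {G : Type*} (u v : FreeMonoid (Letter G)) : Prop :=
  ∃ a : Letter G, u = FreeMonoid.of a * FreeMonoid.of a.bar ∧ v = 1

/-- `π(u) = π(v)` for the canonical projection `π : A* → 𝕄(A)`. -/
def Ambient.Eq {G : Type*} : Ambient → FreeMonoid (Letter G) → FreeMonoid (Letter G) → Prop
  | .freeMonoid, u, v => u = v
  | .freeGroup, u, v => PresentedMonoid.mk cancelRel u = PresentedMonoid.mk cancelRel v

/-- Words over constants and variables; an equation is a pair of such words. -/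
abbrev EqWord (G I : Type*) := FreeMonoid (Letter G ⊕ Variable I)

/-- Evaluation of a word under an assignment of the variables; the constants are fixed. -/
def evalWord {G I : Type*} (σ : Variable I → FreeMonoid (Letter G)) :
    EqWord G I →* FreeMonoid (Letter G) :=
  FreeMonoid.lift (Sum.elim FreeMonoid.of σ)

/-- `σ` solves `(U, V)` over `𝕄(A)` in reduced words. -/
structure SolvesReduced {G I : Type*} (k : Ambient) (U V : EqWord G I)
    (σ : Variable I → FreeMonoid (Letter G)) : Prop where
  map_bar : ∀ X, σ X.bar = barWord Letter.bar (σ X)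
  reduced : ∀ X, IsReducedWord (σ X)
  eq : k.Eq (evalWord σ U) (evalWord σ V)

/-- The variables are those of the equation: for every `i`, `Xᵢ` or `X̄ᵢ` occurs in `UV`. -/
def AllOccur {G I : Type*} (U V : EqWord G I) : Prop :=
  ∀ i : I, ∃ b : Bool, Sum.inr (i, b) ∈ (U * V).toList

/-- The input size `|A| + |UV|`. -/
noncomputable def inputSize {G I : Type*} (U V : EqWord G I) : ℕ :=
  Nat.card (Letter G) + (U * V).length

/-- The solution set `{σ(Z₁) # ⋯ # σ(Zₖ) | σ solves (U, V) in reduced words}`. -/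
def SolSet {G I : Type*} (k : Ambient) (U V : EqWord G I) (Z : List (Variable I)) :
    Set (FreeMonoid (Letter G)) :=
  {w | ∃ σ, SolvesReduced k U V σ ∧ w = joinWith marker (Z.map σ)}

/-! ## Automata producing the solutions -/

/-- A finite extended alphabet `C ⊇ A` with involution, letters `cᵢ` of `C` for the variables `Xᵢ`,
and an NFA over the endomorphisms of `C*`. -/
structure EndoAutomaton (G I : Type*) where
  C : Type
  [finC : Finite C]
  bar : C → C
  bar_bar : ∀ c, bar (bar c) = c
  incl : Letter G ↪ C
  incl_bar : ∀ a, incl a.bar = bar (incl a)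
  seed : I → C
  nfa : MonoidNFA (Monoid.End (FreeMonoid C))

/-- The automaton is trim and produces exactly the solutions of `(U, V)` in reduced words; its
labels are `A`-morphisms of the free monoid with involution `C*`; it is nonempty iff there is
a solution, and it has a directed cycle iff there are infinitely many. -/
structure EndoAutomaton.Produces {G I : Type*} (D : EndoAutomaton G I) (k : Ambient)
    (U V : EqWord G I) : Prop where
  label_fix : ∀ p h q, (p, h, q) ∈ D.nfa.edges →
    ∀ a, h (FreeMonoid.of (D.incl a)) = FreeMonoid.of (D.incl a)
  label_bar : ∀ p h q, (p, h, q) ∈ D.nfa.edges →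
    ∀ w, h (barWord D.bar w) = barWord D.bar (h w)
  trim : D.nfa.IsTrim
  tuples : {t : I → FreeMonoid D.C | ∃ σ, SolvesReduced k U V σ ∧
        ∀ i, t i = FreeMonoid.map D.incl (σ (i, true))} =
      {t : I → FreeMonoid D.C | ∃ h ∈ D.nfa.accepted, ∀ i, t i = h (FreeMonoid.of (D.seed i))}
  nonempty_iff : Nonempty D.nfa.State ↔ ∃ σ, SolvesReduced k U V σ
  cycle_iff : D.nfa.HasCycle ↔ {σ | SolvesReduced k U V σ}.Infinite

/-! The proof is by recompression, carried out on words over signed letters so that inversion is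
built in.

An equation together with a reduced solution is first turned into a system of equations between
words whose values are reduced and whose total length is linear in the input. Over the free monoid
both sides are cut wherever their common value contains a letter followed by its inverse
(`exists_reduced_pieces`). Over the group the product is evaluated symbol by symbol, and auxiliary
variables record what cancels and what survives (`exists_stack_system`).

A solved system is then compressed (`exists_compression`). A relation `r` between adjacent letters
cuts each word into maximal glued factors. The first and the last factor of each variable are popped
into the system. After that no factor of the value of a word belongs partly to the middle of a
variable and partly to its surroundings, so every visible factor can be renamed by a single letter.
Renaming is a function of the factor, hence equations survive. Factors that are nowhere visible are
spelled out in basic letters, so there need be no more names than visible factors.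

A round compresses maximal powers of letters, and then a quarter of the adjacent pairs of distinct
letters. The cost of popping is proportional to the number of occurrences of variables, so the total
length stays below a fixed linear bound, while the meanings of the variables shrink strictly
(`Solved.exists_round`). Hence every reduced solution gives a path, ending with empty variables,
through the finite graph whose vertices are the systems of bounded length.

Conversely, every inner edge of the graph satisfies `Expands`: decoding the new system by the label
gives the old one after a substitution of its variables. This property composes and makes no
reference to a solution, so every complete path yields some solution. The labels of pair
compressions are finitely many. Those of block compressions contain unbounded exponents, but the
admissible exponents solve a linear Diophantine system and form a semilinear set, so these labels
form a rational set (`ratIn_blockLabels`). Together this gives one rational set of substitutions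
(`exists_ratIn_of_systems`), which is intersected with the recognizable condition that the seeds go
to reduced words without marker (`RatIn.filter_reduced`).

If there are infinitely many solutions, the automaton must contain a cycle, because an acyclic one
accepts a finite set. If there are finitely many, a separate automaton lists them
(`exists_produces`). The statement about arbitrary data only uses that labels fix the constants and
respect the involution. A new letter mapped to the joined word then gives an EDT0L language, and an
indexed grammar that stores a path of the automaton in its flags generates every such language. -/

open FreeGroup (invRev)

/-! ## Signed words and substitutions -/

/-- Words over the signed letters `y` and `ȳ`, for `y : Y`. -/
abbrev SW (Y : Type*) := List (Y × Bool)


namespace SW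

variable {Y Z T : Type*}

/-- The inverse of a signed letter. -/
def flip (s : Y × Bool) : Y × Bool := (s.1, !s.2)

@[simp] theorem flip_flip (s : Y × Bool) : flip (flip s) = s := by simp [flip]

@[simp] theorem flip_fst (s : Y × Bool) : (flip s).1 = s.1 := rfl

@[simp] theorem flip_snd (s : Y × Bool) : (flip s).2 = !s.2 := rfl

theorem flip_mk (y : Y) (b : Bool) : flip (y, b) = (y, !b) := rfl

theorem flip_ne (s : Y × Bool) : flip s ≠ s := by
  intro h
  have := congrArg Prod.snd h
  simp [flip] at this

theorem invRev_eq (w : SW Y) : invRev w = (w.map flip).reverse := rfl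

theorem invRev_ne_nil {w : SW Y} (h : w ≠ []) : invRev w ≠ [] := by
  intro h'
  apply h
  have := congrArg invRev h'
  simpa using this

@[simp] theorem invRev_eq_nil {w : SW Y} : invRev w = [] ↔ w = [] := by
  constructor
  · intro h
    by_contra h'
    exact invRev_ne_nil h' h
  · rintro rfl; rfl

theorem mem_invRev {w : SW Y} {s : Y × Bool} : s ∈ invRev w ↔ flip s ∈ w := by
  simp only [invRev_eq, List.mem_reverse, List.mem_map]
  constructor
  · rintro ⟨a, ha, rfl⟩; simpa using ha
  · intro h; exact ⟨_, h, by simp⟩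

theorem getLast?_invRev (w : SW Y) : (invRev w).getLast? = w.head?.map flip := by
  simp [invRev_eq]

theorem head?_invRev (w : SW Y) : (invRev w).head? = w.getLast?.map flip := by
  simp [invRev_eq]

theorem invRev_flatten (l : List (SW Y)) :
    invRev l.flatten = (l.map invRev).reverse.flatten := by
  induction l with
  | nil => rfl
  | cons a l ih => simp [FreeGroup.invRev_append, ih]

/-- The value of a substitution at a signed letter. -/
def img (f : Y → SW Z) (s : Y × Bool) : SW Z := if s.2 then f s.1 else invRev (f s.1)

/-- A substitution applied to a signed word. -/
def sub (f : Y → SW Z) (w : SW Y) : SW Z := w.flatMap (img f)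

@[simp] theorem img_true (f : Y → SW Z) (y : Y) : img f (y, true) = f y := rfl

@[simp] theorem img_false (f : Y → SW Z) (y : Y) : img f (y, false) = invRev (f y) := rfl

theorem img_flip (f : Y → SW Z) (s : Y × Bool) : img f (flip s) = invRev (img f s) := by
  obtain ⟨y, _ | _⟩ := s <;> simp [flip_mk]

theorem img_ne_nil {f : Y → SW Z} {s : Y × Bool} (h : f s.1 ≠ []) : img f s ≠ [] := by
  obtain ⟨y, _ | _⟩ := s
  · exact invRev_ne_nil h
  · exact h

theorem length_img (f : Y → SW Z) (s : Y × Bool) : (img f s).length = (f s.1).length := by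
  obtain ⟨y, _ | _⟩ := s <;> simp

@[simp] theorem sub_nil (f : Y → SW Z) : sub f [] = [] := rfl

@[simp] theorem sub_cons (f : Y → SW Z) (s : Y × Bool) (w : SW Y) :
    sub f (s :: w) = img f s ++ sub f w := rfl

@[simp] theorem sub_append (f : Y → SW Z) (u v : SW Y) : sub f (u ++ v) = sub f u ++ sub f v := by
  simp [sub]

theorem sub_singleton (f : Y → SW Z) (s : Y × Bool) : sub f [s] = img f s := by simp

theorem sub_flatten (f : Y → SW Z) (l : List (SW Y)) :
    sub f l.flatten = (l.map (sub f)).flatten := by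
  induction l with
  | nil => rfl
  | cons a l ih => simp [ih]

theorem sub_invRev (f : Y → SW Z) (w : SW Y) : sub f (invRev w) = invRev (sub f w) := by
  induction w with
  | nil => rfl
  | cons s w ih =>
    rw [FreeGroup.invRev_cons, sub_append, ih, sub_cons, FreeGroup.invRev_append]
    congr 1
    rw [← img_flip, ← sub_singleton]
    rfl

theorem sub_img (f : Z → SW T) (g : Y → SW Z) (s : Y × Bool) :
    sub f (img g s) = img (fun y => sub f (g y)) s := by
  obtain ⟨y, _ | _⟩ := s <;> simp [sub_invRev]

theorem sub_sub (f : Z → SW T) (g : Y → SW Z) (w : SW Y) :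
    sub f (sub g w) = sub (fun y => sub f (g y)) w := by
  induction w with
  | nil => rfl
  | cons s w ih => simp [ih, sub_img]

theorem sub_congr {f g : Y → SW Z} {w : SW Y} (h : ∀ s ∈ w, f s.1 = g s.1) :
    sub f w = sub g w := by
  induction w with
  | nil => rfl
  | cons s w ih =>
    rw [sub_cons, sub_cons, ih fun t ht => h t (List.mem_cons_of_mem _ ht)]
    have := h s List.mem_cons_self
    simp [img, this]

/-- The substitution that maps letters to letters. -/
def letter (f : Y → Z) : Y → SW Z := fun y => [(f y, true)]

@[simp] theorem img_letter (f : Y → Z) (s : Y × Bool) : img (letter f) s = [(f s.1, s.2)] := by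
  obtain ⟨y, _ | _⟩ := s <;> rfl

theorem sub_letter (f : Y → Z) (w : SW Y) : sub (letter f) w = w.map fun s => (f s.1, s.2) := by
  induction w with
  | nil => rfl
  | cons s w ih => simp [ih]

@[simp] theorem sub_letter_id (w : SW Y) : sub (letter id) w = w := by simp [sub_letter]

theorem mem_img {f : Y → SW Z} {s : Y × Bool} {t : Z × Bool} (h : t ∈ img f s) :
    ∃ t' ∈ f s.1, t'.1 = t.1 := by
  obtain ⟨y, _ | _⟩ := s
  · exact ⟨_, mem_invRev.1 h, rfl⟩
  · exact ⟨_, h, rfl⟩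

theorem mem_sub {f : Y → SW Z} {w : SW Y} {t : Z × Bool} (h : t ∈ sub f w) :
    ∃ s ∈ w, ∃ t' ∈ f s.1, t'.1 = t.1 := by
  obtain ⟨s, hs, ht⟩ := List.mem_flatMap.1 h
  exact ⟨s, hs, mem_img ht⟩

theorem length_sub (f : Y → SW Z) (w : SW Y) :
    (sub f w).length = (w.map fun s => (f s.1).length).sum := by
  induction w with
  | nil => rfl
  | cons s w ih => simp [ih, length_img]

theorem sub_sub_letter (f : Z → SW T) (g : Y → Z) (w : SW Y) :
    sub f (sub (letter g) w) = sub (fun y => f (g y)) w := by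
  rw [sub_sub]
  apply sub_congr
  intro s _
  simp [letter]

theorem invRev_replicate (n : ℕ) (s : Y × Bool) :
    invRev (List.replicate n s) = List.replicate n (flip s) := by
  simp [invRev_eq]

end SW

open SW

/-- Signed substitutions of one alphabet, under composition. -/
abbrev SSub (D : Type*) := D → SW D

namespace SSub

variable {D : Type*}

/-- In `h * g` the factor `g` acts first. A label met late on a path is thus applied early: a seed
is rewritten from the end of the path back to its beginning. -/
instance : Monoid (SSub D) where
  one := letter id
  mul h g := fun d => sub h (g d)
  mul_assoc f g h := funext fun d => (sub_sub f g (h d)).symm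
  one_mul f := funext fun d => sub_letter_id (f d)
  mul_one f := funext fun d => List.append_nil (f d)

theorem mul_apply (h g : SSub D) (d : D) : (h * g) d = sub h (g d) := rfl

theorem sub_one (w : SW D) : sub (1 : SSub D) w = w := sub_letter_id w

end SSub

/-! ## Factorizations of words along a gluing relation -/

section Split

variable {A : Type*} {r : A → A → Bool}

/-- The last letter of `a` is not glued to the first letter of `b`. -/
def Unglued (r : A → A → Bool) (a b : List A) : Prop :=
  ∀ x ∈ a.getLast?, ∀ y ∈ b.head?, r x y = false

theorem isChain_unglued_splitBy (w : List A) : (w.splitBy r).IsChain (Unglued r) := by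
  refine (List.isChain_getLast_head_splitBy r w).imp ?_
  rintro a b ⟨ha, hb, h⟩ x hx y hy
  rw [List.getLast?_eq_getLast_of_ne_nil ha, Option.mem_some_iff] at hx
  rw [List.head?_eq_some_head hb, Option.mem_some_iff] at hy
  subst hx hy
  exact h

/-- Uniqueness of the factorization into maximal glued factors; it is how factorizations are
recognized below. -/
theorem splitBy_eq_of_unglued {w : List A} {l : List (List A)} (hw : w = l.flatten) (hn : [] ∉ l)
    (hc : ∀ m ∈ l, m.IsChain fun x y => r x y) (hu : l.IsChain (Unglued r)) :
    w.splitBy r = l := by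
  rw [List.splitBy_eq_iff]
  refine ⟨hw, hn, hc, hu.imp_of_mem_imp ?_⟩
  intro a b ha hb h
  have ha' : a ≠ [] := fun h => hn (h ▸ ha)
  have hb' : b ≠ [] := fun h => hn (h ▸ hb)
  exact ⟨ha', hb', h _ (List.getLast_mem_getLast? ha') _ (List.head_mem_head? hb')⟩

theorem splitBy_flatten_of_unglued {l : List (List A)} (hn : [] ∉ l)
    (hu : l.IsChain (Unglued r)) : l.flatten.splitBy r = l.flatMap (List.splitBy r) := by
  induction l with
  | nil => rfl
  | cons a l ih =>
    rw [List.flatten_cons, List.flatMap_cons, ← ih (fun h => hn (List.mem_cons_of_mem _ h))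
      (List.IsChain.tail hu)]
    apply List.splitBy_append
    cases l with
    | nil => simp
    | cons b l =>
      have hb : b ≠ [] := fun h => hn (by simp [h])
      rw [List.isChain_cons_cons] at hu
      intro x hx y hy
      refine hu.1 x hx y ?_
      rwa [List.flatten_cons, List.head?_append_of_ne_nil _ hb] at hy

/-- At a glued border the last factor of `u` and the first factor of `v` merge into one; at an
unglued border the two factorizations are simply concatenated. -/
theorem length_splitBy_append_le (u v : List A) :
    ((u ++ v).splitBy r).length ≤ (u.splitBy r).length + (v.splitBy r).length := by
  by_cases h : Unglued r u v
  · rw [List.splitBy_append h, List.length_append]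
  · have hu : u ≠ [] := by rintro rfl; exact h (by simp [Unglued])
    have hv : v ≠ [] := by rintro rfl; exact h (by simp [Unglued])
    obtain ⟨U, a, hU⟩ : ∃ U a, u.splitBy r = U ++ [a] :=
      ⟨_, _, (List.dropLast_append_getLast (List.splitBy_ne_nil.2 hu)).symm⟩
    obtain ⟨b, V, hV⟩ : ∃ b V, v.splitBy r = b :: V :=
      List.exists_cons_of_ne_nil (List.splitBy_ne_nil.2 hv)
    have hua : u = U.flatten ++ a := by
      rw [← List.flatten_splitBy r u, hU]; simp
    have hvb : v = b ++ V.flatten := by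
      rw [← List.flatten_splitBy r v, hV]; simp
    have ha : a ≠ [] := List.ne_nil_of_mem_splitBy (r := r) (l := u) (by simp [hU])
    have hb : b ≠ [] := List.ne_nil_of_mem_splitBy (r := r) (l := v) (by simp [hV])
    have key : (u ++ v).splitBy r = U ++ (a ++ b) :: V := by
      apply splitBy_eq_of_unglued
      · rw [hua, hvb]; simp
      · intro hmem
        rw [List.mem_append, List.mem_cons] at hmem
        rcases hmem with hmem | hmem | hmem
        · exact List.nil_notMem_splitBy r u (by simp [hU, hmem])
        · simp [ha] at hmem
        · exact List.nil_notMem_splitBy r v (by simp [hV, hmem])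
      · intro m hm
        rw [List.mem_append, List.mem_cons] at hm
        rcases hm with hm | rfl | hm
        · exact List.isChain_of_mem_splitBy (l := u) (by simp [hU, hm])
        · rw [List.isChain_append]
          refine ⟨List.isChain_of_mem_splitBy (l := u) (by simp [hU]),
            List.isChain_of_mem_splitBy (l := v) (by simp [hV]), ?_⟩
          intro x hx y hy
          by_contra hxy
          apply h
          intro x' hx' y' hy'
          rw [hua, List.getLast?_append_of_ne_nil _ ha] at hx'
          rw [hvb, List.head?_append_of_ne_nil _ hb] at hy'
          rw [Option.mem_unique hx' hx, Option.mem_unique hy' hy]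
          simpa using hxy
        · exact List.isChain_of_mem_splitBy (l := v) (by simp [hV, hm])
      · have h1 := isChain_unglued_splitBy (r := r) u
        have h2 := isChain_unglued_splitBy (r := r) v
        rw [hU, List.isChain_append] at h1
        rw [hV, List.isChain_cons] at h2
        rw [List.isChain_append, List.isChain_cons]
        refine ⟨h1.1, ⟨?_, h2.2⟩, ?_⟩
        · intro c hc x hx y hy
          rw [List.getLast?_append_of_ne_nil _ hb] at hx
          exact h2.1 c hc x hx y hy
        · intro c hc d hd x hx y hy
          simp only [List.head?_cons, Option.mem_some_iff] at hd
          subst hd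
          rw [List.head?_append_of_ne_nil _ ha] at hy
          exact h1.2.2 c hc a (by simp) x hx y hy
    rw [key, hU, hV]
    simp

theorem length_splitBy_le (u : List A) : (u.splitBy r).length ≤ u.length := by
  induction u with
  | nil => simp
  | cons a u ih =>
    have := length_splitBy_append_le (r := r) [a] u
    rw [List.splitBy_of_isChain (l := [a]) (by simp) (by simp)] at this
    simp at this ⊢
    omega

/-- A letter glued to its successor joins the factor of that successor. This is the source of every
gain in length. -/
theorem length_splitBy_cons_cons {a b : A} (h : r a b) (u : List A) :
    ((a :: b :: u).splitBy r).length = ((b :: u).splitBy r).length := by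
  obtain ⟨c, V, hV⟩ : ∃ c V, (b :: u).splitBy r = c :: V :=
    List.exists_cons_of_ne_nil (List.splitBy_ne_nil.2 (by simp))
  have hc : c ≠ [] := List.ne_nil_of_mem_splitBy (r := r) (l := b :: u) (by simp [hV])
  have hvb : b :: u = c ++ V.flatten := by
    rw [← List.flatten_splitBy r (b :: u), hV]; simp
  have hcb : c.head? = some b := by
    have := congrArg List.head? hvb
    rwa [List.head?_append_of_ne_nil _ hc, List.head?_cons, eq_comm] at this
  have key : (a :: b :: u).splitBy r = (a :: c) :: V := by
    apply splitBy_eq_of_unglued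
    · rw [hvb]; simp
    · intro hmem
      rw [List.mem_cons] at hmem
      rcases hmem with hmem | hmem
      · simp at hmem
      · exact List.nil_notMem_splitBy r (b :: u) (by simp [hV, hmem])
    · intro m hm
      rw [List.mem_cons] at hm
      rcases hm with rfl | hm
      · rw [List.isChain_cons]
        refine ⟨?_, List.isChain_of_mem_splitBy (l := b :: u) (by simp [hV])⟩
        intro y hy
        rw [hcb, Option.mem_some_iff] at hy
        exact hy ▸ h
      · exact List.isChain_of_mem_splitBy (l := b :: u) (by simp [hV, hm])
    · have h2 := isChain_unglued_splitBy (r := r) (b :: u)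
      rw [hV, List.isChain_cons] at h2
      rw [List.isChain_cons]
      refine ⟨?_, h2.2⟩
      intro d hd x hx y hy
      rw [List.getLast?_cons_of_ne_nil hc] at hx
      exact h2.1 d hd x hx y hy
  rw [key, hV]
  simp

end Split

/-! ### Factorizations and inversion -/

section SplitInv

variable {D : Type*} {r : D × Bool → D × Bool → Bool}

theorem unglued_invRev (hr : ∀ x y, r (flip y) (flip x) = r x y) {a b : SW D}
    (h : Unglued r a b) : Unglued r (invRev b) (invRev a) := by
  intro x hx y hy
  rw [getLast?_invRev] at hx
  rw [head?_invRev] at hy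
  obtain ⟨x', hx', rfl⟩ := Option.map_eq_some_iff.1 hx
  obtain ⟨y', hy', rfl⟩ := Option.map_eq_some_iff.1 hy
  rw [hr]
  exact h y' hy' x' hx'

theorem isChain_invRev (hr : ∀ x y, r (flip y) (flip x) = r x y) {w : SW D}
    (h : w.IsChain fun x y => r x y) : (invRev w).IsChain fun x y => r x y := by
  rw [invRev_eq, List.isChain_reverse, List.isChain_map]
  exact h.imp fun a b hab => by rwa [hr]

/-- The relation is invariant under inverting and exchanging its arguments, so borders of factors go
to borders. This is what allows a renaming of factors to respect inversion. -/
theorem splitBy_invRev (hr : ∀ x y, r (flip y) (flip x) = r x y) (w : SW D) :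
    (invRev w).splitBy r = ((w.splitBy r).map invRev).reverse := by
  apply splitBy_eq_of_unglued
  · rw [← invRev_flatten, List.flatten_splitBy]
  · intro h
    simp only [List.mem_reverse, List.mem_map, invRev_eq_nil] at h
    obtain ⟨a, ha, rfl⟩ := h
    exact List.nil_notMem_splitBy r w ha
  · intro m hm
    simp only [List.mem_reverse, List.mem_map] at hm
    obtain ⟨a, ha, rfl⟩ := hm
    exact isChain_invRev hr (List.isChain_of_mem_splitBy ha)
  · rw [List.isChain_reverse, List.isChain_map]
    exact (isChain_unglued_splitBy w).imp fun a b hab => unglued_invRev hr hab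

/-- A nonempty word whose consecutive letters are glued is not self-inverse when no letter is
glued to its inverse. -/
theorem invRev_ne_of_isChain (hs : ∀ x, r x (flip x) = false) {w : SW D} (hn : w ≠ [])
    (h : w.IsChain fun x y => r x y) : invRev w ≠ w := by
  intro hw
  have hlen : 0 < w.length := List.length_pos_iff.2 hn
  have key : ∀ i (hi : i < w.length), w[i] = flip (w[w.length - 1 - i]'(by omega)) := by
    intro i hi
    have : w[i] = (invRev w)[i]'(by simpa using hi) := by simp [hw]
    rw [this]
    simp [invRev_eq]
  -- In a self-inverse word of even length the two central letters are inverse to each other, which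
  -- `hs` forbids; in odd length the central letter would be its own inverse.
  rcases Nat.even_or_odd' w.length with ⟨c, hc | hc⟩
  · have h1 := key c (by omega)
    have h2 := List.isChain_iff_getElem.1 h (c - 1) (by omega)
    have e1 : c - 1 + 1 = c := by omega
    have e2 : w.length - 1 - c = c - 1 := by omega
    simp only [e1] at h2
    simp only [e2] at h1
    rw [h1, hs] at h2
    cases h2
  · have h1 := key c (by omega)
    have e2 : w.length - 1 - c = c := by omega
    simp only [e2] at h1
    exact flip_ne _ h1.symm

end SplitInv

/-! ## Uncrossing: popping the extreme factors of the variables -/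

/-- The symbols of a word in which a variable `x` has been replaced by its first factor
`cut x true`, the middle part `mid x` and its last factor `cut x false`. -/
inductive Atom (D X : Type*)
  | const (d : D)
  | cut (x : X) (e : Bool)
  | mid (x : X)

namespace Atom

variable {D X : Type*}

/-- The atom is the middle part of a variable. -/
def IsMid : Atom D X → Prop
  | mid _ => True
  | _ => False

@[simp] theorem isMid_const (d : D) : ¬ (const d : Atom D X).IsMid := id
@[simp] theorem isMid_cut (x : X) (e : Bool) : ¬ (cut x e : Atom D X).IsMid := id
@[simp] theorem isMid_mid (x : X) : (mid x : Atom D X).IsMid := trivial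

end Atom

section Uncross

open Atom

variable {D X : Type*} (r : D × Bool → D × Bool → Bool) (σ : X → SW D)

/-- The pattern by which a variable is replaced. -/
def shape (x : X) : SW (Atom D X) :=
  match ((σ x).splitBy r).length with
  | 0 => []
  | 1 => [(cut x true, true)]
  | 2 => [(cut x true, true), (cut x false, true)]
  | _ => [(cut x true, true), (mid x, true), (cut x false, true)]

/-- The values of the atoms. -/
def atomVal : Atom D X → SW D
  | const d => [(d, true)]
  | cut x true => ((σ x).splitBy r).head?.getD []
  | cut x false => ((σ x).splitBy r).getLast?.getD []
  | mid x => ((σ x).splitBy r).tail.dropLast.flatten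

/-- The replacement of the variables by their patterns. -/
def atomize : D ⊕ X → SW (Atom D X) := Sum.elim (letter const) (shape r σ)

/-- All facts about patterns are read off from these cases: no factor, one, two, or at least three.
Only the last has a middle part, and there it consists of at least one factor; a single factor
counts as the first one only. -/
theorem shape_cases (x : X) :
    ((σ x).splitBy r = [] ∧ shape r σ x = [] ∧ atomVal r σ (mid x) = []) ∨
    (∃ f, (σ x).splitBy r = [f] ∧ shape r σ x = [(cut x true, true)] ∧
      atomVal r σ (cut x true) = f ∧ atomVal r σ (mid x) = []) ∨
    (∃ f g, (σ x).splitBy r = [f, g] ∧ shape r σ x = [(cut x true, true), (cut x false, true)] ∧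
      atomVal r σ (cut x true) = f ∧ atomVal r σ (cut x false) = g ∧
      atomVal r σ (mid x) = []) ∨
    (∃ f m g, m ≠ [] ∧ (σ x).splitBy r = f :: (m ++ [g]) ∧
      shape r σ x = [(cut x true, true), (mid x, true), (cut x false, true)] ∧
      atomVal r σ (cut x true) = f ∧ atomVal r σ (cut x false) = g ∧
      atomVal r σ (mid x) = m.flatten) := by
  simp only [shape, atomVal]
  generalize (σ x).splitBy r = l
  match l with
  | [] => simp
  | [f] => simp
  | [f, g] => simp
  | f :: m :: n :: l =>
    right; right; right
    refine ⟨f, (m :: n :: l).dropLast, (m :: n :: l).getLast (by simp), by simp, ?_, ?_, ?_⟩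
    · rw [List.dropLast_append_getLast]
    · simp
    · simp [List.getLast?_eq_getLast_of_ne_nil]

theorem length_shape_le (x : X) : (shape r σ x).length ≤ 3 := by
  rcases shape_cases r σ x with ⟨_, h, _⟩ | ⟨f, _, h, _⟩ | ⟨f, g, _, h, _⟩ | ⟨f, m, g, _, _, h, _⟩ <;>
    simp [h]

theorem sub_atomVal_shape (x : X) : sub (atomVal r σ) (shape r σ x) = σ x := by
  rw [← List.flatten_splitBy r (σ x)]
  rcases shape_cases r σ x with ⟨h1, h, _⟩ | ⟨f, h1, h, h2, _⟩ | ⟨f, g, h1, h, h2, h3, _⟩ |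
    ⟨f, m, g, _, h1, h, h2, h3, h4⟩
  · simp [h, h1]
  · simp [h, h1, h2]
  · simp [h, h1, h2, h3]
  · simp [h, h1, h2, h3, h4]

theorem sub_atomVal_atomize (w : SW (D ⊕ X)) :
    sub (atomVal r σ) (sub (atomize r σ) w) = sub (Sum.elim (letter id) σ) w := by
  rw [sub_sub]
  apply sub_congr
  rintro ⟨d | x, b⟩ _
  · simp [atomize, letter, atomVal]
  · simp [atomize, sub_atomVal_shape]

theorem atomVal_ne_nil_of_mem_shape {x : X} {s : Atom D X × Bool} (hs : s ∈ shape r σ x) :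
    atomVal r σ s.1 ≠ [] := by
  have hn := List.nil_notMem_splitBy r (σ x)
  rcases shape_cases r σ x with ⟨h1, h, _⟩ | ⟨f, h1, h, h2, _⟩ | ⟨f, g, h1, h, h2, h3, _⟩ |
    ⟨f, m, g, hm, h1, h, h2, h3, h4⟩
  · simp [h] at hs
  · rw [h1] at hn
    simp only [h, List.mem_singleton] at hs
    subst hs
    rintro h0
    rw [h0] at h2
    simp [← h2] at hn
  · rw [h1] at hn
    simp only [h, List.mem_cons, List.not_mem_nil, or_false] at hs
    rcases hs with rfl | rfl <;> intro h0
    · rw [h0] at h2; simp [← h2] at hn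
    · rw [h0] at h3; simp [← h3] at hn
  · rw [h1] at hn
    simp only [h, List.mem_cons, List.not_mem_nil, or_false] at hs
    rcases hs with rfl | rfl | rfl <;> intro h0
    · rw [h0] at h2; simp [← h2] at hn
    · rw [h0, eq_comm, List.flatten_eq_nil_iff] at h4
      obtain ⟨a, ha⟩ := List.exists_mem_of_ne_nil m hm
      rw [h4 a ha] at ha
      simp [ha] at hn
    · rw [h0] at h3; simp [← h3] at hn

theorem atomVal_ne_nil {w : SW (D ⊕ X)} {s : Atom D X × Bool} (hs : s ∈ sub (atomize r σ) w) :
    atomVal r σ s.1 ≠ [] := by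
  obtain ⟨⟨d | x, b⟩, _, t, ht, hst⟩ := mem_sub hs
  · simp only [atomize, Sum.elim_inl, letter, List.mem_singleton] at ht
    subst ht
    rw [← hst]
    simp [atomVal]
  · rw [← hst]
    exact atomVal_ne_nil_of_mem_shape r σ ht

theorem isChain_atomVal (a : Atom D X) (ha : ¬ a.IsMid) :
    (atomVal r σ a).IsChain fun x y => r x y := by
  match a with
  | const d => simp [atomVal]
  | mid x => simp at ha
  | cut x true =>
    rw [atomVal]
    cases h : ((σ x).splitBy r).head? with
    | none => simp
    | some f => exact List.isChain_of_mem_splitBy (List.mem_of_mem_head? h)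
  | cut x false =>
    rw [atomVal]
    cases h : ((σ x).splitBy r).getLast? with
    | none => simp
    | some f => exact List.isChain_of_mem_splitBy (List.mem_of_mem_getLast? h)

open Classical in
/-- Two signed atoms are glued if the adjacent letters of their values are. -/
noncomputable def atomGlue (s t : Atom D X × Bool) : Bool :=
  decide (∃ x ∈ (img (atomVal r σ) s).getLast?, ∃ y ∈ (img (atomVal r σ) t).head?, r x y = true)

variable {r σ}

theorem atomGlue_eq_true {s t : Atom D X × Bool} :
    atomGlue r σ s t = true ↔ ∃ x ∈ (img (atomVal r σ) s).getLast?,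
      ∃ y ∈ (img (atomVal r σ) t).head?, r x y = true := by
  simp [atomGlue]

theorem atomGlue_eq_false {s t : Atom D X × Bool} :
    atomGlue r σ s t = false ↔ Unglued r (img (atomVal r σ) s) (img (atomVal r σ) t) := by
  simp [atomGlue, Unglued]

theorem atomGlue_flip (hr : ∀ x y, r (flip y) (flip x) = r x y) (s t : Atom D X × Bool) :
    atomGlue r σ (flip t) (flip s) = atomGlue r σ s t := by
  have key : ∀ s t : Atom D X × Bool, atomGlue r σ s t = false →
      atomGlue r σ (flip t) (flip s) = false := by
    intro s t h
    rw [atomGlue_eq_false] at h ⊢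
    rw [img_flip, img_flip]
    exact unglued_invRev hr h
  cases h : atomGlue r σ s t with
  | false => exact key s t h
  | true =>
    by_contra h'
    have := key _ _ (Bool.eq_false_iff.2 h')
    simp [h] at this

/-- Middle parts are not glued to anything. -/
def MidUnglued (r : D × Bool → D × Bool → Bool) (σ : X → SW D) (s t : Atom D X × Bool) : Prop :=
  atomGlue r σ s t = true → ¬ s.1.IsMid ∧ ¬ t.1.IsMid

/-- On both sides a middle part is separated from the popped factor by a border between maximal
factors, and such borders are unglued. -/
theorem isChain_shape (x : X) : (shape r σ x).IsChain (MidUnglued r σ) := by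
  have hu := isChain_unglued_splitBy (r := r) (σ x)
  have hn := List.nil_notMem_splitBy r (σ x)
  rcases shape_cases r σ x with ⟨h1, h, _⟩ | ⟨f, h1, h, h2, _⟩ | ⟨f, g, h1, h, h2, h3, _⟩ |
    ⟨f, m, g, hm, h1, h, h2, h3, h4⟩
  · simp [h]
  · simp [h]
  · simp [h, MidUnglued]
  · rw [h]
    rw [h1] at hu hn
    rw [List.isChain_cons, List.isChain_append] at hu
    obtain ⟨a, m', rfl⟩ := List.exists_cons_of_ne_nil hm
    simp only [List.isChain_cons_cons, List.IsChain.singleton, and_true]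
    constructor
    · intro hg
      rw [atomGlue_eq_true] at hg
      obtain ⟨x, hx, y, hy, hxy⟩ := hg
      have ha : a ≠ [] := by rintro rfl; simp at hn
      simp only [img_true, h2, h4, List.flatten_cons, List.head?_append_of_ne_nil _ ha] at hx hy
      have := hu.1 a (by simp) x hx y hy
      simp [this] at hxy
    · intro hg
      rw [atomGlue_eq_true] at hg
      obtain ⟨x, hx, y, hy, hxy⟩ := hg
      obtain ⟨m'', b, hb⟩ : ∃ m'' b, a :: m' = m'' ++ [b] :=
        ⟨_, _, (List.dropLast_append_getLast hm).symm⟩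
      rw [hb] at h4 hu hn
      have hbn : b ≠ [] := by rintro rfl; simp at hn
      simp only [img_true, h3, h4, List.flatten_append, List.flatten_singleton,
        List.getLast?_append_of_ne_nil _ hbn] at hx hy
      have := hu.2.2.2 b (by simp) g (by simp) x hx y hy
      simp [this] at hxy

theorem isMid_extreme_shape (x : X) :
    (∀ s ∈ (shape r σ x).head?, ¬ s.1.IsMid) ∧ (∀ s ∈ (shape r σ x).getLast?, ¬ s.1.IsMid) := by
  rcases shape_cases r σ x with ⟨_, h, _⟩ | ⟨f, _, h, _⟩ | ⟨f, g, _, h, _⟩ | ⟨f, m, g, _, _, h, _⟩ <;>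
    simp [h]

theorem isChain_invRev_of_midUnglued (hr : ∀ x y, r (flip y) (flip x) = r x y)
    {w : SW (Atom D X)} (h : w.IsChain (MidUnglued r σ)) :
    (invRev w).IsChain (MidUnglued r σ) := by
  rw [invRev_eq, List.isChain_reverse, List.isChain_map]
  refine h.imp fun a b hab hg => ?_
  rw [atomGlue_flip hr] at hg
  exact (hab hg).symm

theorem img_atomize_aux (hr : ∀ x y, r (flip y) (flip x) = r x y) (s : (D ⊕ X) × Bool) :
    (img (atomize r σ) s).IsChain (MidUnglued r σ) ∧
    (∀ a ∈ (img (atomize r σ) s).head?, ¬ a.1.IsMid) ∧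
    (∀ a ∈ (img (atomize r σ) s).getLast?, ¬ a.1.IsMid) := by
  obtain ⟨d | x, b⟩ := s
  · cases b <;> simp [atomize, letter, FreeGroup.invRev]
  · cases b
    · simp only [atomize, Sum.elim_inr, img_false, head?_invRev, getLast?_invRev]
      refine ⟨isChain_invRev_of_midUnglued hr (isChain_shape x), ?_, ?_⟩
      · intro a ha
        obtain ⟨a', ha', rfl⟩ := Option.map_eq_some_iff.1 ha
        exact (isMid_extreme_shape x).2 a' ha'
      · intro a ha
        obtain ⟨a', ha', rfl⟩ := Option.map_eq_some_iff.1 ha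
        exact (isMid_extreme_shape x).1 a' ha'
    · exact ⟨isChain_shape x, isMid_extreme_shape x⟩

/-- Where two symbols of `w` meet, only constants and popped factors meet, because no pattern begins
or ends with a middle part. This is the purpose of popping. The claim about the first atom serves
the induction. -/
theorem isChain_atomize (hr : ∀ x y, r (flip y) (flip x) = r x y) (w : SW (D ⊕ X)) :
    (sub (atomize r σ) w).IsChain (MidUnglued r σ) ∧
    ∀ a ∈ (sub (atomize r σ) w).head?, ¬ a.1.IsMid := by
  induction w with
  | nil => simp
  | cons s w ih =>
    obtain ⟨h1, h2, h3⟩ := img_atomize_aux hr s (r := r) (σ := σ)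
    rw [sub_cons, List.isChain_append]
    refine ⟨⟨h1, ih.1, fun a ha b hb _ => ⟨h3 a ha, ih.2 b hb⟩⟩, ?_⟩
    intro a ha
    cases hi : img (atomize r σ) s with
    | nil => rw [hi] at ha; exact ih.2 a ha
    | cons c l =>
      rw [hi] at ha h2
      exact h2 a ha

/-- As the atoms have nonempty values, the letters at a border between groups are those compared by
`atomGlue`. So no factor of the value extends across two groups, and the factorization can be
computed group by group. -/
theorem splitBy_sub_atomVal {w : SW (Atom D X)} (hw : ∀ s ∈ w, atomVal r σ s.1 ≠ []) :
    (sub (atomVal r σ) w).splitBy r =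
      (w.splitBy (atomGlue r σ)).flatMap fun g => (sub (atomVal r σ) g).splitBy r := by
  have hmem : ∀ g ∈ w.splitBy (atomGlue r σ), ∀ s ∈ g, atomVal r σ s.1 ≠ [] := by
    intro g hg s hs
    apply hw
    rw [← List.flatten_splitBy (atomGlue r σ) w]
    exact List.mem_flatten.2 ⟨g, hg, hs⟩
  conv_lhs => rw [← List.flatten_splitBy (atomGlue r σ) w, sub_flatten]
  rw [splitBy_flatten_of_unglued, List.flatMap_map]
  · intro h
    obtain ⟨g, hg, hg0⟩ := List.mem_map.1 h
    obtain ⟨s, g', rfl⟩ := List.exists_cons_of_ne_nil (List.ne_nil_of_mem_splitBy hg)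
    rw [sub_cons, List.append_eq_nil_iff] at hg0
    exact img_ne_nil (hmem _ hg s (by simp)) hg0.1
  · rw [List.isChain_map]
    refine (isChain_unglued_splitBy _).imp_of_mem_imp ?_
    intro g g' hg hg' hu x hx y hy
    obtain ⟨G, s, rfl⟩ : ∃ G s, g = G ++ [s] :=
      ⟨_, _, (List.dropLast_append_getLast (List.ne_nil_of_mem_splitBy hg)).symm⟩
    obtain ⟨t, G', rfl⟩ := List.exists_cons_of_ne_nil (List.ne_nil_of_mem_splitBy hg')
    have h1 := img_ne_nil (hmem _ hg s (by simp))
    have h2 := img_ne_nil (hmem _ hg' t (by simp))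
    have := hu s (by simp) t (by simp)
    rw [atomGlue_eq_false] at this
    rw [sub_append, sub_singleton, List.getLast?_append_of_ne_nil _ h1] at hx
    rw [sub_cons, List.head?_append_of_ne_nil _ h2] at hy
    exact this x hx y hy

theorem isChain_sub_atomVal (hr : ∀ x y, r (flip y) (flip x) = r x y) {g : SW (Atom D X)}
    (hm : ∀ s ∈ g, ¬ s.1.IsMid) (hn : ∀ s ∈ g, atomVal r σ s.1 ≠ [])
    (hc : g.IsChain fun s t => atomGlue r σ s t = true) :
    (sub (atomVal r σ) g).IsChain fun x y => r x y = true := by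
  induction g with
  | nil => simp
  | cons s g ih =>
    rw [sub_cons, List.isChain_append]
    refine ⟨?_, ih (fun t ht => hm t (by simp [ht])) (fun t ht => hn t (by simp [ht])) hc.tail, ?_⟩
    · have := isChain_atomVal r σ s.1 (hm s (by simp))
      obtain ⟨a, _ | _⟩ := s
      · exact isChain_invRev hr this
      · exact this
    · intro x hx y hy
      cases g with
      | nil => simp at hy
      | cons t g =>
        rw [sub_cons, List.head?_append_of_ne_nil _ (img_ne_nil (hn t (by simp)))] at hy
        obtain ⟨x', hx', y', hy', hxy⟩ := atomGlue_eq_true.1 (List.isChain_cons_cons.1 hc).1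
        rw [Option.mem_unique hx hx', Option.mem_unique hy hy']
        exact hxy

/-- The groups of an atomized word are middle parts, or consist of constants and popped factors;
the value of the latter is a single factor. -/
theorem group_cases (hr : ∀ x y, r (flip y) (flip x) = r x y) {w : SW (D ⊕ X)}
    {g : SW (Atom D X)} (hg : g ∈ (sub (atomize r σ) w).splitBy (atomGlue r σ)) :
    (∃ x b, g = [(mid x, b)]) ∨ ((∀ s ∈ g, ¬ s.1.IsMid) ∧ sub (atomVal r σ) g ≠ [] ∧
      (sub (atomVal r σ) g).IsChain (fun x y => r x y = true) ∧
      (sub (atomVal r σ) g).splitBy r = [sub (atomVal r σ) g]) := by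
  have hne := List.ne_nil_of_mem_splitBy hg
  have hmem : ∀ s ∈ g, s ∈ sub (atomize r σ) w := by
    intro s hs
    rw [← List.flatten_splitBy (atomGlue r σ) (sub (atomize r σ) w)]
    exact List.mem_flatten.2 ⟨g, hg, hs⟩
  have hc := List.isChain_of_mem_splitBy hg
  have hM : g.IsChain (MidUnglued r σ) := by
    have := (isChain_atomize (σ := σ) hr w).1
    rw [← List.flatten_splitBy (atomGlue r σ) (sub (atomize r σ) w)] at this
    exact ((List.isChain_flatten (List.nil_notMem_splitBy _ _)).1 this).1 g hg
  by_cases hmid : ∀ s ∈ g, ¬ s.1.IsMid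
  · right
    have hn : ∀ s ∈ g, atomVal r σ s.1 ≠ [] := fun s hs => atomVal_ne_nil r σ (hmem s hs)
    have h1 : sub (atomVal r σ) g ≠ [] := by
      obtain ⟨s, g', rfl⟩ := List.exists_cons_of_ne_nil hne
      rw [sub_cons]
      intro h
      exact img_ne_nil (hn s (by simp)) (List.append_eq_nil_iff.1 h).1
    have h2 := isChain_sub_atomVal hr hmid hn hc
    exact ⟨hmid, h1, h2, List.splitBy_of_isChain h1 h2⟩
  · left
    push Not at hmid
    obtain ⟨s, hs, hsm⟩ := hmid
    match g, hc, hM, hs with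
    | [t], _, _, hs =>
      rw [List.mem_singleton] at hs
      subst hs
      obtain ⟨a, b⟩ := s
      cases a with
      | mid x => exact ⟨x, b, rfl⟩
      | const d => simp at hsm
      | cut x e => simp at hsm
    | t :: u :: g', hc, hM, hs =>
      exfalso
      -- In a group of at least two atoms each atom is glued to a neighbour, which is impossible for
      -- a middle part.
      have key : ∀ (l : SW (Atom D X)) t, (t :: l).IsChain (fun s t => atomGlue r σ s t = true) →
          (t :: l).IsChain (MidUnglued r σ) → l ≠ [] → ∀ s ∈ t :: l, ¬ s.1.IsMid := by
        intro l
        induction l with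
        | nil => simp
        | cons u l ih =>
          intro t hc hM _ s hs
          rw [List.isChain_cons_cons] at hc hM
          have := hM.1 hc.1
          rw [List.mem_cons] at hs
          rcases hs with rfl | hs
          · exact this.1
          · cases l with
            | nil =>
              rw [List.mem_singleton] at hs
              subst hs
              exact this.2
            | cons v l => exact ih u hc.2 hM.2 (by simp) s hs
      exact key _ t hc hM (by simp) s hs hsm

end Uncross

/-! ## Compression: renaming the visible factors -/

section Names

variable {D P : Type*}

open Classical in
/-- A system of names: the factors in a finite set, and their inverses, can be named by signed
letters from a large enough pool, compatibly with inversion. -/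
theorem exists_names [Countable D] [Nonempty D] (V : Finset (SW D)) (hV : ∀ f ∈ V, invRev f ≠ f) (pool : P → D)
    (hpool : pool.Injective) [Fintype P] (hcard : V.card ≤ Fintype.card P) :
    ∃ (U : Set D) (h : SSub D) (N : SW D → D × Bool),
      U ⊆ Set.range pool ∧ (∀ d ∉ U, h d = [(d, true)]) ∧
      (∀ d ∈ U, ∃ f, (f ∈ V ∨ invRev f ∈ V) ∧ h d = f) ∧
      (∀ f, f ∈ V ∨ invRev f ∈ V → img h (N f) = f ∧ N (invRev f) = flip (N f) ∧ (N f).1 ∈ U) := by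
  obtain ⟨key, hkey⟩ := exists_injective_nat (SW D)
  -- Of a factor and its inverse, the one with the smaller key represents both. It is named by a
  -- positive pool letter and its inverse by the same letter with negative sign; this is consistent
  -- because no factor in `V` is its own inverse.
  let nrm : SW D → SW D := fun f => if key f < key (invRev f) then f else invRev f
  have hnrm : ∀ f, nrm (invRev f) = nrm f := by
    intro f
    by_cases hf : invRev f = f
    · rw [hf]
    · have hk : key f ≠ key (invRev f) := fun h => hf (hkey h).symm
      simp only [nrm, FreeGroup.invRev_invRev]
      split_ifs <;> first | rfl | omega
  let V' : Finset (SW D) := V.image nrm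
  have hV' : V'.card ≤ Fintype.card P := Finset.card_image_le.trans hcard
  obtain ⟨e⟩ : Nonempty (V' ↪ P) := Function.Embedding.nonempty_of_card_le (by simpa using hV')
  have hmem : ∀ f, f ∈ V ∨ invRev f ∈ V → nrm f ∈ V' := by
    rintro f (hf | hf)
    · exact Finset.mem_image_of_mem _ hf
    · rw [← hnrm]; exact Finset.mem_image_of_mem _ hf
  have hback : ∀ f ∈ V', f ∈ V ∨ invRev f ∈ V := by
    intro f hf
    obtain ⟨g, hg, rfl⟩ := Finset.mem_image.1 hf
    simp only [nrm]
    split_ifs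
    · exact Or.inl hg
    · right; simpa using hg
  let h : SSub D := fun d => if hd : ∃ f : V', pool (e f) = d then hd.choose.1 else [(d, true)]
  have hh : ∀ f : V', h (pool (e f)) = f := by
    intro f
    have hd : ∃ f' : V', pool (e f') = pool (e f) := ⟨f, rfl⟩
    simp only [h, dif_pos hd]
    exact congrArg _ (e.injective (hpool hd.choose_spec))
  let nm : SW D → D := fun f => if hf : f ∈ V' then pool (e ⟨f, hf⟩) else Classical.arbitrary D
  have hnm : ∀ f (hf : f ∈ V'), nm f = pool (e ⟨f, hf⟩) := fun f hf => dif_pos hf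
  let N : SW D → D × Bool := fun f => (nm (nrm f), decide (key f < key (invRev f)))
  refine ⟨Set.range fun f : V' => pool (e f), h, N, ?_, ?_, ?_, ?_⟩
  · rintro _ ⟨f, rfl⟩; exact ⟨_, rfl⟩
  · intro d hd
    exact dif_neg hd
  · rintro _ ⟨f, rfl⟩
    exact ⟨f, hback _ f.2, hh f⟩
  · intro f hf
    have hfr : invRev f ≠ f := by
      rcases hf with hf | hf
      · exact hV f hf
      · intro h'; exact hV _ hf (by rw [FreeGroup.invRev_invRev]; exact h'.symm)
    have hk : key f ≠ key (invRev f) := fun h => hfr (hkey h).symm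
    have hm := hmem f hf
    refine ⟨?_, ?_, ?_⟩
    · simp only [N, hnm _ hm, img, hh]
      simp only [nrm]
      by_cases hlt : key f < key (invRev f) <;> simp [hlt]
    · simp only [N, hnrm, flip_mk, FreeGroup.invRev_invRev, Prod.mk.injEq, true_and]
      by_cases hlt : key f < key (invRev f)
      · simp [hlt, hlt.le]
      · have : key (invRev f) < key f := by omega
        simp [this, this.le]
    · exact ⟨⟨_, hm⟩, (hnm _ hm).symm⟩

end Names

/-! ### Compression of a system along a given solution -/

section Compression

open Atom

variable {D X B P : Type*}

/-- A group of atoms is replaced by a variable or by a letter that `h` expands to its value. -/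
def AtomMatch (h : SSub D) (v : Atom D X → SW D) (s : (D ⊕ X) × Bool) (g : SW (Atom D X)) : Prop :=
  (∃ x b, s = (Sum.inr x, b) ∧ g = [(mid x, b)]) ∨
  (∃ d b, s = (Sum.inl d, b) ∧ (∀ a ∈ g, ¬ a.1.IsMid) ∧ (∀ a ∈ g, v a.1 ≠ []) ∧
    sub v g = img h (d, b))

/-- The groups of glued atoms of a word. -/
noncomputable def groups (r : D × Bool → D × Bool → Bool) (σ : X → SW D) (w : SW (D ⊕ X)) :
    List (SW (Atom D X)) :=
  (sub (atomize r σ) w).splitBy (atomGlue r σ)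

/-- The letters of the words `W j` and of the values of the variables. -/
def lettersOf {J : Type*} (W : J → SW (D ⊕ X)) (σ : X → SW D) : Set D :=
  {d | (∃ j, ∃ s ∈ W j, s.1 = Sum.inl d) ∨ ∃ x, ∃ s ∈ σ x, s.1 = d}

theorem mem_splitBy_of_mem {A : Type*} {r : A → A → Bool} {w f : List A} (hf : f ∈ w.splitBy r)
    {s : A} (hs : s ∈ f) : s ∈ w := by
  rw [← List.flatten_splitBy r w]
  exact List.mem_flatten.2 ⟨f, hf, hs⟩

theorem fst_mem_of_mem_atomVal {r : D × Bool → D × Bool → Bool} {σ : X → SW D} {x : X}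
    {a : Atom D X × Bool} (ha : a ∈ shape r σ x) {s : D × Bool} (hs : s ∈ atomVal r σ a.1) :
    s ∈ σ x := by
  have : a.2 = true := by
    rcases shape_cases r σ x with ⟨_, h, _⟩ | ⟨f, _, h, _⟩ | ⟨f, g, _, h, _⟩ |
      ⟨f, m, g, _, _, h, _⟩ <;> simp only [h, List.mem_cons, List.not_mem_nil, or_false] at ha
    · exact ha ▸ rfl
    · rcases ha with rfl | rfl <;> rfl
    · rcases ha with rfl | rfl | rfl <;> rfl
  rw [← sub_atomVal_shape r σ x]
  refine List.mem_flatMap.2 ⟨a, ha, ?_⟩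
  simpa [img, this] using hs

theorem mem_lettersOf_of_group {J : Type*} {r : D × Bool → D × Bool → Bool}
    {W : J → SW (D ⊕ X)} {σ : X → SW D} {j : J} {g : SW (Atom D X)} (hg : g ∈ groups r σ (W j))
    {s : D × Bool} (hs : s ∈ sub (atomVal r σ) g) : s.1 ∈ lettersOf W σ := by
  obtain ⟨a, ha, t, ht, hts⟩ := mem_sub hs
  obtain ⟨⟨d | x, b⟩, hw, a', ha', haa⟩ := mem_sub (mem_splitBy_of_mem hg ha)
  · left
    simp only [atomize, Sum.elim_inl, letter, List.mem_singleton] at ha'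
    rw [← haa, ha'] at ht
    simp only [atomVal, List.mem_singleton] at ht
    refine ⟨j, _, hw, ?_⟩
    rw [← hts, ht]
  · right
    rw [← haa] at ht
    exact ⟨x, t, fst_mem_of_mem_atomVal ha' ht, hts⟩

open Classical in
/-- **Compression.** All visible factors of the solution are replaced by letters from the pool. -/
theorem exists_compression {J : Type*} [Fintype J] [Countable D] [Nonempty D] [Fintype P]
    (r : D × Bool → D × Bool → Bool) (hr : ∀ x y, r (flip y) (flip x) = r x y)
    (hs : ∀ x, r x (flip x) = false) (W : J → SW (D ⊕ X)) (σ : X → SW D)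
    (base : B → D) (α : D → SW B) (hα : ∀ b, α (base b) = [(b, true)])
    (pool : P → D) (hpool : pool.Injective) (hbp : ∀ b p, base b ≠ pool p)
    (hcard : ∑ j, (groups r σ (W j)).length ≤ Fintype.card P) :
    ∃ (U : Set D) (h : SSub D) (σ' : X → SW D) (W' : J → SW (D ⊕ X)),
      U ⊆ Set.range pool ∧ (∀ d ∉ U, h d = [(d, true)]) ∧
      (∀ d ∈ U, h d ≠ [] ∧ (h d).IsChain (fun x y => r x y = true) ∧
        ∀ s ∈ h d, s.1 ∈ lettersOf W σ) ∧
      (∀ j, List.Forall₂ (AtomMatch h (atomVal r σ)) (W' j) (groups r σ (W j))) ∧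
      (∀ j j', sub (Sum.elim (letter id) σ) (W j) = sub (Sum.elim (letter id) σ) (W j') →
        sub (Sum.elim (letter id) σ') (W' j) = sub (Sum.elim (letter id) σ') (W' j')) ∧
      (∀ j, sub α (sub h (sub (Sum.elim (letter id) σ') (W' j))) =
        sub α (sub (Sum.elim (letter id) σ) (W j))) ∧
      (∀ x, sub α (sub h (σ' x)) = sub α (atomVal r σ (mid x))) ∧
      (∀ j, ∀ s ∈ W' j, ∀ d, s.1 = Sum.inl d → d ∈ U) ∧
      (∀ x, ∀ s ∈ σ' x, s.1 ∈ U ∨ s.1 ∈ Set.range base) := by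
  -- The visible factors are the values of the groups without middle part. Each group needs at most
  -- one name, whence the bound `hcard`.
  let vis : J → List (SW D) := fun j =>
    ((groups r σ (W j)).filter fun g => ∀ s ∈ g, ¬ s.1.IsMid).map (sub (atomVal r σ))
  let V : Finset (SW D) := Finset.univ.biUnion fun j => (vis j).toFinset
  have hVcard : V.card ≤ Fintype.card P := by
    refine (Finset.card_biUnion_le.trans (Finset.sum_le_sum fun j _ => ?_)).trans hcard
    refine (List.toFinset_card_le _).trans ?_
    simp only [vis, List.length_map]
    exact List.length_filter_le _ _
  have hVmem : ∀ f, f ∈ V ↔ ∃ j, ∃ g ∈ groups r σ (W j), (∀ s ∈ g, ¬ s.1.IsMid) ∧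
      sub (atomVal r σ) g = f := by
    intro f
    simp [V, vis, and_assoc]
  have hchain : ∀ f ∈ V, f ≠ [] ∧ f.IsChain (fun x y => r x y = true) := by
    intro f hf
    obtain ⟨j, g, hg, hm, rfl⟩ := (hVmem f).1 hf
    rcases group_cases hr hg with ⟨x, b, rfl⟩ | ⟨_, h1, h2, _⟩
    · exact absurd (isMid_mid x) (hm _ (List.mem_singleton_self _))
    · exact ⟨h1, h2⟩
  obtain ⟨U, h, N, hU, hid, himg, hN⟩ := exists_names V
    (fun f hf => invRev_ne_of_isChain hs (hchain f hf).1 (hchain f hf).2) pool hpool hVcard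
  have hbase : ∀ b, h (base b) = [(base b, true)] := by
    intro b
    apply hid
    intro hb
    obtain ⟨p, hp⟩ := hU hb
    exact hbp b p hp.symm
  -- the new form of a factor
  let ρ : SW D → SW D := fun f =>
    -- A factor without a name occurs only inside variables. Spelling it out in basic letters
    -- removes all letters of the old pool, which can therefore be used again by the next
    -- compression.
    if f ∈ V ∨ invRev f ∈ V then [N f] else sub (letter base) (sub α f)
  let R : SW D → SW D := fun w => (w.splitBy r).flatMap ρ
  have hρ : ∀ f, ρ (invRev f) = invRev (ρ f) := by
    intro f
    have hiff : (invRev f ∈ V ∨ invRev (invRev f) ∈ V) ↔ (f ∈ V ∨ invRev f ∈ V) := by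
      rw [FreeGroup.invRev_invRev, or_comm]
    by_cases hf : f ∈ V ∨ invRev f ∈ V
    · simp only [ρ, if_pos hf, if_pos (hiff.2 hf), (hN f hf).2.1]
      rfl
    · simp only [ρ, if_neg hf, if_neg (fun h => hf (hiff.1 h)), sub_invRev]
  have hR : ∀ w, R (invRev w) = invRev (R w) := by
    intro w
    simp only [R, splitBy_invRev hr]
    generalize w.splitBy r = l
    induction l with
    | nil => rfl
    | cons a l ih =>
      simp only [List.map_cons, List.reverse_cons, List.flatMap_append, ih, List.flatMap_cons,
        List.flatMap_nil, List.append_nil, hρ, FreeGroup.invRev_append]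
  have hα' : ∀ u : SW B, sub α (sub (letter base) u) = u := by
    intro u
    rw [sub_sub_letter]
    simp only [hα]
    exact sub_letter_id u
  have hρα : ∀ f, sub α (sub h (ρ f)) = sub α f := by
    intro f
    by_cases hf : f ∈ V ∨ invRev f ∈ V
    · simp only [ρ, if_pos hf, sub_singleton, (hN f hf).1]
    · simp only [ρ, if_neg hf]
      rw [sub_sub_letter]
      simp only [hbase]
      exact hα' _
  have hRα : ∀ w, sub α (sub h (R w)) = sub α w := by
    intro w
    conv_rhs => rw [← List.flatten_splitBy r w]
    simp only [R]
    generalize w.splitBy r = l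
    induction l with
    | nil => rfl
    | cons a l ih =>
      simp only [List.flatMap_cons, sub_append, hρα, ih, List.flatten_cons]
  let σ' : X → SW D := fun x => R (atomVal r σ (mid x))
  let toSym : SW (Atom D X) → (D ⊕ X) × Bool := fun g =>
    match g with
    | [(mid x, b)] => (Sum.inr x, b)
    | g => (Sum.inl (N (sub (atomVal r σ) g)).1, (N (sub (atomVal r σ) g)).2)
  have htoSym : ∀ g : SW (Atom D X), (∀ s ∈ g, ¬ s.1.IsMid) → toSym g =
      (Sum.inl (N (sub (atomVal r σ) g)).1, (N (sub (atomVal r σ) g)).2) := by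
    intro g hg
    simp only [toSym]
    split
    · exact absurd (isMid_mid _) (hg _ (List.mem_singleton_self _))
    · rfl
  have hval : ∀ j, ∀ g ∈ groups r σ (W j), img (Sum.elim (letter id) σ') (toSym g) =
      R (sub (atomVal r σ) g) := by
    intro j g hg
    rcases group_cases hr hg with ⟨x, b, rfl⟩ | ⟨h0, h1, h2, h3⟩
    · cases b
      · simp [toSym, σ', hR]
      · simp [toSym, σ']
    · rw [htoSym g h0]
      have hV' : sub (atomVal r σ) g ∈ V := (hVmem _).2 ⟨j, g, hg, h0, rfl⟩
      simp only [R, h3, List.flatMap_cons, List.flatMap_nil, List.append_nil, ρ, if_pos (Or.inl hV')]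
      generalize N (sub (atomVal r σ) g) = n
      obtain ⟨d, _ | _⟩ := n <;> rfl
  -- The new value is `R` applied to the old value, so words with equal values before have equal
  -- values afterwards.
  have hW' : ∀ j, sub (Sum.elim (letter id) σ') ((groups r σ (W j)).map toSym) =
      R (sub (Sum.elim (letter id) σ) (W j)) := by
    intro j
    rw [← sub_atomVal_atomize r σ (W j)]
    simp only [R]
    rw [splitBy_sub_atomVal fun s hs => atomVal_ne_nil r σ hs, List.flatMap_assoc]
    change List.flatMap _ (List.map _ _) = _
    rw [List.flatMap_map]
    exact List.flatMap_congr fun g hg => hval j g hg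
  refine ⟨U, h, σ', fun j => (groups r σ (W j)).map toSym, hU, hid, ?_, ?_, ?_, ?_, ?_, ?_, ?_⟩
  · intro d hd
    obtain ⟨f, hf, hfd⟩ := himg d hd
    have key : ∀ f ∈ V, ∀ s ∈ f, s.1 ∈ lettersOf W σ := by
      intro f hf s hs
      obtain ⟨j, g, hg, hm, rfl⟩ := (hVmem f).1 hf
      exact mem_lettersOf_of_group hg hs
    rw [hfd]
    rcases hf with hf | hf
    · exact ⟨(hchain f hf).1, (hchain f hf).2, key f hf⟩
    · have := isChain_invRev hr (hchain _ hf).2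
      rw [FreeGroup.invRev_invRev] at this
      refine ⟨fun h0 => (hchain _ hf).1 (by simp [h0]), this, fun s hs => ?_⟩
      have := key _ hf (flip s) (by rw [mem_invRev]; simpa using hs)
      exact this
  · intro j
    rw [List.forall₂_map_left_iff, List.forall₂_same]
    intro g hg
    rcases group_cases hr hg with ⟨x, b, rfl⟩ | ⟨h0, h1, h2, h3⟩
    · exact Or.inl ⟨x, b, rfl, rfl⟩
    · right
      have hV' : sub (atomVal r σ) g ∈ V := (hVmem _).2 ⟨j, g, hg, h0, rfl⟩
      refine ⟨_, _, htoSym g h0, h0, fun a ha => ?_, ?_⟩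
      · exact atomVal_ne_nil r σ (mem_splitBy_of_mem hg ha)
      · exact (hN _ (Or.inl hV')).1.symm
  · intro j j' hjj
    simp only [hW', hjj]
  · intro j
    rw [hW', hRα]
  · intro x
    exact hRα _
  · intro j s hs d hd
    obtain ⟨g, hg, rfl⟩ := List.mem_map.1 hs
    rcases group_cases hr hg with ⟨x, b, rfl⟩ | ⟨h0, h1, h2, h3⟩
    · simp [toSym] at hd
    · rw [htoSym g h0] at hd
      have hV' : sub (atomVal r σ) g ∈ V := (hVmem _).2 ⟨j, g, hg, h0, rfl⟩
      rw [← Sum.inl.inj hd]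
      exact (hN _ (Or.inl hV')).2.2
  · intro x s hs'
    obtain ⟨f, hf, hsf⟩ := List.mem_flatMap.1 hs'
    by_cases hfV : f ∈ V ∨ invRev f ∈ V
    · simp only [ρ, if_pos hfV, List.mem_singleton] at hsf
      subst hsf
      exact Or.inl (hN f hfV).2.2
    · simp only [ρ, if_neg hfV] at hsf
      right
      rw [sub_letter] at hsf
      obtain ⟨t, _, rfl⟩ := List.mem_map.1 hsf
      exact ⟨_, rfl⟩

end Compression

/-! ## Systems of words with variables -/

section Expansion

open Atom

variable {D X J : Type*}

/-- Expansion of the letters; the variables are fixed. -/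
def letterMap (h : SSub D) : D ⊕ X → SW (D ⊕ X) :=
  Sum.elim (fun d => sub (letter Sum.inl) (h d)) (letter Sum.inr)

/-- Substitution of the variables; the letters are fixed. -/
def varMap (τ : X → SW (D ⊕ X)) : D ⊕ X → SW (D ⊕ X) := Sum.elim (letter Sum.inl) τ

/-- `W` becomes the expansion of `W'` under `h` after a substitution of its variables. -/
def Expands (W W' : J → SW (D ⊕ X)) (h : SSub D) : Prop :=
  ∃ τ : X → SW (D ⊕ X), ∀ j, sub (letterMap h) (W' j) = sub (varMap τ) (W j)

theorem Expands.refl (W : J → SW (D ⊕ X)) : Expands W W 1 := by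
  refine ⟨letter Sum.inr, fun j => sub_congr ?_⟩
  rintro ⟨d | x, b⟩ _
  · rfl
  · rfl

/-- The required substitution expands the values of `τ'` by `h` and inserts them into the values of
`τ`. -/
theorem Expands.trans {W W' W'' : J → SW (D ⊕ X)} {h h' : SSub D} (H : Expands W W' h)
    (H' : Expands W' W'' h') : Expands W W'' (h * h') := by
  obtain ⟨τ, hτ⟩ := H
  obtain ⟨τ', hτ'⟩ := H'
  have e1 : ∀ w : SW (D ⊕ X), sub (letterMap (h * h')) w = sub (letterMap h) (sub (letterMap h') w) := by
    intro w
    rw [sub_sub]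
    apply sub_congr
    rintro ⟨d | x, b⟩ _
    · simp only [letterMap, Sum.elim_inl, SSub.mul_apply, sub_sub_letter]
      rw [sub_sub]
    · simp [letterMap, letter]
  have e2 : ∀ w : SW (D ⊕ X), sub (letterMap h) (sub (varMap τ') w) =
      sub (varMap fun x => sub (letterMap h) (τ' x)) (sub (letterMap h) w) := by
    intro w
    rw [sub_sub, sub_sub]
    apply sub_congr
    rintro ⟨d | x, b⟩ _
    · simp only [letterMap, varMap, Sum.elim_inl, sub_sub_letter]
      simp [letter]
      rfl
    · simp [letterMap, varMap, letter]
  refine ⟨fun x => sub (varMap fun x => sub (letterMap h) (τ' x)) (τ x), fun j => ?_⟩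
  rw [e1, hτ', e2, hτ, sub_sub]
  apply sub_congr
  rintro ⟨d | x, b⟩ _
  · simp [varMap, letter]
  · simp [varMap]

/-- Values of the atoms, keeping the middle parts as variables. -/
def keepMid (v : Atom D X → SW D) : Atom D X → SW (D ⊕ X)
  | mid x => [(Sum.inr x, true)]
  | a => sub (letter Sum.inl) (v a)

/-- Each variable is replaced by the values of its popped factors around a middle part that remains
a variable; then both sides agree group by group. Since `v` need not come from a solution, this
applies equally to freely chosen exponents. -/
theorem expands_of_groups {W W' : J → SW (D ⊕ X)} {h : SSub D} (v : Atom D X → SW D)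
    (hv : ∀ d, v (const d) = [(d, true)]) (shp : X → SW (Atom D X))
    (γ : J → List (SW (Atom D X)))
    (hγ : ∀ j, (γ j).flatten = sub (Sum.elim (letter const) shp) (W j))
    (hM : ∀ j, List.Forall₂ (fun s g => (∃ x b, s = (Sum.inr x, b) ∧ g = [(mid x, b)]) ∨
      (∃ d b, s = (Sum.inl d, b) ∧ (∀ a ∈ g, ¬ a.1.IsMid) ∧ sub v g = img h (d, b)))
        (W' j) (γ j)) : Expands W W' h := by
  refine ⟨fun x => sub (keepMid v) (shp x), fun j => ?_⟩
  have h1 : sub (varMap fun x => sub (keepMid v) (shp x)) (W j) =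
      sub (keepMid v) (γ j).flatten := by
    rw [hγ, sub_sub]
    apply sub_congr
    rintro ⟨d | x, b⟩ _
    · simp [varMap, letter, keepMid, hv]
    · simp [varMap]
  rw [h1]
  have := hM j
  generalize W' j = w at this
  generalize γ j = l at this
  induction this with
  | nil => rfl
  | @cons s g w l hsg _ ih =>
    rw [sub_cons, List.flatten_cons, sub_append, ih]
    congr 1
    rcases hsg with ⟨x, b, rfl, rfl⟩ | ⟨d, b, rfl, hm, hd⟩
    · cases b <;> rfl
    · have : sub (keepMid v) g = sub (letter Sum.inl) (sub v g) := by
        rw [sub_sub]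
        apply sub_congr
        rintro ⟨a, b⟩ ha
        have := hm _ ha
        cases a with
        | mid x => simp at this
        | const d => rfl
        | cut x e => rfl
      rw [this, hd, sub_img]
      cases b <;> simp [letterMap]

end Expansion

/-! ### Counting letters, variables and adjacent pairs -/

section Count

open Atom

variable {D X J : Type*}

/-- The number of occurrences of variables. -/
def numVars (w : SW (D ⊕ X)) : ℕ := w.countP fun s => s.1.isRight

/-- The number of adjacent pairs with a given property. -/
def adjCount {A : Type*} (q : A → A → Bool) : List A → ℕ
  | s :: t :: l => (if q s t then 1 else 0) + adjCount q (t :: l)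
  | _ => 0

/-- Two letters are glued. -/
def constGlue (r : D × Bool → D × Bool → Bool) (s t : (D ⊕ X) × Bool) : Bool :=
  match s, t with
  | (Sum.inl d, b), (Sum.inl d', b') => r (d, b) (d', b')
  | _, _ => false

/-- A variable contributes at most three atoms instead of one, which costs `2 * numVars w`; each
glued pair of adjacent letters saves one group. -/
theorem length_groups_le (r : D × Bool → D × Bool → Bool) (σ : X → SW D) (w : SW (D ⊕ X)) :
    (groups r σ w).length + adjCount (constGlue r) w ≤ w.length + 2 * numVars w := by
  have h1 : ∀ s : (D ⊕ X) × Bool,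
      (img (atomize r σ) s).length ≤ 1 + 2 * if s.1.isRight then 1 else 0 := by
    rintro ⟨d | x, b⟩
    · simp [length_img, atomize, letter]
    · simpa [length_img, atomize] using length_shape_le r σ x
  have h2 : ∀ (s : (D ⊕ X) × Bool) (l : SW (D ⊕ X)), (groups r σ (s :: l)).length ≤
      (1 + 2 * if s.1.isRight then 1 else 0) + (groups r σ l).length := by
    intro s l
    rw [groups, sub_cons]
    refine (length_splitBy_append_le _ _).trans ?_
    exact Nat.add_le_add ((length_splitBy_le _).trans (h1 s)) le_rfl
  induction w with
  | nil => simp [groups, adjCount]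
  | cons s w ih =>
    have hn : numVars (s :: w) = numVars w + if s.1.isRight then 1 else 0 := by
      simp [numVars, List.countP_cons]
    rw [hn, List.length_cons]
    cases w with
    | nil =>
      have := h2 s []
      simp [groups, adjCount, numVars] at this ⊢
      omega
    | cons t l =>
      rw [adjCount]
      have := h2 s (t :: l)
      by_cases hg : constGlue r s t = true
      · rw [if_pos hg]
        obtain ⟨d | x, b⟩ := s
        · obtain ⟨d' | x', b'⟩ := t
          · have e : groups r σ ((Sum.inl d, b) :: (Sum.inl d', b') :: l) =
                ((const d, b) :: (const d', b') :: sub (atomize r σ) l).splitBy (atomGlue r σ) := by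
              cases b <;> cases b' <;> rfl
            have e' : groups r σ ((Sum.inl d', b') :: l) =
                ((const d', b') :: sub (atomize r σ) l).splitBy (atomGlue r σ) := by
              cases b' <;> rfl
            have hg' : atomGlue r σ (const d, b) (const d', b') = true := by
              rw [atomGlue_eq_true]
              cases b <;> cases b' <;> simpa [atomVal, FreeGroup.invRev, constGlue] using hg
            rw [e, length_splitBy_cons_cons hg', ← e']
            simp at ih ⊢
            omega
          · simp [constGlue] at hg
        · simp [constGlue] at hg
      · rw [if_neg hg]
        simp only [List.length_cons] at ih ⊢
        omega

open Classical in
-- Only middle parts remain variables, and a pattern has at most one middle part.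
theorem numVars_le_of_match {r : D × Bool → D × Bool → Bool} {σ : X → SW D} {h : SSub D}
    {w w' : SW (D ⊕ X)}
    (hM : List.Forall₂ (AtomMatch h (atomVal r σ)) w' (groups r σ w)) :
    numVars w' ≤ numVars w := by
  let c : SW (Atom D X) → ℕ := List.countP fun a => decide a.1.IsMid
  have h1 : numVars w' ≤ c (groups r σ w).flatten := by
    generalize groups r σ w = l at hM
    induction hM with
    | nil => simp [numVars]
    | @cons s g w l hsg _ ih =>
      simp only [numVars, c, List.countP_cons, List.flatten_cons, List.countP_append] at ih ⊢
      rcases hsg with ⟨x, b, rfl, rfl⟩ | ⟨d, b, rfl, _⟩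
      · simp only [Sum.isRight_inr, List.countP_cons, List.countP_nil, isMid_mid, decide_true,
          if_true]
        omega
      · simp only [Sum.isRight_inl, Bool.false_eq_true, if_false]
        omega
  refine h1.trans ?_
  clear h1 hM
  rw [groups, List.flatten_splitBy]
  induction w with
  | nil => simp [numVars, c]
  | cons s w ih =>
    rw [sub_cons]
    simp only [c, numVars, List.countP_append, List.countP_cons] at ih ⊢
    have : List.countP (fun a => decide a.1.IsMid) (img (atomize r σ) s) ≤
        if s.1.isRight = true then 1 else 0 := by
      have hb : ∀ u : SW (Atom D X), List.countP (fun a => decide a.1.IsMid) (invRev u) =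
          List.countP (fun a => decide a.1.IsMid) u := by
        intro u
        rw [invRev_eq, List.countP_reverse, List.countP_map]
        rfl
      obtain ⟨d | x, b⟩ := s
      · cases b <;> simp [atomize, letter, FreeGroup.invRev]
      · have : List.countP (fun a => decide a.1.IsMid) (shape r σ x) ≤ 1 := by
          rcases shape_cases r σ x with ⟨_, h, _⟩ | ⟨f, _, h, _⟩ | ⟨f, g, _, h, _⟩ |
            ⟨f, m, g, _, _, h, _⟩ <;> simp [h]
        cases b <;> simpa [atomize, hb] using this
    omega

/-- Consecutive letters of a compressed word expand to unglued words. -/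
theorem isChain_of_match {r : D × Bool → D × Bool → Bool} {σ : X → SW D} {h : SSub D}
    {w w' : SW (D ⊕ X)}
    (hM : List.Forall₂ (AtomMatch h (atomVal r σ)) w' (groups r σ w)) :
    w'.IsChain fun s t => ∀ d b d' b', s = (Sum.inl d, b) → t = (Sum.inl d', b') →
      Unglued r (img h (d, b)) (img h (d', b')) := by
  have hu := isChain_unglued_splitBy (r := atomGlue r σ) (sub (atomize r σ) w)
  have hn := List.nil_notMem_splitBy (atomGlue r σ) (sub (atomize r σ) w)
  change (groups r σ w).IsChain _ at hu
  change [] ∉ groups r σ w at hn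
  generalize groups r σ w = l at hM hu hn
  induction hM with
  | nil => simp
  | @cons s g w l hsg hM ih =>
    cases hM with
    | nil => simp
    | @cons t g' w l htg hM =>
      rw [List.isChain_cons_cons] at hu ⊢
      refine ⟨?_, ih hu.2 fun h => hn (List.mem_cons_of_mem _ h)⟩
      rintro d b d' b' rfl rfl
      rcases hsg with ⟨x, c, h1, -⟩ | ⟨_, _, h1, -, hgn, hg⟩
      · simp at h1
      rcases htg with ⟨x, c, h2, -⟩ | ⟨_, _, h2, -, hgn', hg'⟩
      · simp at h2
      cases h1
      cases h2
      rw [← hg, ← hg']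
      have hg0 : g ≠ [] := fun h => hn (by simp [h])
      have hg0' : g' ≠ [] := fun h => hn (by simp [h])
      obtain ⟨G, s, rfl⟩ : ∃ G s, g = G ++ [s] :=
        ⟨_, _, (List.dropLast_append_getLast hg0).symm⟩
      obtain ⟨t, G', rfl⟩ := List.exists_cons_of_ne_nil hg0'
      have := hu.1 s (by simp) t (by simp)
      rw [atomGlue_eq_false] at this
      intro x hx y hy
      rw [sub_append, sub_singleton,
        List.getLast?_append_of_ne_nil _ (img_ne_nil (hgn s (by simp)))] at hx
      rw [sub_cons, List.head?_append_of_ne_nil _ (img_ne_nil (hgn' t (by simp)))] at hy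
      exact this x hx y hy

/-- In a word with reduced image no letter with nonempty image is followed by its inverse. -/
theorem isChain_of_isReduced_sub {Y B : Type*} {f : Y → SW B} {w : SW Y}
    (h : FreeGroup.IsReduced (sub f w)) :
    w.IsChain fun s t => f s.1 ≠ [] → t ≠ flip s := by
  induction w with
  | nil => simp
  | cons s w ih =>
    cases w with
    | nil => simp
    | cons t w =>
      rw [List.isChain_cons_cons]
      refine ⟨?_, ih (h.infix ⟨img f s, [], by simp⟩)⟩
      rintro hs rfl
      have h' : FreeGroup.IsReduced (img f s ++ invRev (img f s)) :=
        h.infix ⟨[], sub f w, by simp [img_flip]⟩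
      obtain ⟨G, a, hG⟩ : ∃ G a, img f s = G ++ [a] :=
        ⟨_, _, (List.dropLast_append_getLast (img_ne_nil hs)).symm⟩
      rw [FreeGroup.IsReduced, List.isChain_append] at h'
      have := h'.2.2 a (by simp [hG]) (flip a) (by rw [head?_invRev, hG]; simp) rfl
      simp at this

/-- The gluing relation of pair compression: a letter whose sign is given by `ε` is glued to the
letters of the opposite kind. -/
def pairGlue [DecidableEq D] (ε : D → Bool) (s t : D × Bool) : Bool :=
  decide (s.2 = ε s.1 ∧ t.2 ≠ ε t.1 ∧ s.1 ≠ t.1)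

theorem pairGlue_flip [DecidableEq D] (ε : D → Bool) (s t : D × Bool) :
    pairGlue ε (flip t) (flip s) = pairGlue ε s t := by
  obtain ⟨d, b⟩ := s
  obtain ⟨d', b'⟩ := t
  by_cases hd : d = d'
  · simp [pairGlue, hd]
  · have hd' : ¬ d' = d := fun h => hd h.symm
    simp only [pairGlue, flip_mk, ne_eq, hd, hd', not_false_eq_true, and_true]
    cases b <;> cases b' <;> cases ε d <;> cases ε d' <;> rfl

theorem pairGlue_self [DecidableEq D] (ε : D → Bool) (s : D × Bool) :
    pairGlue ε s (flip s) = false := by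
  simp [pairGlue]

/-- The second of three consecutive glued letters would have to be a left partner and a right
partner at once. -/
theorem length_le_two_of_pairGlue [DecidableEq D] {ε : D → Bool} {w : SW D}
    (h : w.IsChain fun s t => pairGlue ε s t = true) : w.length ≤ 2 := by
  match w, h with
  | [], _ => simp
  | [_], _ => simp
  | [_, _], _ => simp
  | a :: b :: c :: l, h =>
    rw [List.isChain_cons_cons, List.isChain_cons_cons] at h
    have h1 := h.1
    have h2 := h.2.1
    simp only [pairGlue, decide_eq_true_eq] at h1 h2
    exact absurd h2.1 h1.2.1

/-- Changing `ε` at the two letters gives orbits of four sign functions, and exactly one in each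
orbit glues the pair. -/
theorem card_pairGlue [DecidableEq D] [Fintype D] {s t : D × Bool} (hst : s.1 ≠ t.1) :
    4 * ∑ ε : D → Bool, (if pairGlue ε s t then 1 else 0) = Fintype.card (D → Bool) := by
  obtain ⟨d, b⟩ := s
  obtain ⟨d', b'⟩ := t
  have hd : d ≠ d' := hst
  let fl : D → (D → Bool) → (D → Bool) := fun d ε => Function.update ε d (!ε d)
  have hfl : ∀ d, Function.Involutive (fl d) := by
    intro d ε
    simp [fl]
  have hsum : ∀ d (F : (D → Bool) → ℕ), ∑ ε, F (fl d ε) = ∑ ε, F ε := fun d F =>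
    Equiv.sum_comp ((hfl d).toPerm) F
  let F : (D → Bool) → ℕ := fun ε => if pairGlue ε (d, b) (d', b') then 1 else 0
  have h1 : ∀ ε, F ε + F (fl d ε) + (F (fl d' ε) + F (fl d (fl d' ε))) = 1 := by
    intro ε
    simp only [F, pairGlue, fl, hd, hd.symm, Function.update_self, ne_eq, not_false_eq_true,
      Function.update_of_ne, and_true]
    cases b <;> cases b' <;> cases ε d <;> cases ε d' <;> rfl
  have h2 : ∑ ε, (F ε + F (fl d ε) + (F (fl d' ε) + F (fl d (fl d' ε)))) = 4 * ∑ ε, F ε := by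
    rw [Finset.sum_add_distrib, Finset.sum_add_distrib, Finset.sum_add_distrib,
      hsum d F, hsum d' F, hsum d' (fun ε => F (fl d ε)), hsum d F]
    ring
  rw [← h2, Finset.sum_congr rfl fun ε _ => h1 ε]
  simp

/-- The number of adjacent pairs of letters. -/
def constPairs (w : SW (D ⊕ X)) : ℕ := adjCount (constGlue fun _ _ => true) w

/-- A nonempty word has one adjacency less than its length, and each occurrence of a variable spoils
at most two of them. -/
theorem length_le_constPairs (w : SW (D ⊕ X)) :
    w.length ≤ constPairs w + 1 + 2 * numVars w := by
  have key : ∀ (w : SW (D ⊕ X)) s, (s :: w).length + (if s.1.isRight then 1 else 0) ≤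
      constPairs (s :: w) + 1 + 2 * numVars (s :: w) := by
    intro w
    induction w with
    | nil =>
      rintro ⟨d | x, b⟩ <;> simp [constPairs, adjCount, numVars]
    | cons t w ih =>
      intro s
      have := ih t
      have hn : numVars (s :: t :: w) = numVars (t :: w) + if s.1.isRight then 1 else 0 := by
        simp [numVars, List.countP_cons]
      have hp : constPairs (s :: t :: w) =
          (if constGlue (fun _ _ => true) s t then 1 else 0) + constPairs (t :: w) := rfl
      rw [hn, hp, List.length_cons]
      obtain ⟨d | x, b⟩ := s <;> obtain ⟨d' | x', b'⟩ := t <;>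
        simp only [constGlue, Sum.isRight_inl, Sum.isRight_inr, Bool.false_eq_true, if_true,
          if_false] at this ⊢ <;> omega
  cases w with
  | nil => simp
  | cons s w => have := key w s; omega

theorem sum_adjCount_pairGlue [DecidableEq D] [Fintype D] (w : SW (D ⊕ X))
    (hw : w.IsChain fun s t => ∀ d b d' b', s = (Sum.inl d, b) →
      t = (Sum.inl d', b') → d ≠ d') :
    4 * ∑ ε : D → Bool, adjCount (constGlue (pairGlue ε)) w =
      Fintype.card (D → Bool) * constPairs w := by
  induction w with
  | nil => simp [constPairs, adjCount]
  | cons s w ih =>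
    cases w with
    | nil => simp [constPairs, adjCount]
    | cons t w =>
      rw [List.isChain_cons_cons] at hw
      have hsum : ∑ ε : D → Bool, adjCount (constGlue (pairGlue ε)) (s :: t :: w) =
          (∑ ε : D → Bool, if constGlue (pairGlue ε) s t then 1 else 0) +
            ∑ ε : D → Bool, adjCount (constGlue (pairGlue ε)) (t :: w) := by
        rw [← Finset.sum_add_distrib]
        rfl
      have hp : constPairs (s :: t :: w) =
          (if constGlue (fun _ _ => true) s t then 1 else 0) + constPairs (t :: w) := rfl
      rw [hsum, hp, mul_add, mul_add, ih hw.2]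
      congr 1
      obtain ⟨d | x, b⟩ := s <;> obtain ⟨d' | x', b'⟩ := t
      · have := card_pairGlue (s := (d, b)) (t := (d', b')) (hw.1 d b d' b' rfl rfl)
        change 4 * ∑ ε : D → Bool, (if pairGlue ε (d, b) (d', b') = true then 1 else 0) =
          _ * (if true = true then 1 else 0)
        rw [if_pos rfl, mul_one]
        exact this
      all_goals simp [constGlue]

/-- Some choice of signs glues a quarter of the adjacent pairs of letters. -/
theorem exists_pairGlue [DecidableEq D] [Fintype D] [Fintype J] (W : J → SW (D ⊕ X))
    (hW : ∀ j, (W j).IsChain fun s t => ∀ d b d' b', s = (Sum.inl d, b) →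
      t = (Sum.inl d', b') → d ≠ d') :
    ∃ ε : D → Bool, ∑ j, (W j).length ≤
      4 * ∑ j, adjCount (constGlue (pairGlue ε)) (W j) + Fintype.card J + 2 * ∑ j, numVars (W j) := by
  have h1 : ∑ j, (W j).length ≤ ∑ j, constPairs (W j) + Fintype.card J + 2 * ∑ j, numVars (W j) := by
    refine (Finset.sum_le_sum fun j _ => length_le_constPairs (W j)).trans ?_
    rw [Finset.sum_add_distrib, Finset.sum_add_distrib, Finset.mul_sum]
    simp
  have h2 : ∑ ε : D → Bool, 4 * ∑ j, adjCount (constGlue (pairGlue ε)) (W j) =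
      ∑ _ε : D → Bool, ∑ j, constPairs (W j) := by
    rw [← Finset.mul_sum, Finset.sum_comm, Finset.mul_sum,
      Finset.sum_congr rfl fun j _ => sum_adjCount_pairGlue (W j) (hW j), ← Finset.mul_sum]
    simp
  obtain ⟨ε, -, hε⟩ := Finset.exists_le_of_sum_le (s := (Finset.univ : Finset (D → Bool)))
    Finset.univ_nonempty h2.ge
  exact ⟨ε, by omega⟩

end Count

/-! ## Rounds of block and pair compression -/

section Round

open Atom

variable {D X J B P : Type*} [Fintype J]

/-- A system `W` with a solution `σ` whose words have the reduced meaning `α (σ (W j))`; the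
letters in use are basic or belong to one of the two pools. -/
structure Solved (base : B → D) (pool : Bool → P → D) (E : J → J → Prop) (N : ℕ) (e : Bool)
    (W : J → SW (D ⊕ X)) (σ : X → SW D) (α : D → SW B) : Prop where
  map_base : ∀ b, α (base b) = [(b, true)]
  ne_nil : ∀ d, α d ≠ []
  letters : ∀ d ∈ lettersOf W σ, (∃ b, d = base b) ∨ ∃ p, d = pool e p
  eqs : ∀ j j', E j j' → sub (Sum.elim (letter id) σ) (W j) = sub (Sum.elim (letter id) σ) (W j')
  reduced : ∀ j, FreeGroup.IsReduced (sub α (sub (Sum.elim (letter id) σ) (W j)))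
  vars : ∑ j, numVars (W j) ≤ N

/-- The total length of the meanings of the variables. -/
def weight [Fintype X] (σ : X → SW D) (α : D → SW B) : ℕ := ∑ x, (sub α (σ x)).length

/-- What one compression of a solved system with respect to `r` yields. -/
structure Compressed (base : B → D) (r : D × Bool → D × Bool → Bool) (W : J → SW (D ⊕ X))
    (σ : X → SW D) (U : Set D) (h : SSub D) (W' : J → SW (D ⊕ X)) : Prop where
  base_notMem : ∀ b, base b ∉ U
  of_notMem : ∀ d ∉ U, h d = [(d, true)]
  ne_nil : ∀ d ∈ U, h d ≠ []
  isChain : ∀ d ∈ U, (h d).IsChain (fun x y => r x y = true)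
  letters : ∀ d ∈ U, ∀ s ∈ h d, s.1 ∉ U
  isMatch : ∀ j, List.Forall₂ (AtomMatch h (atomVal r σ)) (W' j) (groups r σ (W j))
  distinct : ∀ j, (W' j).IsChain fun s t => ∀ d b d' b', s = (Sum.inl d, b) →
    t = (Sum.inl d', b') → (d, b') ≠ (d', !b)
  mem : ∀ j, ∀ s ∈ W' j, ∀ d, s.1 = Sum.inl d → d ∈ U

/-- Names are taken from the other pool, so no new letter occurs in the expansion of a new letter.
Reducedness enters in `distinct`: adjacent inverse letters would cancel in the value. The weight
drops because a nonempty variable loses its first factor, whose meaning is nonempty. -/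
theorem Solved.exists_compressed [Countable D] [Nonempty D] [Fintype P] [Fintype X]
    {base : B → D} {pool : Bool → P → D} (hpool : ∀ e, (pool e).Injective)
    (hbp : ∀ b e p, base b ≠ pool e p) (hpp : ∀ e p p', pool e p ≠ pool (!e) p')
    {E : J → J → Prop} {N : ℕ} {e : Bool} {W : J → SW (D ⊕ X)} {σ : X → SW D} {α : D → SW B}
    (S : Solved base pool E N e W σ α) (r : D × Bool → D × Bool → Bool)
    (hr : ∀ x y, r (flip y) (flip x) = r x y) (hs : ∀ x, r x (flip x) = false)
    (hcard : ∑ j, (groups r σ (W j)).length ≤ Fintype.card P) :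
    ∃ (U : Set D) (h : SSub D) (σ' : X → SW D) (W' : J → SW (D ⊕ X)),
      Compressed base r W σ U h W' ∧ Solved base pool E N (!e) W' σ' (fun d => sub α (h d)) ∧
      (∀ j, sub α (sub h (sub (Sum.elim (letter id) σ') (W' j))) =
        sub α (sub (Sum.elim (letter id) σ) (W j))) ∧
      weight σ' (fun d => sub α (h d)) ≤ weight σ α ∧
      ((∃ x, σ x ≠ []) → weight σ' (fun d => sub α (h d)) < weight σ α) := by
  obtain ⟨U, h, σ', W', hU, hid, hh, hM, heq, hα, hmid, hW', hσ'⟩ :=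
    exists_compression r hr hs W σ base α S.map_base (pool !e) (hpool _) (fun b p => hbp b _ p) hcard
  have hbU : ∀ b, base b ∉ U := by
    intro b hb
    obtain ⟨p, hp⟩ := hU hb
    exact hbp b _ p hp.symm
  have hne : ∀ d, h d ≠ [] := by
    intro d
    by_cases hd : d ∈ U
    · exact (hh d hd).1
    · simp [hid d hd]
  have hne' : ∀ w : SW D, w ≠ [] → sub α w ≠ [] := by
    intro w hw h0
    obtain ⟨s, w, rfl⟩ := List.exists_cons_of_ne_nil hw
    rw [sub_cons, List.append_eq_nil_iff] at h0
    exact img_ne_nil (S.ne_nil s.1) h0.1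
  have hcomp : ∀ w, sub (fun d => sub α (h d)) w = sub α (sub h w) := fun w => (sub_sub _ _ _).symm
  have hred : ∀ j, FreeGroup.IsReduced
      (sub (fun d => sub α (h d)) (sub (Sum.elim (letter id) σ') (W' j))) := by
    intro j
    rw [hcomp, hα]
    exact S.reduced j
  have hlen : ∀ x, (sub (fun d => sub α (h d)) (σ' x)).length ≤ (sub α (σ x)).length ∧
      (σ x ≠ [] → (sub (fun d => sub α (h d)) (σ' x)).length < (sub α (σ x)).length) := by
    intro x
    rw [hcomp, hmid]
    have hn := List.nil_notMem_splitBy r (σ x)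
    have hfl := List.flatten_splitBy r (σ x)
    rcases shape_cases r σ x with ⟨h1, _, h2⟩ | ⟨f, h1, _, _, h2⟩ | ⟨f, g, h1, _, _, _, h2⟩ |
      ⟨f, m, g, _, h1, _, _, _, h2⟩
    · rw [h1] at hfl
      simp [h2, ← hfl]
    all_goals
      rw [h1] at hn hfl
      have hf : f ≠ [] := by rintro rfl; simp at hn
      have := List.length_pos_iff.2 (hne' f hf)
      rw [h2, ← hfl]
      simp only [List.flatten_cons, List.flatten_append, sub_append, List.length_append, sub_nil,
        List.length_nil]
      omega
  refine ⟨U, h, σ', W', ⟨hbU, hid, fun d hd => (hh d hd).1, fun d hd => (hh d hd).2.1, ?_, hM, ?_,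
    hW'⟩, ⟨?_, ?_, ?_, fun j j' hj => heq j j' (S.eqs j j' hj), hred, ?_⟩, hα, ?_, ?_⟩
  · intro d hd s hs' hsU
    obtain ⟨p, hp⟩ := hU hsU
    rcases S.letters _ ((hh d hd).2.2 s hs') with ⟨b, hb⟩ | ⟨p', hp'⟩
    · exact hbp b _ p (hb.symm.trans hp.symm)
    · exact hpp e p' p (hp'.symm.trans hp.symm)
  · intro j
    have := hred j
    rw [sub_sub] at this
    refine (isChain_of_isReduced_sub this).imp ?_
    rintro s t hst d b d' b' rfl rfl hd
    have h1 : sub (fun d => sub α (h d)) (letter id d) ≠ [] := by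
      simp only [letter, sub_singleton, img_true]
      exact hne' _ (hne d)
    refine hst h1 ?_
    simp only [Prod.mk.injEq] at hd
    simp [SW.flip, hd.1, hd.2]
  · intro b
    simp [hid _ (hbU b), S.map_base]
  · intro d
    exact hne' _ (hne d)
  · rintro d (⟨j, s, hs', hd⟩ | ⟨x, s, hs', rfl⟩)
    · obtain ⟨p, hp⟩ := hU (hW' j s hs' d hd)
      exact Or.inr ⟨p, hp.symm⟩
    · rcases hσ' x s hs' with hd | ⟨b, hb⟩
      · obtain ⟨p, hp⟩ := hU hd
        exact Or.inr ⟨p, hp.symm⟩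
      · exact Or.inl ⟨b, hb.symm⟩
  · exact (Finset.sum_le_sum fun j _ => numVars_le_of_match (hM j)).trans S.vars
  · exact Finset.sum_le_sum fun x _ => (hlen x).1
  · rintro ⟨x, hx⟩
    exact Finset.sum_lt_sum (fun x _ => (hlen x).1) ⟨x, Finset.mem_univ x, (hlen x).2 hx⟩

open Classical in
/-- The gluing relation of block compression. -/
noncomputable def blockGlue (s t : D × Bool) : Bool := decide (s = t)

theorem blockGlue_flip (s t : D × Bool) : blockGlue (flip t) (flip s) = blockGlue s t := by
  have : flip t = flip s ↔ s = t := by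
    constructor
    · intro h
      have := congrArg SW.flip h
      simpa using this.symm
    · rintro rfl; rfl
  simp [blockGlue, this]

theorem blockGlue_self (s : D × Bool) : blockGlue s (flip s) = false := by
  simp only [blockGlue, decide_eq_false_iff_not]
  exact fun h => flip_ne s h.symm

theorem eq_replicate_of_blockGlue {w : SW D} (hn : w ≠ [])
    (h : w.IsChain fun s t => blockGlue s t = true) :
    ∃ z, w = List.replicate w.length z := by
  obtain ⟨z, w, rfl⟩ := List.exists_cons_of_ne_nil hn
  refine ⟨z, ?_⟩
  simp only [blockGlue, decide_eq_true_eq] at h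
  rw [List.isChain_cons_eq_iff_eq_replicate] at h
  rw [List.length_cons, List.replicate_succ, ← h]

/-- One round: block compression followed by pair compression. -/
theorem Solved.exists_round [Finite D] [Nonempty D] [Fintype P] [Fintype X]
    {base : B → D} {pool : Bool → P → D} (hpool : ∀ e, (pool e).Injective)
    (hbp : ∀ b e p, base b ≠ pool e p) (hpp : ∀ e p p', pool e p ≠ pool (!e) p')
    {E : J → J → Prop} {N : ℕ} {W : J → SW (D ⊕ X)} {σ : X → SW D} {α : D → SW B}
    (S : Solved base pool E N false W σ α) (hW : ∑ j, (W j).length ≤ 16 * N + Fintype.card J)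
    (hP : 20 * N + Fintype.card J ≤ Fintype.card P) (hσ : ∃ x, σ x ≠ []) :
    ∃ (U₁ : Set D) (h₁ : SSub D) (W₁ : J → SW (D ⊕ X)) (r : D × Bool → D × Bool → Bool)
      (σ₁ : X → SW D) (U₂ : Set D) (h₂ : SSub D) (W₂ : J → SW (D ⊕ X)) (σ₂ : X → SW D)
      (α₂ : D → SW B),
      Compressed base blockGlue W σ U₁ h₁ W₁ ∧
      Compressed base r W₁ σ₁ U₂ h₂ W₂ ∧ (∀ d, (h₂ d).length ≤ 2) ∧
      ∑ j, (W₁ j).length ≤ 18 * N + Fintype.card J ∧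
      ∑ j, (W₂ j).length ≤ 16 * N + Fintype.card J ∧
      Solved base pool E N false W₂ σ₂ α₂ ∧
      (∀ d, α₂ d = sub α (sub h₁ (h₂ d))) ∧
      (∀ j, sub α₂ (sub (Sum.elim (letter id) σ₂) (W₂ j)) =
        sub α (sub (Sum.elim (letter id) σ) (W j))) ∧
      weight σ₂ α₂ < weight σ α := by
  classical
  have := Fintype.ofFinite D
  have hgr : ∀ (r : D × Bool → D × Bool → Bool) (σ : X → SW D) (W : J → SW (D ⊕ X)),
      ∑ j, (groups r σ (W j)).length + ∑ j, adjCount (constGlue r) (W j) ≤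
        ∑ j, (W j).length + 2 * ∑ j, numVars (W j) := by
    intro r σ W
    rw [Finset.mul_sum, ← Finset.sum_add_distrib, ← Finset.sum_add_distrib]
    exact Finset.sum_le_sum fun j _ => length_groups_le r σ (W j)
  have hv := S.vars
  have hg1 := hgr blockGlue σ W
  obtain ⟨U₁, h₁, σ₁, W₁, C₁, S₁, hα₁, -, hw₁⟩ := S.exists_compressed hpool hbp hpp blockGlue
    blockGlue_flip blockGlue_self (by omega)
  have hl₁ : ∑ j, (W₁ j).length ≤ 18 * N + Fintype.card J := by
    rw [Finset.sum_congr rfl fun j _ => (C₁.isMatch j).length_eq]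
    omega
  -- After block compression neighbouring letters have different names. Equal names with opposite
  -- signs contradict reducedness; with equal signs they would expand to two adjacent powers of one
  -- signed letter, and these would be glued.
  have hdist : ∀ j, (W₁ j).IsChain fun s t => ∀ d b d' b', s = (Sum.inl d, b) →
      t = (Sum.inl d', b') → d ≠ d' := by
    intro j
    have h1 := C₁.distinct j
    have h2 := isChain_of_match (C₁.isMatch j)
    have hm := C₁.mem j
    rw [List.isChain_iff_getElem] at h1 h2 ⊢
    intro i hi d b d' b' hs ht hd
    subst hd
    have h1' := h1 i hi d b d b' hs ht
    have hb : b' = b := by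
      by_contra hb
      apply h1'
      cases b <;> cases b' <;> simp at hb ⊢
    subst hb
    have h2' := h2 i hi d b' d b' hs ht
    have hdU : d ∈ U₁ := hm _ (List.getElem_mem (l := W₁ j) (n := i) (by omega)) d (by rw [hs])
    obtain ⟨z, hz⟩ := eq_replicate_of_blockGlue (C₁.ne_nil d hdU) (C₁.isChain d hdU)
    obtain ⟨n, hn⟩ : ∃ n, (h₁ d).length = n + 1 :=
      ⟨_, (Nat.succ_pred_eq_of_pos (List.length_pos_iff.2 (C₁.ne_nil d hdU))).symm⟩
    rw [hn] at hz
    obtain ⟨z', hz'⟩ : ∃ z', img h₁ (d, b') = List.replicate (n + 1) z' := by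
      cases b'
      · exact ⟨flip z, by rw [img_false, hz, invRev_replicate]⟩
      · exact ⟨z, hz⟩
    rw [hz'] at h2'
    have := h2' z' (by simp [List.getLast?_replicate]) z' (by simp [List.head?_replicate])
    simp [blockGlue] at this
  obtain ⟨ε, hε⟩ := exists_pairGlue W₁ hdist
  have hg2 := hgr (pairGlue ε) σ₁ W₁
  have hv₁ := S₁.vars
  obtain ⟨U₂, h₂, σ₂, W₂, C₂, S₂, hα₂, hw₂, -⟩ := S₁.exists_compressed hpool hbp hpp (pairGlue ε)
    (pairGlue_flip ε) (pairGlue_self ε) (by omega)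
  -- If `l₁` and `l₂` are the total lengths of `W₁` and `W₂`, then `l₂ ≤ l₁ + 2 * N - (l₁ - |J| - 2
  -- * N) / 4`, and `l₁ ≤ 18 * N + |J|` reproduces the bound `16 * N + |J|`. Both compressions need
  -- at most `20 * N + |J|` names.
  have hl₂ : ∑ j, (W₂ j).length ≤ 16 * N + Fintype.card J := by
    rw [Finset.sum_congr rfl fun j _ => (C₂.isMatch j).length_eq]
    have := Finset.sum_congr rfl fun j (_ : j ∈ Finset.univ) => (C₁.isMatch j).length_eq
    omega
  refine ⟨U₁, h₁, W₁, pairGlue ε, σ₁, U₂, h₂, W₂, σ₂, _, C₁, C₂, ?_, hl₁, hl₂, S₂, ?_, ?_,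
    hw₂.trans_lt (hw₁ hσ)⟩
  · intro d
    by_cases hd : d ∈ U₂
    · exact length_le_two_of_pairGlue (C₂.isChain d hd)
    · simp [C₂.of_notMem d hd]
  · intro d
    exact (sub_sub _ _ _).symm
  · intro j
    rw [← hα₁ j]
    exact ((sub_sub _ _ _).symm.trans (hα₂ j)).trans (sub_sub _ _ _).symm

end Round

/-! ## Closure properties of rational sets -/

namespace MonoidNFA

variable {M N : Type*} [Monoid M] [Monoid N]

theorem Path.single {𝒜 : MonoidNFA M} {p q : 𝒜.State} {a : M} (h : (p, a, q) ∈ 𝒜.edges) :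
    𝒜.Path p a q := by
  have := Path.cons h (Path.nil q)
  rwa [mul_one] at this

theorem Path.trans {𝒜 : MonoidNFA M} {p q r : 𝒜.State} {a b : M} (h : 𝒜.Path p a q)
    (h' : 𝒜.Path q b r) : 𝒜.Path p (a * b) r := by
  induction h with
  | nil p => rwa [one_mul]
  | cons he _ ih => rw [mul_assoc]; exact Path.cons he (ih h')

end MonoidNFA

open MonoidNFA

/-- `R` is accepted by an automaton with labels in `P`. -/
def RatIn {M : Type*} [Monoid M] (P R : Set M) : Prop :=
  ∃ 𝒜 : MonoidNFA M, (∀ p a q, (p, a, q) ∈ 𝒜.edges → a ∈ P) ∧ 𝒜.accepted = R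

/-- Products of elements of `R p q` along the paths of the complete graph on `Q`. -/
inductive ChainProd {M Q : Type*} [Monoid M] (R : Q → Q → Set M) : Q → M → Q → Prop
  | nil (p : Q) : ChainProd R p 1 p
  | cons {p q r : Q} {a m : M} : a ∈ R p q → ChainProd R q m r → ChainProd R p (a * m) r

namespace RatIn

variable {M N : Type*} [Monoid M] [Monoid N] {P R : Set M}

/-- Each pair of vertices receives a copy of the automaton for its label set, entered and left by
edges labelled `1`. In this way a finite graph may carry infinite rational sets of labels. -/
theorem chainProd {Q : Type} [Finite Q] {R : Q → Q → Set M} (h1 : 1 ∈ P)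
    (hR : ∀ p q, RatIn P (R p q)) (I F : Set Q) :
    RatIn P {m | ∃ p ∈ I, ∃ q ∈ F, ChainProd R p m q} := by
  choose 𝒜 hP h𝒜 using hR
  have hfin : ∀ p q, Finite (𝒜 p q).State := fun p q => (𝒜 p q).finState
  let E1 : Set ((Q ⊕ Σ pq : Q × Q, (𝒜 pq.1 pq.2).State) × M ×
      (Q ⊕ Σ pq : Q × Q, (𝒜 pq.1 pq.2).State)) :=
    {e | ∃ p q, ∃ s ∈ (𝒜 p q).initial, e = (Sum.inl p, 1, Sum.inr ⟨(p, q), s⟩)}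
  let E2 : Set ((Q ⊕ Σ pq : Q × Q, (𝒜 pq.1 pq.2).State) × M ×
      (Q ⊕ Σ pq : Q × Q, (𝒜 pq.1 pq.2).State)) :=
    {e | ∃ p q, ∃ s a t, (s, a, t) ∈ (𝒜 p q).edges ∧
      e = (Sum.inr ⟨(p, q), s⟩, a, Sum.inr ⟨(p, q), t⟩)}
  let E3 : Set ((Q ⊕ Σ pq : Q × Q, (𝒜 pq.1 pq.2).State) × M ×
      (Q ⊕ Σ pq : Q × Q, (𝒜 pq.1 pq.2).State)) :=
    {e | ∃ p q, ∃ s ∈ (𝒜 p q).final, e = (Sum.inr ⟨(p, q), s⟩, 1, Sum.inl q)}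
  have f1 : E1.Finite := by
    refine (Set.finite_range fun x : (Σ pq : Q × Q, (𝒜 pq.1 pq.2).State) =>
      ((Sum.inl x.1.1, 1, Sum.inr x) : _ × M × _)).subset ?_
    rintro _ ⟨p, q, s, _, rfl⟩
    exact ⟨⟨(p, q), s⟩, rfl⟩
  have f3 : E3.Finite := by
    refine (Set.finite_range fun x : (Σ pq : Q × Q, (𝒜 pq.1 pq.2).State) =>
      ((Sum.inr x, 1, Sum.inl x.1.2) : _ × M × _)).subset ?_
    rintro _ ⟨p, q, s, _, rfl⟩
    exact ⟨⟨(p, q), s⟩, rfl⟩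
  have f2 : E2.Finite := by
    refine (Set.finite_iUnion fun pq : Q × Q => ((𝒜 pq.1 pq.2).finEdges.image fun e =>
      ((Sum.inr ⟨pq, e.1⟩, e.2.1, Sum.inr ⟨pq, e.2.2⟩) :
        (Q ⊕ Σ pq : Q × Q, (𝒜 pq.1 pq.2).State) × M × _))).subset ?_
    rintro _ ⟨p, q, s, a, t, he, rfl⟩
    exact Set.mem_iUnion.2 ⟨(p, q), ⟨(s, a, t), he, rfl⟩⟩
  let ℬ : MonoidNFA M :=
    { State := Q ⊕ Σ pq : Q × Q, (𝒜 pq.1 pq.2).State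
      edges := E1 ∪ E2 ∪ E3
      finEdges := (f1.union f2).union f3
      initial := Sum.inl '' I
      final := Sum.inl '' F }
  refine ⟨ℬ, ?_, ?_⟩
  · rintro p a q ((⟨p, q, s, _, he⟩ | ⟨p, q, s, a, t, he', he⟩) | ⟨p, q, s, _, he⟩)
    · rw [Prod.mk.injEq, Prod.mk.injEq] at he
      rw [he.2.1]; exact h1
    · rw [Prod.mk.injEq, Prod.mk.injEq] at he
      rw [he.2.1]; exact hP _ _ _ _ _ he'
    · rw [Prod.mk.injEq, Prod.mk.injEq] at he
      rw [he.2.1]; exact h1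
  -- A path that starts inside a copy is split into the rest of the current factor and the factors
  -- that follow.
  have sound : ∀ x m y, ℬ.Path x m y → ∀ r, y = Sum.inl r →
      (∀ p, x = Sum.inl p → ChainProd R p m r) ∧
      (∀ p q s, x = Sum.inr ⟨(p, q), s⟩ → ∃ a b f, f ∈ (𝒜 p q).final ∧ (𝒜 p q).Path s a f ∧
        ChainProd R q b r ∧ m = a * b) := by
    intro x m y h
    induction h with
    | nil x =>
      rintro r rfl
      refine ⟨?_, ?_⟩
      · intro p hp
        cases hp
        exact ChainProd.nil _
      · intro p q s hs
        cases hs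
    | @cons x y z a m he _ ih =>
      intro r hr
      obtain ⟨ih1, ih2⟩ := ih r hr
      rcases he with (⟨p, q, s, hs, he⟩ | ⟨p, q, s, a, t, he', he⟩) | ⟨p, q, s, hs, he⟩
      · cases he
        refine ⟨?_, fun p q s hs => by cases hs⟩
        intro p' hp'
        cases hp'
        obtain ⟨a, b, f, hf, hp, hc, rfl⟩ := ih2 p q s rfl
        rw [one_mul]
        refine ChainProd.cons ?_ hc
        rw [← h𝒜]
        exact ⟨s, hs, f, hf, hp⟩
      · cases he
        refine ⟨fun p hp => (by cases hp), ?_⟩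
        intro p' q' s' hs'
        cases hs'
        obtain ⟨a', b, f, hf, hp, hc, rfl⟩ := ih2 p q t rfl
        exact ⟨a * a', b, f, hf, MonoidNFA.Path.cons he' hp, hc, (mul_assoc _ _ _).symm⟩
      · cases he
        refine ⟨fun p hp => (by cases hp), ?_⟩
        intro p' q' s' hs'
        cases hs'
        exact ⟨1, m, s, hs, MonoidNFA.Path.nil _, ih1 q rfl, rfl⟩
  have lift : ∀ p q s a t, (𝒜 p q).Path s a t →
      ℬ.Path (Sum.inr ⟨(p, q), s⟩) a (Sum.inr ⟨(p, q), t⟩) := by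
    intro p q s a t h
    induction h with
    | nil => exact MonoidNFA.Path.nil _
    | cons he _ ih => exact MonoidNFA.Path.cons (Or.inl (Or.inr ⟨p, q, _, _, _, he, rfl⟩)) ih
  have complete : ∀ p m r, ChainProd R p m r → ℬ.Path (Sum.inl p) m (Sum.inl r) := by
    intro p m r h
    induction h with
    | nil => exact MonoidNFA.Path.nil _
    | @cons p q r a m ha _ ih =>
      rw [← h𝒜] at ha
      obtain ⟨s, hs, f, hf, hp⟩ := ha
      refine MonoidNFA.Path.trans ?_ ih
      have e1 : ((Sum.inl p : ℬ.State), (1 : M), (Sum.inr ⟨(p, q), s⟩ : ℬ.State)) ∈ ℬ.edges :=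
        Or.inl (Or.inl ⟨p, q, s, hs, rfl⟩)
      have e3 : ((Sum.inr ⟨(p, q), f⟩ : ℬ.State), (1 : M), (Sum.inl q : ℬ.State)) ∈ ℬ.edges :=
        Or.inr ⟨p, q, f, hf, rfl⟩
      have := (MonoidNFA.Path.cons e1 (lift _ _ _ _ _ hp)).trans (MonoidNFA.Path.single e3)
      rwa [one_mul, mul_one] at this
  ext m
  constructor
  · rintro ⟨_, ⟨p, hp, rfl⟩, _, ⟨q, hq, rfl⟩, h⟩
    exact ⟨p, hp, q, hq, (sound _ _ _ h q rfl).1 p rfl⟩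
  · rintro ⟨p, hp, q, hq, h⟩
    exact ⟨_, ⟨p, hp, rfl⟩, _, ⟨q, hq, rfl⟩, complete _ _ _ h⟩

theorem of_finite {S : Set M} (hS : S.Finite) (hP : S ⊆ P) : RatIn P S := by
  let 𝒜 : MonoidNFA M :=
    { State := Bool
      edges := (fun a => (false, a, true)) '' S
      finEdges := hS.image _
      initial := {false}
      final := {true} }
  refine ⟨𝒜, ?_, ?_⟩
  · rintro p a q ⟨b, hb, he⟩
    cases he
    exact hP hb
  · have key : ∀ p m q, 𝒜.Path p m q → (p = true → m = 1) ∧ (p = false → q = true → m ∈ S) := by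
      intro p m q h
      induction h with
      | nil p =>
        refine ⟨fun _ => rfl, ?_⟩
        intro h1 h2
        rw [h1] at h2
        cases h2
      | cons he _ ih =>
        obtain ⟨b, hb, he⟩ := he
        cases he
        refine ⟨fun h => (by cases h), fun _ _ => ?_⟩
        rw [ih.1 rfl, mul_one]
        exact hb
    ext m
    constructor
    · rintro ⟨p, rfl, q, rfl, h⟩
      exact (key _ _ _ h).2 rfl rfl
    · intro hm
      exact ⟨false, rfl, true, rfl, MonoidNFA.Path.single ⟨m, hm, rfl⟩⟩

theorem iUnion {ι : Type} [Finite ι] {R : ι → Set M} (h1 : 1 ∈ P) (hR : ∀ i, RatIn P (R i)) :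
    RatIn P (⋃ i, R i) := by
  let R' : Option ι → Option ι → Set M := fun p q =>
    match p, q with
    | none, some i => R i
    | _, _ => ∅
  have hR' : ∀ p q, RatIn P (R' p q) := by
    rintro (_ | p) (_ | q)
    · exact of_finite Set.finite_empty (Set.empty_subset _)
    · exact hR q
    · exact of_finite Set.finite_empty (Set.empty_subset _)
    · exact of_finite Set.finite_empty (Set.empty_subset _)
  have := chainProd h1 hR' {none} (Set.range some)
  convert this using 1
  ext m
  rw [Set.mem_iUnion]
  constructor
  · rintro ⟨i, hi⟩
    refine ⟨none, rfl, some i, ⟨i, rfl⟩, ?_⟩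
    have := ChainProd.cons (R := R') (p := none) (q := some i) hi (ChainProd.nil _)
    rwa [mul_one] at this
  · rintro ⟨_, rfl, _, ⟨i, rfl⟩, h⟩
    cases h with
    | @cons _ q _ a m ha h =>
      cases q with
      | none => exact ha.elim
      | some j =>
        cases h with
        | nil => exact ⟨i, by rw [mul_one]; exact ha⟩
        | @cons _ q' _ b m hb _ => cases q' <;> exact hb.elim

theorem union {R R' : Set M} (h1 : 1 ∈ P) (h : RatIn P R) (h' : RatIn P R') :
    RatIn P (R ∪ R') := by
  rw [Set.union_eq_iUnion]
  exact iUnion h1 fun b => by cases b <;> assumption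

theorem biUnion {ι : Type*} {s : Set ι} (hs : s.Finite) {R : ι → Set M} (h1 : 1 ∈ P)
    (hR : ∀ i ∈ s, RatIn P (R i)) : RatIn P (⋃ i ∈ s, R i) := by
  induction s, hs using Set.Finite.induction_on with
  | empty => simpa using of_finite Set.finite_empty (Set.empty_subset _)
  | @insert a s _ _ ih =>
    rw [Set.biUnion_insert]
    exact union h1 (hR a (by simp)) (ih fun i hi => hR i (by simp [hi]))

theorem mul_closure {a : M} {S : Set M} (h1 : 1 ∈ P) (ha : a ∈ P) (hS : S.Finite) (hP : S ⊆ P) :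
    RatIn P ((fun m => a * m) '' (Submonoid.closure S : Set M)) := by
  let R' : Bool → Bool → Set M := fun p q =>
    match p, q with
    | false, true => {a}
    | true, true => S
    | _, _ => ∅
  have hR' : ∀ p q, RatIn P (R' p q) := by
    rintro (_ | _) (_ | _)
    · exact of_finite Set.finite_empty (Set.empty_subset _)
    · exact of_finite (Set.finite_singleton a) (Set.singleton_subset_iff.2 ha)
    · exact of_finite Set.finite_empty (Set.empty_subset _)
    · exact of_finite hS hP
  have := chainProd h1 hR' {false} {true}
  convert this using 1
  have key : ∀ p m q, ChainProd R' p m q → p = true → q = true → m ∈ Submonoid.closure S := by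
    intro p m q h
    induction h with
    | nil => intros; exact Submonoid.one_mem _
    | @cons p q r b m hb _ ih =>
      rintro rfl hr
      cases q with
      | false => exact hb.elim
      | true => exact Submonoid.mul_mem _ (Submonoid.subset_closure hb) (ih rfl hr)
  have key' : ∀ m ∈ Submonoid.closure S, ChainProd R' true m true := by
    intro m hm
    induction hm using Submonoid.closure_induction_left with
    | one => exact ChainProd.nil _
    | mul_left b hb m _ ih => exact ChainProd.cons (R := R') (q := true) hb ih
  ext m
  constructor
  · rintro ⟨b, hb, rfl⟩
    exact ⟨false, rfl, true, rfl, ChainProd.cons (R := R') (q := true) rfl (key' b hb)⟩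
  · rintro ⟨_, rfl, _, rfl, h⟩
    cases h with
    | @cons _ q _ b m hb h =>
      cases q with
      | false => exact hb.elim
      | true => exact ⟨m, key _ _ _ h rfl rfl, by rw [Set.mem_singleton_iff.1 hb]⟩

theorem map (f : M →* N) (h : RatIn P R) : RatIn (f '' P) (f '' R) := by
  obtain ⟨𝒜, hP, rfl⟩ := h
  have := 𝒜.finState
  let ℬ : MonoidNFA N :=
    { State := 𝒜.State
      edges := (fun e => (e.1, f e.2.1, e.2.2)) '' 𝒜.edges
      finEdges := 𝒜.finEdges.image _
      initial := 𝒜.initial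
      final := 𝒜.final }
  refine ⟨ℬ, ?_, ?_⟩
  · rintro p a q ⟨⟨p', a', q'⟩, he, h⟩
    cases h
    exact ⟨_, hP _ _ _ he, rfl⟩
  · have h1 : ∀ p m q, 𝒜.Path p m q → ℬ.Path p (f m) q := by
      intro p m q h
      induction h with
      | nil => rw [map_one]; exact MonoidNFA.Path.nil _
      | cons he _ ih => rw [map_mul]; exact MonoidNFA.Path.cons (𝒜 := ℬ) ⟨_, he, rfl⟩ ih
    have h2 : ∀ p n q, ℬ.Path p n q → ∃ m, f m = n ∧ 𝒜.Path p m q := by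
      intro p n q h
      induction h with
      | nil p => exact ⟨1, map_one f, MonoidNFA.Path.nil (𝒜 := 𝒜) p⟩
      | cons he _ ih =>
        obtain ⟨⟨p', a', q'⟩, he, h⟩ := he
        cases h
        obtain ⟨m, rfl, hm⟩ := ih
        exact ⟨a' * m, map_mul f _ _, MonoidNFA.Path.cons he hm⟩
    ext n
    constructor
    · rintro ⟨p, hp, q, hq, h⟩
      obtain ⟨m, rfl, hm⟩ := h2 _ _ _ h
      exact ⟨m, ⟨p, hp, q, hq, hm⟩, rfl⟩
    · rintro ⟨m, ⟨p, hp, q, hq, h⟩, rfl⟩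
      exact ⟨p, hp, q, hq, h1 _ _ _ h⟩

/-- Intersection with a recognizable set, given by a right action on a finite set. -/
theorem filter (h : RatIn P R) {S : Type} [Finite S] (act : S → M → S)
    (act_one : ∀ s, act s 1 = s) (act_mul : ∀ s a b, act s (a * b) = act (act s a) b) (s₀ : S)
    (F : Set S) : RatIn P {m ∈ R | act s₀ m ∈ F} := by
  obtain ⟨𝒜, hP, rfl⟩ := h
  have := 𝒜.finState
  let ℬ : MonoidNFA M :=
    { State := 𝒜.State × S
      edges := (fun x : (𝒜.State × M × 𝒜.State) × S =>
        ((x.1.1, x.2), x.1.2.1, (x.1.2.2, act x.2 x.1.2.1))) '' (𝒜.edges ×ˢ Set.univ)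
      finEdges := (𝒜.finEdges.prod Set.finite_univ).image _
      initial := 𝒜.initial ×ˢ {s₀}
      final := 𝒜.final ×ˢ F }
  refine ⟨ℬ, ?_, ?_⟩
  · rintro p a q ⟨⟨⟨p', a', q'⟩, s⟩, he, h⟩
    cases h
    exact hP _ _ _ he.1
  · have h1 : ∀ p m q, 𝒜.Path p m q → ∀ s, ℬ.Path (p, s) m (q, act s m) := by
      intro p m q h
      induction h with
      | nil => intro s; rw [act_one]; exact MonoidNFA.Path.nil _
      | cons he _ ih =>
        intro s
        rw [act_mul]
        exact MonoidNFA.Path.cons (𝒜 := ℬ) ⟨(_, s), ⟨he, trivial⟩, rfl⟩ (ih _)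
    have h2 : ∀ x m y, ℬ.Path x m y → 𝒜.Path x.1 m y.1 ∧ y.2 = act x.2 m := by
      intro x m y h
      induction h with
      | nil p => exact ⟨MonoidNFA.Path.nil _, (act_one _).symm⟩
      | cons he _ ih =>
        obtain ⟨⟨⟨p', a', q'⟩, s⟩, he, h⟩ := he
        cases h
        exact ⟨MonoidNFA.Path.cons he.1 ih.1, by rw [ih.2, act_mul]⟩
    ext m
    constructor
    · rintro ⟨⟨p, s⟩, ⟨hp, hs⟩, ⟨q, t⟩, ⟨hq, ht⟩, h⟩
      obtain ⟨h', hst⟩ := h2 _ _ _ h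
      simp only [Set.mem_singleton_iff] at hs hst ht
      subst hs hst
      exact ⟨⟨p, hp, q, hq, h'⟩, ht⟩
    · rintro ⟨⟨p, hp, q, hq, h⟩, hm⟩
      exact ⟨(p, s₀), ⟨hp, rfl⟩, (q, act s₀ m), Set.mk_mem_prod hq hm, h1 _ _ _ h s₀⟩

theorem exists_trim (h : RatIn P R) : ∃ 𝒜 : MonoidNFA M,
    (∀ p a q, (p, a, q) ∈ 𝒜.edges → a ∈ P) ∧ 𝒜.accepted = R ∧ 𝒜.IsTrim := by
  obtain ⟨𝒜, hP, rfl⟩ := h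
  have := 𝒜.finState
  let useful : 𝒜.State → Prop := fun q =>
    (∃ p ∈ 𝒜.initial, ∃ m, 𝒜.Path p m q) ∧ (∃ r ∈ 𝒜.final, ∃ m, 𝒜.Path q m r)
  let ℬ : MonoidNFA M :=
    { State := {q // useful q}
      edges := (fun e : {q // useful q} × M × {q // useful q} => (e.1.1, e.2.1, e.2.2.1)) ⁻¹'
        𝒜.edges
      finEdges := 𝒜.finEdges.preimage (by
        rintro ⟨p, a, q⟩ _ ⟨p', a', q'⟩ _ h
        simp only [Prod.mk.injEq] at h
        exact Prod.ext (Subtype.ext h.1) (Prod.ext h.2.1 (Subtype.ext h.2.2)))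
      initial := Subtype.val ⁻¹' 𝒜.initial
      final := Subtype.val ⁻¹' 𝒜.final }
  have h1 : ∀ p m q, 𝒜.Path p m q → ∀ (hp : useful p) (hq : useful q),
      ℬ.Path ⟨p, hp⟩ m ⟨q, hq⟩ := by
    intro p m q h
    induction h with
    | nil => intro hp hq; exact MonoidNFA.Path.nil _
    | @cons p q r a m he h ih =>
      intro hp hr
      have hq : useful q := by
        obtain ⟨p₀, hp₀, m₀, h₀⟩ := hp.1
        obtain ⟨r₀, hr₀, m₁, h₁⟩ := hr.2
        exact ⟨⟨p₀, hp₀, _, h₀.trans (MonoidNFA.Path.single he)⟩, ⟨r₀, hr₀, _, h.trans h₁⟩⟩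
      exact MonoidNFA.Path.cons (𝒜 := ℬ) (q := ⟨q, hq⟩) he (ih hq hr)
  have h2 : ∀ p m q, ℬ.Path p m q → 𝒜.Path p.1 m q.1 := by
    intro p m q h
    induction h with
    | nil => exact MonoidNFA.Path.nil _
    | cons he _ ih => exact MonoidNFA.Path.cons he ih
  refine ⟨ℬ, fun p a q he => hP _ _ _ he, ?_, ?_⟩
  · ext m
    constructor
    · rintro ⟨p, hp, q, hq, h⟩
      exact ⟨p.1, hp, q.1, hq, h2 _ _ _ h⟩
    · rintro ⟨p, hp, q, hq, h⟩
      have up : useful p := ⟨⟨p, hp, 1, MonoidNFA.Path.nil _⟩, ⟨q, hq, m, h⟩⟩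
      have uq : useful q := ⟨⟨p, hp, m, h⟩, ⟨q, hq, 1, MonoidNFA.Path.nil _⟩⟩
      exact ⟨⟨p, up⟩, hp, ⟨q, uq⟩, hq, h1 _ _ _ h up uq⟩
  · rintro ⟨q, hq⟩
    obtain ⟨p, hp, m, h⟩ := hq.1
    obtain ⟨r, hr, m', h'⟩ := hq.2
    have up : useful p := ⟨⟨p, hp, 1, MonoidNFA.Path.nil _⟩, ⟨r, hr, _, h.trans h'⟩⟩
    have ur : useful r := ⟨⟨p, hp, _, h.trans h'⟩, ⟨r, hr, 1, MonoidNFA.Path.nil _⟩⟩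
    exact ⟨⟨⟨p, up⟩, hp, m, h1 _ _ _ h up hq⟩, ⟨⟨r, ur⟩, hr, m', h1 _ _ _ h' hq ur⟩⟩

end RatIn

/-- Without directed cycles only finitely many elements are accepted. -/
theorem MonoidNFA.finite_accepted {M : Type*} [Monoid M] (𝒜 : MonoidNFA M) (h : ¬ 𝒜.HasCycle) :
    𝒜.accepted.Finite := by
  have := 𝒜.finState
  let r : 𝒜.State → 𝒜.State → Prop := fun q p => ∃ a, (p, a, q) ∈ 𝒜.edges
  have key : ∀ p q, Relation.TransGen r q p → ∃ q' a m, (p, a, q') ∈ 𝒜.edges ∧ 𝒜.Path q' m q := by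
    intro p q h
    induction h with
    | single h => obtain ⟨a, ha⟩ := h; exact ⟨_, a, 1, ha, MonoidNFA.Path.nil _⟩
    | tail _ h ih =>
      obtain ⟨a, ha⟩ := h
      obtain ⟨q', a', m, he, hp⟩ := ih
      exact ⟨_, a, _, ha, MonoidNFA.Path.cons he hp⟩
  have irr : Std.Irrefl (Relation.TransGen r) := ⟨fun p hp => h (by
    obtain ⟨q', a, m, he, hp⟩ := key p p hp
    exact ⟨p, q', a, m, he, hp⟩)⟩
  have wf : WellFounded (Relation.TransGen r) := Finite.wellFounded_of_trans_of_irrefl _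
  have fin : ∀ p, {m | ∃ q, 𝒜.Path p m q}.Finite := by
    intro p
    induction p using wf.induction with
    | _ p ih =>
      have : {m | ∃ q, 𝒜.Path p m q} ⊆ {1} ∪ ⋃ e ∈ {e ∈ 𝒜.edges | e.1 = p},
          (fun m => e.2.1 * m) '' {m | ∃ q, 𝒜.Path e.2.2 m q} := by
        rintro m ⟨q, hq⟩
        cases hq with
        | nil => exact Or.inl rfl
        | @cons _ q' _ a m he hp =>
          right
          simp only [Set.mem_iUnion]
          exact ⟨_, ⟨he, rfl⟩, m, ⟨q, hp⟩, rfl⟩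
      refine Set.Finite.subset ((Set.finite_singleton 1).union
        ((𝒜.finEdges.subset (Set.sep_subset _ _)).biUnion fun e he => (ih _ ?_).image _)) this
      exact Relation.TransGen.single ⟨e.2.1, by rw [← he.2]; exact he.1⟩
  refine (Set.finite_iUnion fun p => fin p).subset ?_
  rintro m ⟨p, _, q, _, h⟩
  exact Set.mem_iUnion.2 ⟨p, q, h⟩

/-! ## Block compression is described by rational sets of substitutions -/

/-- The substitutions that fix the basic letters. -/
def fixing {B D : Type*} (base : B → D) : Set (SSub D) := {h | ∀ b, h (base b) = [(base b, true)]}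

theorem one_mem_fixing {B D : Type*} (base : B → D) : (1 : SSub D) ∈ fixing base := fun _ => rfl

section BlockLabel

variable {D : Type*} (b : D → Option (D × Bool))

/-- The letters in the domain of `b` are expanded to powers. -/
def blockLabel (n : D → ℕ) : SSub D := fun d =>
  match b d with
  | none => [(d, true)]
  | some z => List.replicate (n d) z

/-- The letters in the domain of `b` receive powers on the left. -/
def blockStep (n : D → ℕ) : SSub D := fun d =>
  match b d with
  | none => [(d, true)]
  | some z => List.replicate (n d) z ++ [(d, true)]

variable {b}

/-- By `hb` the letters of the powers are fixed by block labels, so the exponents simply add. -/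
theorem blockLabel_mul_blockStep (hb : ∀ d z, b d = some z → b z.1 = none) (m n : D → ℕ) :
    blockLabel b m * blockStep b n = blockLabel b (m + n) := by
  funext d
  rw [SSub.mul_apply]
  cases hd : b d with
  | none => simp [blockStep, blockLabel, hd]
  | some z =>
    have hz : img (blockLabel b m) z = [z] := by
      obtain ⟨y, _ | _⟩ := z <;> simp [blockLabel, hb d _ hd, FreeGroup.invRev]
    have hrep : ∀ k, sub (blockLabel b m) (List.replicate k z) = List.replicate k z := by
      intro k
      induction k with
      | zero => rfl
      | succ k ih => rw [List.replicate_succ, sub_cons, ih, hz]; rfl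
    simp only [blockStep, hd, sub_append, hrep, sub_singleton, img_true]
    simp [blockLabel, hd, add_comm (m d)]

variable {K : Type*}

/-- The base point of the linear set gives one initial label, and each of its finitely many periods
gives a loop labelled by a `blockStep`. Additivity of exponents matches sums of periods with
products of loops. -/
theorem ratIn_blockLabel_linear {B : Type*} {base : B → D} (hb : ∀ d z, b d = some z → b z.1 = none)
    (hbase : ∀ x, b (base x) = none) (π : (K → ℕ) →+ (D → ℕ)) {T : Set (K → ℕ)}
    (hT : IsLinearSet T) : RatIn (fixing base) ((fun v => blockLabel b (π v)) '' T) := by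
  obtain ⟨a, t, ht, rfl⟩ := hT
  have hstep : ∀ n, blockStep b n ∈ fixing base := fun n x => by simp [blockStep, hbase]
  have hlab : ∀ n, blockLabel b n ∈ fixing base := fun n x => by simp [blockLabel, hbase]
  have := RatIn.mul_closure (one_mem_fixing base) (hlab (π a))
    (ht.image fun p => blockStep b (π p)) (by rintro _ ⟨p, _, rfl⟩; exact hstep _)
  convert this using 1
  have h1 : ∀ w ∈ AddSubmonoid.closure t,
      ∃ m ∈ Submonoid.closure ((fun p => blockStep b (π p)) '' t),
        ∀ v, blockLabel b v * m = blockLabel b (v + π w) := by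
    intro w hw
    induction hw using AddSubmonoid.closure_induction with
    | mem p hp =>
      exact ⟨_, Submonoid.subset_closure ⟨p, hp, rfl⟩, fun v => blockLabel_mul_blockStep hb _ _⟩
    | zero => exact ⟨1, Submonoid.one_mem _, fun v => by simp⟩
    | add x y _ _ hx hy =>
      obtain ⟨m, hm, hm'⟩ := hx
      obtain ⟨n, hn, hn'⟩ := hy
      refine ⟨m * n, Submonoid.mul_mem _ hm hn, fun v => ?_⟩
      rw [← mul_assoc, hm', hn', map_add, add_assoc]
  have h2 : ∀ m ∈ Submonoid.closure ((fun p => blockStep b (π p)) '' t),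
      ∃ w ∈ AddSubmonoid.closure t, ∀ v, blockLabel b v * m = blockLabel b (v + π w) := by
    intro w hw
    induction hw using Submonoid.closure_induction with
    | mem p hp =>
      obtain ⟨p, hp, rfl⟩ := hp
      exact ⟨p, AddSubmonoid.subset_closure hp, fun v => blockLabel_mul_blockStep hb _ _⟩
    | one => exact ⟨0, AddSubmonoid.zero_mem _, fun v => by simp⟩
    | mul x y _ _ hx hy =>
      obtain ⟨m, hm, hm'⟩ := hx
      obtain ⟨n, hn, hn'⟩ := hy
      refine ⟨m + n, AddSubmonoid.add_mem _ hm hn, fun v => ?_⟩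
      rw [← mul_assoc, hm', hn', map_add, add_assoc]
  ext h
  constructor
  · rintro ⟨_, ⟨w, hw, rfl⟩, rfl⟩
    obtain ⟨m, hm, hm'⟩ := h1 w hw
    refine ⟨m, hm, ?_⟩
    change blockLabel b (π a) * m = blockLabel b (π (a + w))
    rw [hm', map_add]
  · rintro ⟨m, hm, rfl⟩
    obtain ⟨w, hw, hw'⟩ := h2 m hm
    refine ⟨a + w, ⟨w, hw, rfl⟩, ?_⟩
    change blockLabel b (π (a + w)) = blockLabel b (π a) * m
    rw [hw', map_add]

theorem ratIn_blockLabel_semilinear {B : Type*} {base : B → D}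
    (hb : ∀ d z, b d = some z → b z.1 = none) (hbase : ∀ x, b (base x) = none)
    (π : (K → ℕ) →+ (D → ℕ)) {T : Set (K → ℕ)} (hT : IsSemilinearSet T) :
    RatIn (fixing base) ((fun v => blockLabel b (π v)) '' T) := by
  obtain ⟨S, hS, hlin, rfl⟩ := hT
  rw [Set.sUnion_eq_biUnion, Set.image_iUnion₂]
  exact RatIn.biUnion hS (one_mem_fixing base) fun t ht =>
    ratIn_blockLabel_linear hb hbase π (hlin t ht)

end BlockLabel

/-! ### Block compressions with free exponents -/

section BlockSystem

open Atom

variable {D X J B : Type*}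

instance [Finite D] [Finite X] : Finite (Atom D X) := by
  let f : Atom D X → D ⊕ (X × Bool) ⊕ X := fun a =>
    match a with
    | const d => Sum.inl d
    | cut x e => Sum.inr (Sum.inl (x, e))
    | mid x => Sum.inr (Sum.inr x)
  apply Finite.of_injective f
  intro a a' h
  cases a <;> cases a' <;> simp_all [f]

/-- A signed letter with the given orientation. -/
def orient (z : D × Bool) (q : Bool) : D × Bool := if q then z else flip z

theorem img_replicate {Y : Type*} {f : Y → SW D} {y : Y} {n : ℕ} {z : D × Bool}
    (h : f y = List.replicate n z) (q : Bool) : img f (y, q) = List.replicate n (orient z q) := by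
  cases q <;> simp [orient, h, invRev_replicate]

/-- The letter of which an atom is a power. -/
def atomLetter (c : X × Bool → D × Bool) : Atom D X → D × Bool
  | const d => (d, true)
  | cut x e => c (x, e)
  | mid x => c (x, true)

/-- The exponent of an atom. -/
def atomExp (v : D ⊕ X × Bool → ℕ) : Atom D X → ℕ
  | const _ => 1
  | cut x e => v (Sum.inr (x, e))
  | mid _ => 0

/-- A group of powers of one letter is replaced by a letter. -/
def BlockMatch (b : D → Option (D × Bool)) (c : X × Bool → D × Bool) (s : (D ⊕ X) × Bool)
    (g : SW (Atom D X)) : Prop :=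
  (∃ x q, s = (Sum.inr x, q) ∧ g = [(mid x, q)]) ∨
  (∃ d q z, s = (Sum.inl d, q) ∧ b d = some z ∧
    ∀ a ∈ g, ¬ a.1.IsMid ∧ orient (atomLetter c a.1) a.2 = orient z q)

/-- The combinatorial part of a block compression that turns `W` into `W'`. -/
structure BlockSystem (base : B → D) (W W' : J → SW (D ⊕ X)) (b : D → Option (D × Bool))
    (c : X × Bool → D × Bool) (shp : X → SW (Atom D X)) (γ : J → List (SW (Atom D X))) : Prop where
  base_eq : ∀ x, b (base x) = none
  eq_none : ∀ d z, b d = some z → b z.1 = none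
  length_le : ∀ x, (shp x).length ≤ 3
  flatten_eq : ∀ j, (γ j).flatten = sub (Sum.elim (letter const) shp) (W j)
  isMatch : ∀ j, List.Forall₂ (BlockMatch b c) (W' j) (γ j)

/-- The exponents that are compatible with a block compression. -/
def blockSolutions (W' : J → SW (D ⊕ X)) (γ : J → List (SW (Atom D X))) :
    Set (D ⊕ X × Bool → ℕ) :=
  {v | ∀ j, ∀ p ∈ (W' j).zip (γ j), ∀ d, p.1.1 = Sum.inl d →
    v (Sum.inl d) = (p.2.map fun a => atomExp v a.1).sum}

/-- The labels of block compressions. -/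
def blockLabels (base : B → D) (W W' : J → SW (D ⊕ X)) : Set (SSub D) :=
  {h | ∃ b c shp γ, BlockSystem base W W' b c shp γ ∧
    ∃ v ∈ blockSolutions W' γ, h = blockLabel b fun d => v (Sum.inl d)}

/-- There are finitely many conditions. Each is a linear equation in the exponents, whose constant
term is the number of constants in the group. -/
theorem isSemilinearSet_blockSolutions [Finite D] [Finite X] [Finite J] (W' : J → SW (D ⊕ X))
    (γ : J → List (SW (Atom D X))) : IsSemilinearSet (blockSolutions W' γ) := by
  have key : ∀ l : SW (Atom D X), ∃ (k : ℕ) (g : (D ⊕ X × Bool → ℕ) →+ ℕ),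
      ∀ v, (l.map fun a => atomExp v a.1).sum = k + g v := by
    intro l
    induction l with
    | nil => exact ⟨0, 0, fun v => rfl⟩
    | cons a l ih =>
      obtain ⟨k, g, hg⟩ := ih
      obtain ⟨a, q⟩ := a
      cases a with
      | const d => exact ⟨1 + k, g, fun v => by
        rw [List.map_cons, List.sum_cons, hg]; simp only [atomExp]; ring⟩
      | cut x e =>
        refine ⟨k, Pi.evalAddMonoidHom (fun _ => ℕ) (Sum.inr (x, e)) + g, fun v => ?_⟩
        rw [List.map_cons, List.sum_cons, hg]
        simp only [atomExp, AddMonoidHom.add_apply, Pi.evalAddMonoidHom_apply]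
        ring
      | mid x => exact ⟨k, g, fun v => by
        rw [List.map_cons, List.sum_cons, hg]; simp only [atomExp]; ring⟩
  have : blockSolutions W' γ = ⋂ j, ⋂ p ∈ {p | p ∈ (W' j).zip (γ j)},
      ⋂ d ∈ {d : D | p.1.1 = Sum.inl d},
        {v | v (Sum.inl d) = (p.2.map fun a => atomExp v a.1).sum} := by
    ext v
    simp [blockSolutions]
  rw [this]
  refine IsSemilinearSet.iInter fun j => IsSemilinearSet.biInter (List.finite_toSet _) fun p _ =>
    IsSemilinearSet.biInter (Set.toFinite _) fun d _ => ?_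
  obtain ⟨k, g, hg⟩ := key p.2
  simp only [hg]
  have := isSemilinearSet_setOfPred_eq 0 k
    (Pi.evalAddMonoidHom (fun _ : D ⊕ X × Bool => ℕ) (Sum.inl d)) g
  simpa only [zero_add, Pi.evalAddMonoidHom_apply] using this

/-- Only the exponents are unbounded. The other data range over a finite set: patterns have at most
three atoms, and groups are parts of the atomized words. So the labels form a finite union of images
of semilinear sets. -/
theorem ratIn_blockLabels [Finite D] [Finite X] [Finite J] (base : B → D)
    (W W' : J → SW (D ⊕ X)) : RatIn (fixing base) (blockLabels base W W') := by
  let Data := (D → Option (D × Bool)) × (X × Bool → D × Bool) × (X → SW (Atom D X)) ×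
    (J → List (SW (Atom D X)))
  let 𝒟 : Set Data := {δ | BlockSystem base W W' δ.1 δ.2.1 δ.2.2.1 δ.2.2.2}
  have hfin : 𝒟.Finite := by
    have h1 : {s : X → SW (Atom D X) | ∀ x, s x ∈ {l | l.length ≤ 3}}.Finite :=
      Set.Finite.pi' fun _ => List.finite_length_le _ 3
    have h2 : {γ : J → List (SW (Atom D X)) | ∀ j, γ j ∈ {l | l.length ≤ (W' j).length ∧
        ∀ g ∈ l, g ∈ {g | g.length ≤ 3 * (W j).length}}}.Finite := by
      refine Set.Finite.pi' fun j => ?_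
      have hS : {g : SW (Atom D X) | g.length ≤ 3 * (W j).length}.Finite :=
        List.finite_length_le _ _
      have := hS.to_subtype
      refine ((List.finite_length_le {g : SW (Atom D X) | g.length ≤ 3 * (W j).length}
        (W' j).length).image (List.map Subtype.val)).subset ?_
      rintro l ⟨hl, hg⟩
      refine ⟨l.attach.map fun g => ⟨g.1, hg g.1 g.2⟩, ?_, ?_⟩
      · change (List.map _ l.attach).length ≤ _
        rwa [List.length_map, List.length_attach]
      · rw [List.map_map]
        exact List.attach_map_subtype_val l
    refine (Set.finite_univ.prod (Set.finite_univ.prod (h1.prod h2))).subset ?_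
    rintro ⟨b, c, shp, γ⟩ h
    refine ⟨trivial, trivial, h.length_le, fun j => ⟨(h.isMatch j).length_eq.ge, fun g hg => ?_⟩⟩
    have h3 : g.length ≤ (γ j).flatten.length := by
      rw [List.length_flatten]
      exact List.le_sum_of_mem (List.mem_map_of_mem hg)
    rw [h.flatten_eq, length_sub] at h3
    refine h3.trans ?_
    refine (List.sum_le_card_nsmul _ 3 ?_).trans ?_
    · intro n hn
      obtain ⟨⟨d | x, q⟩, _, rfl⟩ := List.mem_map.1 hn
      · simp [letter]
      · exact h.length_le x
    · simp [mul_comm]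
  let π : (D ⊕ X × Bool → ℕ) →+ (D → ℕ) :=
    { toFun := fun v d => v (Sum.inl d)
      map_zero' := rfl
      map_add' := fun _ _ => rfl }
  have : blockLabels base W W' = ⋃ δ ∈ 𝒟,
      (fun v => blockLabel δ.1 (π v)) '' (blockSolutions W' δ.2.2.2) := by
    ext h
    simp only [Set.mem_iUnion]
    constructor
    · rintro ⟨b, c, shp, γ, hB, v, hv, rfl⟩
      exact ⟨(b, c, shp, γ), hB, v, hv, rfl⟩
    · rintro ⟨⟨b, c, shp, γ⟩, hB, v, hv, rfl⟩
      exact ⟨b, c, shp, γ, hB, v, hv, rfl⟩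
  rw [this]
  exact RatIn.biUnion hfin (one_mem_fixing base) fun δ hδ =>
    ratIn_blockLabel_semilinear hδ.eq_none hδ.base_eq π (isSemilinearSet_blockSolutions _ _)

/-- Matched sides are powers of the same signed letter, and the equations between the exponents make
these powers equal. -/
theorem expands_of_mem_blockLabels {base : B → D} {W W' : J → SW (D ⊕ X)} {h : SSub D}
    (hh : h ∈ blockLabels base W W') : Expands W W' h := by
  obtain ⟨b, c, shp, γ, hB, v, hv, rfl⟩ := hh
  let val : Atom D X → SW D := fun a =>
    match a with
    | const d => [(d, true)]
    | cut x e => List.replicate (v (Sum.inr (x, e))) (c (x, e))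
    | mid _ => []
  have hval : ∀ a : Atom D X, ¬ a.IsMid →
      val a = List.replicate (atomExp v a) (atomLetter c a) := by
    intro a ha
    cases a with
    | const d => rfl
    | cut x e => rfl
    | mid x => simp at ha
  refine expands_of_groups val (fun d => rfl) shp γ hB.flatten_eq fun j => ?_
  have h1 := hB.isMatch j
  have h2 := hv j
  generalize W' j = w at h1 h2
  generalize γ j = l at h1 h2
  induction h1 with
  | nil => exact List.Forall₂.nil
  | @cons s g w l hsg _ ih =>
    refine List.Forall₂.cons ?_ (ih fun p hp => h2 p (by simp [hp]))
    rcases hsg with ⟨x, q, rfl, rfl⟩ | ⟨d, q, z, rfl, hd, hg⟩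
    · exact Or.inl ⟨x, q, rfl, rfl⟩
    · refine Or.inr ⟨d, q, rfl, fun a ha => (hg a ha).1, ?_⟩
      have hsum := h2 ((Sum.inl d, q), g) (by simp) d rfl
      have e : blockLabel b (fun d => v (Sum.inl d)) d = List.replicate (v (Sum.inl d)) z := by
        simp [blockLabel, hd]
      rw [img_replicate e, hsum]
      clear h2 hsum e
      simp only
      induction g with
      | nil => rfl
      | cons a g ih' =>
        obtain ⟨ha, ha'⟩ := hg a (by simp)
        rw [sub_cons, ih' fun a ha => hg a (by simp [ha])]
        rw [show a = (a.1, a.2) from rfl, img_replicate (hval a.1 ha), ha']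
        simp [List.replicate_append_replicate]

/-- A nonempty factor is a power of its first letter, so letters and exponents are the heads and
lengths of the factors. The default of `hd` concerns the empty word only, which is not the value of
any atom in a group. -/
theorem Compressed.mem_blockLabels [Nonempty D] {base : B → D} {W W' : J → SW (D ⊕ X)}
    {σ : X → SW D} {U : Set D} {h : SSub D} (C : Compressed base blockGlue W σ U h W') :
    h ∈ blockLabels base W W' := by
  classical
  let hd : SW D → D × Bool := fun w => w.head?.getD (Classical.arbitrary D, true)
  have hrep : ∀ w : SW D, w ≠ [] → (w.IsChain fun s t => blockGlue s t = true) →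
      w = List.replicate w.length (hd w) := by
    intro w hn hc
    obtain ⟨z, hz⟩ := eq_replicate_of_blockGlue hn hc
    have : hd w = z := by
      obtain ⟨n, hn⟩ : ∃ n, w.length = n + 1 :=
        ⟨_, (Nat.succ_pred_eq_of_pos (List.length_pos_iff.2 hn)).symm⟩
      rw [hn] at hz
      simp [hd, hz, List.replicate_succ]
    rw [this]
    exact hz
  let b : D → Option (D × Bool) := fun d => if d ∈ U then some (hd (h d)) else none
  let c : X × Bool → D × Bool := fun p => hd (atomVal blockGlue σ (cut p.1 p.2))
  let v : D ⊕ X × Bool → ℕ := Sum.elim (fun d => (h d).length)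
    (fun p => (atomVal blockGlue σ (cut p.1 p.2)).length)
  have hb : ∀ d ∈ U, b d = some (hd (h d)) := fun d hd => if_pos hd
  have hb' : ∀ d ∉ U, b d = none := fun d hd => if_neg hd
  have hrepU : ∀ d ∈ U, h d = List.replicate (h d).length (hd (h d)) :=
    fun d hdU => hrep _ (C.ne_nil d hdU) (C.isChain d hdU)
  have hval : ∀ a : Atom D X, ¬ a.IsMid → atomVal blockGlue σ a ≠ [] →
      atomVal blockGlue σ a = List.replicate (atomExp v a) (atomLetter c a) ∧
      atomExp v a = (atomVal blockGlue σ a).length := by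
    intro a ha hn
    cases a with
    | const d => exact ⟨rfl, rfl⟩
    | cut x e => exact ⟨hrep _ hn (isChain_atomVal blockGlue σ _ ha), rfl⟩
    | mid x => simp at ha
  refine ⟨b, c, shape blockGlue σ, fun j => groups blockGlue σ (W j), ⟨?_, ?_, ?_, ?_, ?_⟩, v, ?_, ?_⟩
  · exact fun x => hb' _ (C.base_notMem x)
  · intro d z hz
    by_cases hdU : d ∈ U
    · rw [hb d hdU, Option.some_inj] at hz
      subst hz
      apply hb'
      refine C.letters d hdU _ ?_
      obtain ⟨n, hn⟩ : ∃ n, (h d).length = n + 1 :=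
        ⟨_, (Nat.succ_pred_eq_of_pos (List.length_pos_iff.2 (C.ne_nil d hdU))).symm⟩
      have := hrepU d hdU
      rw [hn] at this
      generalize hd (h d) = z at this
      rw [this]
      simp [List.replicate_succ]
    · rw [hb' d hdU] at hz
      cases hz
  · exact length_shape_le blockGlue σ
  · exact fun j => List.flatten_splitBy _ _
  · intro j
    have hm := C.mem j
    have := C.isMatch j
    generalize W' j = w at this hm
    generalize groups blockGlue σ (W j) = l at this
    induction this with
    | nil => exact List.Forall₂.nil
    | @cons s g w l hsg _ ih =>
      refine List.Forall₂.cons ?_ (ih fun s hs => hm s (by simp [hs]))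
      rcases hsg with ⟨x, q, rfl, rfl⟩ | ⟨d, q, rfl, hmid, hn, hg⟩
      · exact Or.inl ⟨x, q, rfl, rfl⟩
      · have hdU : d ∈ U := hm _ List.mem_cons_self d rfl
        refine Or.inr ⟨d, q, _, rfl, hb d hdU, fun a ha => ⟨hmid a ha, ?_⟩⟩
        rw [img_replicate (hrepU d hdU)] at hg
        obtain ⟨e1, e2⟩ := hval a.1 (hmid a ha) (hn a ha)
        have hmem : orient (atomLetter c a.1) a.2 ∈ sub (atomVal blockGlue σ) g := by
          refine List.mem_flatMap.2 ⟨a, ha, ?_⟩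
          rw [show a = (a.1, a.2) from rfl, img_replicate e1, List.mem_replicate, e2]
          exact ⟨fun h0 => hn a ha (List.length_eq_zero_iff.1 h0), rfl⟩
        rw [hg] at hmem
        exact (List.mem_replicate.1 hmem).2
  · intro j p hp d hpd
    have hm := C.mem j
    have := C.isMatch j
    generalize W' j = w at this hm hp
    change p ∈ w.zip (groups blockGlue σ (W j)) at hp
    generalize groups blockGlue σ (W j) = l at this hp
    induction this with
    | nil => simp at hp
    | @cons s g w l hsg _ ih =>
      rw [List.zip_cons_cons, List.mem_cons] at hp
      rcases hp with rfl | hp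
      · rcases hsg with ⟨x, q, rfl, rfl⟩ | ⟨d', q, rfl, hmid, hn, hg⟩
        · simp at hpd
        · simp only [Sum.inl.injEq] at hpd
          subst hpd
          have := congrArg List.length hg
          rw [length_img, length_sub] at this
          change (h d').length = _
          rw [← this]
          congr 1
          exact List.map_congr_left fun a ha => ((hval a.1 (hmid a ha) (hn a ha)).2).symm
      · exact ih (fun s hs => hm s (by simp [hs])) hp
  · funext d
    by_cases hdU : d ∈ U
    · simp only [blockLabel, hb d hdU]
      exact hrepU d hdU
    · simp only [blockLabel, hb' d hdU]
      exact C.of_notMem d hdU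

end BlockSystem

/-! ## The solutions of a system form a rational set of substitutions -/

/-- The letters of the recompression alphabet: basic letters, two pools, and seeds. -/
inductive Ltr (B P J : Type)
  | base (b : B)
  | pool (e : Bool) (p : P)
  | seed (j : J)

namespace Ltr

variable {B P J : Type}

/-- The alphabet as a sum type. -/
def equivSum : Ltr B P J ≃ B ⊕ (Bool × P) ⊕ J where
  toFun
    | base b => Sum.inl b
    | pool e p => Sum.inr (Sum.inl (e, p))
    | seed j => Sum.inr (Sum.inr j)
  invFun
    | Sum.inl b => base b
    | Sum.inr (Sum.inl (e, p)) => pool e p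
    | Sum.inr (Sum.inr j) => seed j
  left_inv d := by cases d <;> rfl
  right_inv d := by rcases d with b | ⟨e, p⟩ | j <;> rfl

instance [Finite B] [Finite P] [Finite J] : Finite (Ltr B P J) := Finite.of_equiv _ equivSum.symm

theorem card_eq [Finite B] [Finite P] [Finite J] :
    Nat.card (Ltr B P J) = Nat.card B + 2 * Nat.card P + Nat.card J := by
  rw [Nat.card_congr equivSum, Nat.card_sum, Nat.card_sum, Nat.card_prod]
  simp
  omega

end Ltr

section Systems

open Atom

theorem Compressed.expands {D X J B : Type*} {base : B → D} {r : D × Bool → D × Bool → Bool}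
    {W W' : J → SW (D ⊕ X)} {σ : X → SW D} {U : Set D} {h : SSub D}
    (C : Compressed base r W σ U h W') : Expands W W' h := by
  refine expands_of_groups (atomVal r σ) (fun d => rfl) (shape r σ) (fun j => groups r σ (W j))
    (fun j => List.flatten_splitBy _ _) fun j => (C.isMatch j).imp ?_
  rintro s g (h | ⟨d, b, h1, h2, h3, h4⟩)
  · exact Or.inl h
  · exact Or.inr ⟨d, b, h1, h2, h4⟩

variable {B P J X : Type}

theorem finite_systems [Finite B] [Finite P] [Fintype J] [Finite X] (n : ℕ) :
    Finite {W : J → SW (Ltr B P J ⊕ X) // ∑ j, (W j).length ≤ n} := by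
  have : {W : J → SW (Ltr B P J ⊕ X) | ∑ j, (W j).length ≤ n}.Finite := by
    refine (Set.Finite.pi' (t := fun _ => {w : SW (Ltr B P J ⊕ X) | w.length ≤ n})
      fun _ => List.finite_length_le _ n).subset ?_
    intro W hW j
    exact (Finset.single_le_sum (f := fun j => (W j).length) (fun _ _ => Nat.zero_le _)
      (Finset.mem_univ j)).trans hW
  exact this.to_subtype

/-- Variables are erased. -/
def eraseVars {D X : Type*} (w : SW (D ⊕ X)) : SW D := sub (Sum.elim (letter id) fun _ => []) w

/-- The value of a word with variables. -/
abbrev value {D X : Type*} (σ : X → SW D) (w : SW (D ⊕ X)) : SW D := sub (Sum.elim (letter id) σ) w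

/-- Erasing the variables on both sides of the decoding relation turns `τ` into an assignment. The
word decoded at the end of a path is thus a value of the word at its start. -/
theorem value_eraseVars {D : Type*} {h : SSub D} {W W' : SW (D ⊕ X)} {τ : X → SW (D ⊕ X)}
    (H : sub (letterMap h) W' = sub (varMap τ) W) :
    sub h (eraseVars W') = value (fun x => eraseVars (τ x)) W := by
  have := congrArg eraseVars H
  simp only [eraseVars, sub_sub] at this ⊢
  rw [value]
  refine Eq.trans ?_ (this.trans ?_)
  · apply sub_congr
    rintro ⟨d | x, b⟩ _
    · simp only [letterMap, Sum.elim_inl, sub_sub_letter]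
      rw [letter, sub_singleton, img_true]
      exact (sub_letter_id _).symm
    · simp [letterMap, letter]
  · apply sub_congr
    rintro ⟨d | x, b⟩ _
    · simp [varMap, letter]
    · simp [varMap]

variable [Nonempty B]

/-- The value of the letters before they are expanded. -/
noncomputable def initialValue : Ltr B P J → SW B
  | .base b => [(b, true)]
  | _ => [(Classical.arbitrary B, true)]

/-- The first label. -/
noncomputable def initialLabel : SSub (Ltr B P J) := fun d => sub (letter Ltr.base) (initialValue d)

/-- A system over the basic letters as a system over all letters. -/
def liftSystem (W : J → SW (B ⊕ X)) : J → SW (Ltr B P J ⊕ X) :=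
  fun j => sub (letter (Sum.map Ltr.base id)) (W j)

/-- The last label, which produces the words of the system. -/
def finalLabel (W : J → SW (Ltr B P J ⊕ X)) : SSub (Ltr B P J)
  | .seed j => eraseVars (W j)
  | d => [(d, true)]

/-- The labels of the recompression graph. -/
def recompressionLabels (E : J → J → Prop) (L : (J → SW (Ltr B P J ⊕ X)) → Prop)
    (𝒲 : Set (J → SW (B ⊕ X))) : Bool ⊕ {W // L W} → Bool ⊕ {W // L W} → Set (SSub (Ltr B P J))
  | .inl false, .inr W' => {h | h = initialLabel ∧ ∃ W ∈ 𝒲, W'.1 = liftSystem W}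
  | .inr W, .inr W' => blockLabels Ltr.base W.1 W'.1 ∪
      {h | Expands W.1 W'.1 h ∧ h ∈ fixing Ltr.base ∧ ∀ d, (h d).length ≤ 2}
  | .inr W, .inl true => {h | h = finalLabel W.1 ∧
      ∀ j j', E j j' → eraseVars (W.1 j) = eraseVars (W.1 j')}
  | _, _ => ∅

variable {E : J → J → Prop} {L : (J → SW (Ltr B P J ⊕ X)) → Prop} {𝒲 : Set (J → SW (B ⊕ X))}

theorem initialLabel_mem_fixing : (initialLabel : SSub (Ltr B P J)) ∈ fixing Ltr.base := by
  intro b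
  simp [initialLabel, initialValue, letter]

theorem ratIn_recompressionLabels [Finite B] [Finite P] [Finite J] [Finite X]
    (p q : Bool ⊕ {W // L W}) : RatIn (fixing Ltr.base) (recompressionLabels E L 𝒲 p q) := by
  rcases p with (_ | _) | W <;> rcases q with (_ | _) | W'
  case inl.false.inr =>
    refine RatIn.of_finite ((Set.finite_singleton initialLabel).subset fun h hh => hh.1) ?_
    rintro h ⟨rfl, _⟩
    exact initialLabel_mem_fixing
  case inr.inl.true =>
    refine RatIn.of_finite ((Set.finite_singleton (finalLabel W.1)).subset fun h hh => hh.1) ?_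
    rintro h ⟨rfl, _⟩ b
    rfl
  case inr.inr =>
    refine RatIn.union (one_mem_fixing _) (ratIn_blockLabels _ _ _) (RatIn.of_finite ?_ ?_)
    · refine (Set.Finite.pi' (t := fun _ => {w : SW (Ltr B P J) | w.length ≤ 2})
        fun _ => List.finite_length_le _ 2).subset ?_
      exact fun h hh d => hh.2.2 d
    · exact fun h hh => hh.2.1
  all_goals exact RatIn.of_finite Set.finite_empty (Set.empty_subset _)

/-- Every label between the first and the last one satisfies `Expands`, and this composes; nothing
else about these labels is needed. -/
theorem exists_value_of_chainProd_inr {W : {W // L W}} {m : SSub (Ltr B P J)}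
    (hm : ChainProd (recompressionLabels E L 𝒲) (.inr W) m (.inl true)) :
    ∃ (l : SSub (Ltr B P J)) (W' : {W // L W}), m = l * finalLabel W'.1 ∧ Expands W.1 W'.1 l ∧
      ∀ j j', E j j' → eraseVars (W'.1 j) = eraseVars (W'.1 j') := by
  generalize hp : (Sum.inr W : Bool ⊕ {W // L W}) = p at hm
  generalize hq : (Sum.inl true : Bool ⊕ {W // L W}) = q at hm
  induction hm generalizing W with
  | nil p => rw [← hp] at hq; cases hq
  | @cons p q r a m ha hm ih =>
    subst hp hq
    rcases q with (_ | _) | W'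
    · exact ha.elim
    · obtain ⟨rfl, hE⟩ := ha
      cases hm with
      | nil => exact ⟨1, W, by rw [mul_one, one_mul], Expands.refl _, hE⟩
      | @cons _ q _ a m ha _ => rcases q with (_ | _) | W' <;> exact ha.elim
    · obtain ⟨l, W'', rfl, hl, hE⟩ := ih rfl rfl
      refine ⟨a * l, W'', by rw [mul_assoc], ?_, hE⟩
      rcases ha with ha | ha
      · exact (expands_of_mem_blockLabels ha).trans hl
      · exact ha.1.trans hl

/-- Letters outside the basic ones may survive in the substituted variables. The first label, which
acts last, sends them to an arbitrary basic letter, and the result still solves the initial system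
because that system contains basic letters only. -/
theorem exists_value_of_chainProd {m : SSub (Ltr B P J)}
    (hm : ChainProd (recompressionLabels E L 𝒲) (.inl false) m (.inl true)) :
    ∃ W ∈ 𝒲, ∃ τ : X → SW B, (∀ j, m (.seed j) = sub (letter Ltr.base) (value τ (W j))) ∧
      ∀ j j', E j j' → m (.seed j) = m (.seed j') := by
  cases hm with
  | @cons _ q _ a m ha hm =>
    rcases q with (_ | _) | W'
    · exact ha.elim
    · exact ha.elim
    · obtain ⟨rfl, W, hW, hW'⟩ := ha
      obtain ⟨l, W'', rfl, ⟨τ, hτ⟩, hE⟩ := exists_value_of_chainProd_inr hm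
      have key : ∀ j, (initialLabel * (l * finalLabel W''.1) : SSub (Ltr B P J)) (.seed j) =
          sub initialLabel (sub l (eraseVars (W''.1 j))) := by
        intro j
        rw [SSub.mul_apply, SSub.mul_apply]
        rfl
      refine ⟨W, hW, fun x => sub initialValue (eraseVars (τ x)), fun j => ?_, fun j j' hj => ?_⟩
      · rw [key, value_eraseVars (hτ j), hW', liftSystem]
        simp only [value, sub_sub]
        apply sub_congr
        rintro ⟨d | x, b⟩ _
        · simp [letter, initialLabel, initialValue]
        · simp only [letter, Sum.map_inr, sub_singleton, img_true, Sum.elim_inr, id, sub_sub]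
          rfl
      · rw [key, key, hE j j' hj]

/-- Rounds are repeated until all variables are empty. Each round follows two edges and lowers the
weight. The number of rounds is not bounded in advance, but all systems met obey one length bound.
-/
theorem exists_chainProd_of_solved [Finite B] [Fintype P] [Fintype J] [Fintype X] {N : ℕ}
    (hP : 20 * N + Fintype.card J ≤ Fintype.card P) (𝒲 : Set (J → SW (B ⊕ X))) (n : ℕ)
    {W : {W : J → SW (Ltr B P J ⊕ X) // ∑ j, (W j).length ≤ 18 * N + Fintype.card J}}
    {σ : X → SW (Ltr B P J)} {α : Ltr B P J → SW B}
    (S : Solved Ltr.base Ltr.pool E N false W.1 σ α)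
    (hW : ∑ j, (W.1 j).length ≤ 16 * N + Fintype.card J) (hn : weight σ α = n) :
    ∃ m, ChainProd (recompressionLabels E _ 𝒲) (.inr W) m (.inl true) ∧
      ∀ j, sub α (m (.seed j)) = sub α (value σ (W.1 j)) := by
  induction n using Nat.strong_induction_on generalizing W σ α with
  | h n ih =>
    by_cases hσ : ∃ x, σ x ≠ []
    · have : Nonempty (Ltr B P J) := ⟨.base (Classical.arbitrary B)⟩
      obtain ⟨U₁, h₁, W₁, r, σ₁, U₂, h₂, W₂, σ₂, α₂, C₁, C₂, hl, hW₁, hW₂, S₂, hα, hv, hw⟩ :=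
        S.exists_round (fun e p p' h => by cases h; rfl) (fun b e p h => by cases h)
          (fun e p p' h => by cases e <;> cases h) hW hP hσ
      obtain ⟨m, hm, hm'⟩ := ih _ (hn ▸ hw) (W := ⟨W₂, hW₂.trans (by omega)⟩) S₂ hW₂ rfl
      have m₁ : h₁ ∈ recompressionLabels E
          (fun W : J → SW (Ltr B P J ⊕ X) => ∑ j, (W j).length ≤ 18 * N + Fintype.card J) 𝒲
          (.inr W) (.inr ⟨W₁, hW₁⟩) := Or.inl C₁.mem_blockLabels
      have m₂ : h₂ ∈ recompressionLabels E
          (fun W : J → SW (Ltr B P J ⊕ X) => ∑ j, (W j).length ≤ 18 * N + Fintype.card J) 𝒲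
          (.inr ⟨W₁, hW₁⟩) (.inr ⟨W₂, hW₂.trans (by omega)⟩) :=
        Or.inr ⟨C₂.expands, fun b => C₂.of_notMem _ (C₂.base_notMem b), hl⟩
      refine ⟨h₁ * (h₂ * m), ChainProd.cons m₁ (ChainProd.cons m₂ hm), fun j => ?_⟩
      · rw [← hv j, ← hm' j, SSub.mul_apply, SSub.mul_apply]
        have : α₂ = fun d => sub α (sub h₁ (h₂ d)) := funext hα
        simp only [this, SW.sub_sub]
    · push Not at hσ
      have he : ∀ j, eraseVars (W.1 j) = value σ (W.1 j) := by
        intro j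
        apply sub_congr
        rintro ⟨d | x, b⟩ _
        · rfl
        · simp [hσ]
      refine ⟨finalLabel W.1, ?_, fun j => ?_⟩
      · have : finalLabel W.1 ∈ recompressionLabels E
            (fun W : J → SW (Ltr B P J ⊕ X) => ∑ j, (W j).length ≤ 18 * N + Fintype.card J) 𝒲
            (.inr W) (.inl true) :=
          ⟨rfl, fun j j' hj => by rw [he, he]; exact S.eqs j j' hj⟩
        simpa using ChainProd.cons this (ChainProd.nil _)
      · exact congrArg (sub α) (he j)

/-- The words described by the solutions of systems of bounded length are the images of the seeds
under a rational set of substitutions. -/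
theorem exists_ratIn_of_systems [Finite B] [Fintype P] [Fintype J] [Finite X] {N : ℕ}
    (hP : 20 * N + Fintype.card J ≤ Fintype.card P) (E : J → J → Prop) (𝒲 : Set (J → SW (B ⊕ X)))
    (hlen : ∀ W ∈ 𝒲, ∑ j, (W j).length ≤ 16 * N + Fintype.card J)
    (hvars : ∀ W ∈ 𝒲, ∑ j, numVars (W j) ≤ N) :
    ∃ R : Set (SSub (Ltr B P J)), RatIn (fixing Ltr.base) R ∧
      (∀ m ∈ R, ∃ W ∈ 𝒲, ∃ τ : X → SW B,
        (∀ j, m (.seed j) = sub (letter Ltr.base) (value τ (W j))) ∧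
        ∀ j j', E j j' → value τ (W j) = value τ (W j')) ∧
      (∀ W ∈ 𝒲, ∀ σ : X → SW B, (∀ j j', E j j' → value σ (W j) = value σ (W j')) →
        (∀ j, FreeGroup.IsReduced (value σ (W j))) →
        ∃ m ∈ R, ∀ j, m (.seed j) = sub (letter Ltr.base) (value σ (W j))) := by
  have := Fintype.ofFinite X
  have := finite_systems (B := B) (P := P) (X := X) (J := J) (18 * N + Fintype.card J)
  refine ⟨_, RatIn.chainProd (one_mem_fixing _) (ratIn_recompressionLabels (E := E)
    (L := fun W : J → SW (Ltr B P J ⊕ X) => ∑ j, (W j).length ≤ 18 * N + Fintype.card J)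
    (𝒲 := 𝒲)) {Sum.inl false} {Sum.inl true}, ?_, ?_⟩
  · rintro m ⟨_, rfl, _, rfl, hm⟩
    obtain ⟨W, hW, τ, hτ, hE⟩ := exists_value_of_chainProd hm
    refine ⟨W, hW, τ, hτ, fun j j' hj => ?_⟩
    have := hE j j' hj
    rw [hτ, hτ] at this
    have hinj : Function.Injective fun s : B × Bool => ((Ltr.base s.1, s.2) : Ltr B P J × Bool) := by
      rintro ⟨b, q⟩ ⟨b', q'⟩ h
      simpa using h
    rw [sub_letter, sub_letter] at this
    exact List.map_injective_iff.2 hinj this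
  · intro W hW σ hE hred
    have hlift : ∀ j, value (fun x => sub (letter Ltr.base) (σ x)) (liftSystem W j) =
        sub (letter (Ltr.base : B → Ltr B P J)) (value σ (W j)) := by
      intro j
      simp only [liftSystem, value, sub_sub]
      apply sub_congr
      rintro ⟨d | x, b⟩ _ <;> simp [letter]
    have hα : ∀ w : SW B, sub initialValue (sub (letter (Ltr.base : B → Ltr B P J)) w) = w := by
      intro w
      rw [sub_sub_letter]
      exact sub_letter_id w
    have hlen' : ∀ j, (liftSystem (P := P) W j).length = (W j).length := by
      intro j
      simp [liftSystem, sub_letter]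
    have hW16 : ∑ j, (liftSystem (P := P) W j).length ≤ 16 * N + Fintype.card J := by
      simp only [hlen']
      exact hlen W hW
    have S : Solved Ltr.base Ltr.pool E N false (liftSystem (P := P) W)
        (fun x => sub (letter Ltr.base) (σ x)) initialValue := by
      refine ⟨fun b => rfl, fun d => by cases d <;> simp [initialValue], ?_, ?_, ?_, ?_⟩
      · rintro d (⟨j, s, hs, hd⟩ | ⟨x, s, hs, rfl⟩)
        · simp only [liftSystem, sub_letter, List.mem_map] at hs
          obtain ⟨⟨b | x, q⟩, _, rfl⟩ := hs
          · exact Or.inl ⟨b, (by simpa using hd.symm)⟩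
          · simp at hd
        · simp only [sub_letter, List.mem_map] at hs
          obtain ⟨a, _, rfl⟩ := hs
          exact Or.inl ⟨_, rfl⟩
      · intro j j' hj
        have := hE j j' hj
        change value _ _ = value _ _
        rw [hlift, hlift, this]
      · intro j
        change FreeGroup.IsReduced (sub initialValue (value _ _))
        rw [hlift, hα]
        exact hred j
      · refine le_trans (Finset.sum_le_sum fun j _ => ?_) (hvars W hW)
        simp only [numVars, liftSystem, sub_letter, List.countP_map]
        refine le_of_eq (List.countP_congr ?_)
        rintro ⟨b | x, q⟩ _ <;> simp
    obtain ⟨m, hm, hm'⟩ := exists_chainProd_of_solved hP 𝒲 _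
      (W := ⟨liftSystem W, hW16.trans (by omega)⟩) S hW16 rfl
    have m₀ : initialLabel ∈ recompressionLabels E
        (fun W : J → SW (Ltr B P J ⊕ X) => ∑ j, (W j).length ≤ 18 * N + Fintype.card J) 𝒲
        (.inl false) (.inr ⟨liftSystem W, hW16.trans (by omega)⟩) := ⟨rfl, W, hW, rfl⟩
    refine ⟨initialLabel * m, ⟨_, rfl, _, rfl, ChainProd.cons m₀ hm⟩, fun j => ?_⟩
    rw [SSub.mul_apply]
    have := hm' j
    rw [hlift, hα] at this
    rw [← this, SW.sub_sub]
    rfl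

end Systems

/-! ## Equations over words as systems of reduced words -/

section Cancellation

variable {Y : Type*}

/-- The cancellation in a product of two reduced words. -/
theorem exists_cancellation {y t : SW Y} (hy : FreeGroup.IsReduced y) (ht : FreeGroup.IsReduced t) :
    ∃ p q r : SW Y, y = p ++ q ∧ t = invRev q ++ r ∧ FreeGroup.IsReduced (p ++ r) := by
  induction t generalizing y with
  | nil => exact ⟨y, [], [], by simp, by simp, by simpa using hy⟩
  | cons a t ih =>
    by_cases h : FreeGroup.IsReduced (y ++ a :: t)
    · exact ⟨y, [], a :: t, by simp, by simp, h⟩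
    · have h' : ∃ z ∈ y.getLast?, z = flip a := by
        by_contra hne
        push Not at hne
        apply h
        rw [FreeGroup.IsReduced, List.isChain_append]
        refine ⟨hy, ht, ?_⟩
        rintro z hz _ ⟨⟩ h1
        by_contra h2
        refine hne z hz (Prod.ext h1 ?_)
        cases hz2 : z.2 <;> cases ha : a.2 <;> simp_all
      obtain ⟨z, hz, rfl⟩ := h'
      obtain ⟨y, rfl⟩ := List.getLast?_eq_some_iff.1 hz
      obtain ⟨p, q, r, rfl, rfl, hpr⟩ := ih (List.IsChain.left_of_append hy)
        (List.isChain_cons.1 ht).2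
      refine ⟨p, q ++ [flip a], r, by simp, ?_, hpr⟩
      rw [FreeGroup.invRev_append]
      simp [FreeGroup.invRev, SW.flip]

end Cancellation

/-! ### Cutting equal words into reduced pieces -/

section Cutting

variable {D X : Type*}

/-- The border is followed through the word symbol by symbol. The second alternative is there to be
excluded, when no value of a symbol can contain the border. -/
theorem sub_eq_append {Y Z : Type*} {f : Y → SW Z} {w : SW Y} {p q : SW Z} (h : sub f w = p ++ q) :
    (∃ u v, w = u ++ v ∧ sub f u = p ∧ sub f v = q) ∨
      ∃ s ∈ w, ∃ p' q', img f s = p' ++ q' ∧ p' ≠ [] ∧ q' ≠ [] ∧ p' <:+ p ∧ q' <+: q := by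
  induction w generalizing p with
  | nil =>
    simp only [sub_nil, List.nil_eq, List.append_eq_nil_iff] at h
    exact Or.inl ⟨[], [], rfl, h.1.symm, h.2.symm⟩
  | cons s w ih =>
    rw [sub_cons] at h
    rcases List.append_eq_append_iff.1 h with ⟨a, h1, h2⟩ | ⟨a, h1, h2⟩
    · rcases ih h2 with ⟨u, v, rfl, rfl, rfl⟩ | ⟨s', hs', p', q', h3, h4, h5, h6, h7⟩
      · exact Or.inl ⟨s :: u, v, rfl, by rw [sub_cons, h1], rfl⟩
      · exact Or.inr ⟨s', by simp [hs'], p', q', h3, h4, h5,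
          h6.trans (h1 ▸ List.suffix_append _ _), h7⟩
    · by_cases hp : p = []
      · exact Or.inl ⟨[], s :: w, rfl, hp.symm, by rw [sub_cons, h1, h2, hp]; simp⟩
      · by_cases ha : a = []
        · exact Or.inl ⟨[s], w, rfl, by simp [h1, ha], by simp [h2, ha]⟩
        · exact Or.inr ⟨s, by simp, p, a, h1, hp, ha, List.suffix_rfl, h2 ▸ List.prefix_append _ _⟩

theorem isReduced_invRev {Y : Type*} {w : SW Y} (h : FreeGroup.IsReduced w) :
    FreeGroup.IsReduced (invRev w) := by
  rw [FreeGroup.IsReduced, invRev_eq, List.isChain_reverse, List.isChain_map]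
  refine List.IsChain.imp ?_ h
  intro a b hab h1
  simp only [flip_fst, flip_snd] at h1 ⊢
  rw [hab h1.symm]

theorem isReduced_img {Y Z : Type*} {f : Y → SW Z} {s : Y × Bool}
    (h : FreeGroup.IsReduced (f s.1)) : FreeGroup.IsReduced (img f s) := by
  obtain ⟨y, _ | _⟩ := s
  · exact isReduced_invRev h
  · exact h

theorem not_isReduced_of_append {Y : Type*} {w : SW Y} (h : ¬ FreeGroup.IsReduced w) :
    ∃ p a q, w = (p ++ [a]) ++ (flip a :: q) := by
  rw [FreeGroup.IsReduced, List.isChain_iff_getElem] at h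
  push Not at h
  obtain ⟨i, hi, h1, h2⟩ := h
  refine ⟨w.take i, w[i], w.drop (i + 2), ?_⟩
  have : flip w[i] = w[i + 1] := by
    refine Prod.ext h1 ?_
    cases hz2 : w[i].2 <;> cases ha : w[i + 1].2 <;> simp_all
  rw [this, List.take_append_getElem, ← List.drop_eq_getElem_cons, List.take_append_drop]

/-- Two words with the same value are cut into pieces with reduced values. -/
theorem exists_reduced_pieces {σ : X → SW D} (hσ : ∀ x, FreeGroup.IsReduced (σ x))
    {u v : SW (D ⊕ X)} (h : value σ u = value σ v) :
    ∃ L : List (SW (D ⊕ X) × SW (D ⊕ X)), (L.map Prod.fst).flatten = u ∧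
      (L.map Prod.snd).flatten = v ∧ L.length ≤ max 1 u.length ∧
      ∀ p ∈ L, value σ p.1 = value σ p.2 ∧ FreeGroup.IsReduced (value σ p.1) := by
  induction hn : u.length using Nat.strong_induction_on generalizing u v with
  | h n ih =>
    subst hn
    by_cases hr : FreeGroup.IsReduced (value σ u)
    · exact ⟨[(u, v)], by simp, by simp, by simp, by simpa using ⟨h, hr⟩⟩
    · obtain ⟨p, a, q, hpq⟩ := not_isReduced_of_append hr
      -- All symbols have reduced values, so the border between `a` and its inverse cannot lie
      -- inside one of them. Hence both sides of the equation can be cut there.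
      have cut : ∀ w, value σ w = (p ++ [a]) ++ (flip a :: q) →
          ∃ w₁ w₂, w = w₁ ++ w₂ ∧ value σ w₁ = p ++ [a] ∧ value σ w₂ = flip a :: q := by
        intro w hw
        rcases sub_eq_append hw with h | ⟨s, _, p', q', h1, h2, h3, h4, h5⟩
        · exact h
        · exfalso
          have hs : FreeGroup.IsReduced (img (Sum.elim (letter id) σ) s) := by
            apply isReduced_img
            rcases s with ⟨d | x, b⟩
            · simp [letter]
            · exact hσ x
          rw [h1] at hs
          obtain ⟨p'', rfl⟩ : ∃ p'', p' = p'' ++ [a] := by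
            obtain ⟨b, p'', rfl⟩ : ∃ b p'', p' = p'' ++ [b] :=
              ⟨_, _, (List.dropLast_append_getLast h2).symm⟩
            obtain ⟨r, hr⟩ := h4
            rw [← List.append_assoc] at hr
            have := List.append_inj_right' hr rfl
            exact ⟨p'', by rw [this]⟩
          obtain ⟨q'', rfl⟩ : ∃ q'', q' = flip a :: q'' := by
            obtain ⟨b, q'', rfl⟩ := List.exists_cons_of_ne_nil h3
            exact ⟨q'', by rw [(List.cons_prefix_cons.1 h5).1]⟩
          rw [FreeGroup.IsReduced, List.isChain_append] at hs
          have := hs.2.2 a (by simp) (flip a) (by simp) rfl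
          simp at this
      obtain ⟨u₁, u₂, rfl, hu₁, hu₂⟩ := cut u hpq
      obtain ⟨v₁, v₂, rfl, hv₁, hv₂⟩ := cut v (h ▸ hpq)
      have h1 : 0 < u₁.length := List.length_pos_iff.2 (by rintro rfl; simp at hu₁)
      have h2 : 0 < u₂.length := List.length_pos_iff.2 (by rintro rfl; simp at hu₂)
      obtain ⟨L₁, a1, a2, a3, a4⟩ := ih u₁.length (by simp; omega) (hu₁.trans hv₁.symm) rfl
      obtain ⟨L₂, b1, b2, b3, b4⟩ := ih u₂.length (by simp; omega) (hu₂.trans hv₂.symm) rfl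
      refine ⟨L₁ ++ L₂, by simp [a1, b1], by simp [a2, b2], ?_, ?_⟩
      · simp only [List.length_append]
        omega
      · intro p hp
        rcases List.mem_append.1 hp with hp | hp
        exacts [a4 p hp, b4 p hp]

end Cutting

/-! ### Normal forms in the free product with the group of order two -/

section Stacks

variable {H : Type*} [Group H]

open Classical in
/-- Multiplication by the marker on a normal form `w₀ # w₁ # ⋯ # wₖ`. -/
noncomputable def pushPop : H × List H → H × List H
  | (t, w :: l) => if t = 1 then (w, l) else (1, t :: w :: l)
  | (t, []) => (1, [t])

/-- The inner factors of a normal form are nontrivial. -/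
def ValidStack (S : H × List H) : Prop := ∀ x ∈ S.2.dropLast, x ≠ 1

theorem ValidStack.pushPop {S : H × List H} (h : ValidStack S) : ValidStack (pushPop S) := by
  obtain ⟨t, _ | ⟨w, l⟩⟩ := S
  · simp [ValidStack, _root_.pushPop]
  · by_cases ht : t = 1
    · intro x hx
      simp only [_root_.pushPop, ht, if_true] at hx
      cases l with
      | nil => simp at hx
      | cons y l => exact h x (by simp only [List.dropLast_cons_cons] at hx ⊢; simp [hx])
    · intro x hx
      simp only [_root_.pushPop, ht, if_false, List.dropLast_cons_cons, List.mem_cons] at hx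
      rcases hx with rfl | hx
      · exact ht
      · exact h x hx

/-- After a pop the next call must push, which requires that an exposed inner factor is nontrivial.
The bottom factor may be trivial, since with nothing below it a call pushes in any case. -/
theorem pushPop_pushPop {S : H × List H} (h : ValidStack S) : pushPop (pushPop S) = S := by
  obtain ⟨t, _ | ⟨w, l⟩⟩ := S
  · simp [pushPop]
  · by_cases ht : t = 1
    · subst ht
      cases l with
      | nil => simp [pushPop]
      | cons y l =>
        have := h w (by simp)
        simp [pushPop, this]
    · simp [pushPop, ht]

end Stacks

/-! ## Equations over the group as systems of reduced words -/

section Conversion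

variable {G G' : Type*} (e : G ≃ G')

/-- Signed letters as letters of the alphabet with involution. -/
def backLetter : Option G' × Bool → Letter G
  | (some g, q) => some (e.symm g, q)
  | (none, _) => none

/-- Letters of the alphabet with involution as signed letters. -/
def signedLetter : Letter G → Option G' × Bool
  | some (g, q) => (some (e g), q)
  | none => (none, true)

theorem backLetter_signedLetter (a : Letter G) : backLetter e (signedLetter e a) = a := by
  rcases a with _ | ⟨g, q⟩ <;> simp [backLetter, signedLetter]

theorem backLetter_flip (z : Option G' × Bool) : backLetter e (flip z) = (backLetter e z).bar := by
  obtain ⟨_ | g, q⟩ := z <;> rfl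

theorem Letter.bar_bar (a : Letter G) : a.bar.bar = a := by
  rcases a with _ | ⟨g, q⟩ <;> simp [Letter.bar]

/-- Signed words as words of the alphabet with involution. -/
def backWord (w : SW (Option G')) : FreeMonoid (Letter G) := FreeMonoid.ofList (w.map (backLetter e))

theorem backWord_append (u v : SW (Option G')) : backWord e (u ++ v) = backWord e u * backWord e v := by
  simp [backWord]

theorem backWord_cons (z : Option G' × Bool) (w : SW (Option G')) :
    backWord e (z :: w) = FreeMonoid.of (backLetter e z) * backWord e w := rfl

/-- The value of a signed word in the group. -/
def groupValue (w : SW (Option G')) : PresentedMonoid (cancelRel (G := G)) :=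
  PresentedMonoid.mk cancelRel (backWord e w)

theorem groupValue_append (u v : SW (Option G')) :
    groupValue e (u ++ v) = groupValue e u * groupValue e v := by
  simp [groupValue, backWord_append]

theorem groupValue_nil : groupValue e [] = 1 := map_one _

theorem mk_of_mul_bar (a : Letter G) :
    PresentedMonoid.mk cancelRel (FreeMonoid.of a * FreeMonoid.of a.bar) = 1 :=
  PresentedMonoid.mk_eq_mk_of_rel ⟨a, rfl, rfl⟩

theorem groupValue_mul_invRev (w : SW (Option G')) : groupValue e w * groupValue e (invRev w) = 1 := by
  induction w with
  | nil => simp [groupValue_nil]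
  | cons z w ih =>
    have h1 : invRev (z :: w) = invRev w ++ [flip z] := FreeGroup.invRev_cons
    have h2 : groupValue e [z] * groupValue e [flip z] = 1 := by
      rw [← mk_of_mul_bar (backLetter e z), ← backLetter_flip]
      rfl
    rw [h1, show z :: w = [z] ++ w from rfl, groupValue_append, groupValue_append, ← h2]
    calc _ = groupValue e [z] * (groupValue e w * groupValue e (invRev w)) * groupValue e [flip z] := by
          simp only [mul_assoc]
      _ = _ := by rw [ih, mul_one]

theorem groupValue_invRev_mul (w : SW (Option G')) : groupValue e (invRev w) * groupValue e w = 1 := by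
  have := groupValue_mul_invRev e (invRev w)
  rwa [FreeGroup.invRev_invRev] at this

end Conversion

/-! ### The action of words on normal forms -/

section StackAction

variable {G G' : Type*} (e : G ≃ G')

/-- The action of the letters on normal forms. -/
noncomputable def letterAct (a : Letter G) :
    Function.End {S : FreeGroup (Option G') × List (FreeGroup (Option G')) // ValidStack S} :=
  match a with
  | some (g, q) => fun S => ⟨(FreeGroup.mk [(some (e g), q)] * S.1.1, S.1.2), S.2⟩
  | none => fun S => ⟨pushPop S.1, S.2.pushPop⟩

/-- The action of words on normal forms. -/
noncomputable def stackAct : FreeMonoid (Letter G) →*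
    Function.End {S : FreeGroup (Option G') × List (FreeGroup (Option G')) // ValidStack S} :=
  FreeMonoid.lift (letterAct e)

/-- Van der Waerden's argument: a letter and its bar act by inverse maps, and the marker by an
involution, so the action factors through the group. -/
theorem stackAct_eq_of_mk_eq {u v : FreeMonoid (Letter G)}
    (h : PresentedMonoid.mk cancelRel u = PresentedMonoid.mk cancelRel v) :
    stackAct e u = stackAct e v := by
  have hrel : ∀ a b : FreeMonoid (Letter G), cancelRel a b →
      FreeMonoid.lift (letterAct e) a = FreeMonoid.lift (letterAct e) b := by
    rintro _ _ ⟨a, rfl, rfl⟩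
    rw [map_mul, FreeMonoid.lift_eval_of, FreeMonoid.lift_eval_of, map_one]
    funext S
    apply Subtype.ext
    rcases a with _ | ⟨g, q⟩
    · exact pushPop_pushPop S.2
    · change (FreeGroup.mk [(some (e g), q)] * (FreeGroup.mk [(some (e g), !q)] * S.1.1), S.1.2) = S.1
      rw [← mul_assoc, show FreeGroup.mk [(some (e g), !q)] = (FreeGroup.mk [(some (e g), q)])⁻¹ from rfl,
        mul_inv_cancel, one_mul]
  exact congrArg (PresentedMonoid.lift (letterAct e) hrel) h

theorem stackAct_backWord {w : SW (Option G')} (hw : ∀ z ∈ w, z.1 ≠ none)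
    (S : {S : FreeGroup (Option G') × List (FreeGroup (Option G')) // ValidStack S}) :
    (stackAct e (backWord e w) S).1 = (FreeGroup.mk w * S.1.1, S.1.2) := by
  induction w with
  | nil =>
    change (stackAct e 1 S).1 = _
    rw [map_one, ← FreeGroup.one_eq_mk, one_mul]
    rfl
  | cons z w ih =>
    have := ih fun z hz => hw z (by simp [hz])
    rw [backWord_cons, map_mul]
    change (stackAct e (FreeMonoid.of (backLetter e z)) (stackAct e (backWord e w) S)).1 = _
    obtain ⟨_ | g, q⟩ := z
    · exact absurd rfl (hw (none, q) (by simp))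
    · change (FreeGroup.mk [(some (e (e.symm g)), q)] * (stackAct e (backWord e w) S).1.1,
        (stackAct e (backWord e w) S).1.2) = _
      rw [this, e.apply_symm_apply, ← mul_assoc, FreeGroup.mul_mk]
      rfl

end StackAction

/-! ### Recording cancellations by auxiliary variables -/

section GroupSystem

variable {G : Type*} {G' I : Type} (e : G ≃ G')

/-- The value in the group of the lower part of a normal form. -/
def tailValue : List (SW (Option G')) → PresentedMonoid (cancelRel (G := G))
  | [] => 1
  | w :: l => groupValue e [(none, true)] * groupValue e w * tailValue l

/-- The variables of the system for an equation over the group. -/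
abbrev StackVar (G' I : Type) (n : ℕ) := I ⊕ ({l : SW (Option G' ⊕ I) // l.length ≤ n} × Fin 3)

theorem value_map_inl {D X T : Type*} (ρ : X ⊕ T → SW D) (w : SW (D ⊕ X)) :
    value ρ (sub (letter (Sum.map id Sum.inl)) w) = value (fun x => ρ (Sum.inl x)) w := by
  simp only [value, SW.sub_sub]
  apply sub_congr
  rintro ⟨d | x, b⟩ _ <;> simp [letter]

theorem mk_mul_eq_of_cancel {Y : Type*} [DecidableEq Y] {p q r : SW Y} {g : FreeGroup Y} (hg : g.toWord = invRev q ++ r)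
    (h : FreeGroup.IsReduced (p ++ r)) : (FreeGroup.mk (p ++ q) * g).toWord = p ++ r := by
  rw [← FreeGroup.mk_toWord (x := g), hg, ← FreeGroup.mul_mk, ← FreeGroup.mul_mk, ← FreeGroup.inv_mk,
    mul_assoc, mul_inv_cancel_left, FreeGroup.mul_mk, FreeGroup.toWord_mk, h.reduce_eq]

/-- The words of an evaluation step by step. -/
theorem exists_stack_system [DecidableEq G'] (n : ℕ) (s : I → SW (Option G')) (hs : ∀ i, FreeGroup.IsReduced (s i))
    (hp : ∀ i, ∀ z ∈ s i, z.1 ≠ none) :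
    ∃ ρ : StackVar G' I n → SW (Option G'), (∀ i, ρ (Sum.inl i) = s i) ∧
    ∀ l : SW (Option G' ⊕ I), l.length ≤ n →
    ∃ (t : SW (Option G' ⊕ StackVar G' I n)) (ts : List (SW (Option G' ⊕ StackVar G' I n)))
      (L : List (SW (Option G' ⊕ StackVar G' I n) × SW (Option G' ⊕ StackVar G' I n))),
      (stackAct e (backWord e (value s l)) ⟨(1, []), by simp [ValidStack]⟩).1.1.toWord = value ρ t ∧
      (stackAct e (backWord e (value s l)) ⟨(1, []), by simp [ValidStack]⟩).1.2.map FreeGroup.toWord =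
        ts.map (value ρ) ∧
      (∀ p ∈ L, value ρ p.1 = value ρ p.2 ∧ FreeGroup.IsReduced (value ρ p.1)) ∧
      t.length ≤ 2 ∧ (∀ t ∈ ts, t.length ≤ 2) ∧ L.length ≤ 2 * l.length ∧
      (L.map fun p => p.1.length + p.2.length).sum ≤ 7 * l.length ∧
      ∀ τ : StackVar G' I n → SW (Option G'), (∀ p ∈ L, value τ p.1 = value τ p.2) →
        groupValue e (value (fun i => τ (Sum.inl i)) l) =
          groupValue e (value τ t) * tailValue e (ts.map (value τ)) := by
  let S : SW (Option G' ⊕ I) →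
      {S : FreeGroup (Option G') × List (FreeGroup (Option G')) // ValidStack S} :=
    fun l => stackAct e (backWord e (value s l)) ⟨(1, []), by simp [ValidStack]⟩
  let s' : Option G' ⊕ I → SW (Option G') := Sum.elim (letter id) s
  have hs' : ∀ y, FreeGroup.IsReduced (s' y) := by
    rintro (d | i)
    · simp [s', letter]
    · exact hs i
  -- When the first symbol of a suffix meets the top of the stack built by the rest, three words
  -- describe the product: what survives of the symbol, what cancels, and what survives of the top.
  -- The suffix itself indexes the new variables.
  have hdec : ∀ l : SW (Option G' ⊕ I), ∃ f : Fin 3 → SW (Option G'), ∀ y l', l = y :: l' →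
      img s' y = f 0 ++ f 1 ∧ (S l').1.1.toWord = invRev (f 1) ++ f 2 ∧
      FreeGroup.IsReduced (f 0 ++ f 2) := by
    intro l
    cases l with
    | nil => exact ⟨fun _ => [], fun y l' h => by cases h⟩
    | cons y l' =>
      obtain ⟨p, q, r, h1, h2, h3⟩ := exists_cancellation (isReduced_img (s := y) (hs' y.1))
        (FreeGroup.isReduced_toWord (x := (S l').1.1))
      exact ⟨![p, q, r], fun _ _ h => by cases h; exact ⟨h1, h2, h3⟩⟩
  choose f hf using hdec
  let ρ : StackVar G' I n → SW (Option G') := Sum.elim s fun p => f p.1.1 p.2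
  refine ⟨ρ, fun i => rfl, fun l => ?_⟩
  induction l with
  | nil =>
    intro _
    refine ⟨[], [], [], ?_, ?_, by simp, by simp, by simp, by simp, by simp, fun τ _ => ?_⟩
    · change (stackAct e 1 _).1.1.toWord = _
      rw [map_one]
      exact FreeGroup.toWord_one
    · change (stackAct e 1 _).1.2.map _ = _
      rw [map_one]
      rfl
    · simp [groupValue_nil, tailValue]
  | cons y l ih =>
    intro hl
    obtain ⟨t, ts, L, h1, h2, h3, h4, h5, h6, h7, h8⟩ := ih (Nat.le_of_succ_le hl)
    have hS : S (y :: l) = stackAct e (backWord e (img s' y)) (S l) := by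
      simp only [S, value, sub_cons, backWord_append, map_mul]
      rfl
    change (S l).1.1.toWord = _ at h1
    change (S l).1.2.map _ = _ at h2
    change ∃ t ts L, (S (y :: l)).1.1.toWord = _ ∧ (S (y :: l)).1.2.map _ = _ ∧ _
    rw [hS]
    have hcons : ∀ τ : StackVar G' I n → SW (Option G'),
        groupValue e (value (fun i => τ (Sum.inl i)) (y :: l)) =
          groupValue e (value (fun i => τ (Sum.inl i)) [y]) *
            groupValue e (value (fun i => τ (Sum.inl i)) l) := by
      intro τ
      rw [← groupValue_append]
      simp
    by_cases hy : y.1 = Sum.inl none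
    · obtain ⟨_, q⟩ := y
      subst hy
      have hS' : (stackAct e (backWord e (img s' (Sum.inl none, q))) (S l)).1 = pushPop (S l).1 := by
        cases q <;> rfl
      have hm : ∀ σ : I → SW (Option G'),
          groupValue e (value σ [(Sum.inl none, q)]) = groupValue e [(none, true)] := by
        intro σ
        cases q <;> rfl
      have hmm : groupValue e [(none, true)] * groupValue e [(none, true)] = 1 :=
        mk_of_mul_bar none
      rw [hS']
      generalize (S l).1 = S' at h1 h2
      obtain ⟨g, gs⟩ := S'
      -- Popping is correct only if the word on top is trivial, so it adds the equation `t = []`.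
      -- Pushing adds no equation.
      by_cases hpop : g = 1 ∧ gs ≠ []
      · obtain ⟨rfl, hgs⟩ := hpop
        obtain ⟨w, gs, rfl⟩ := List.exists_cons_of_ne_nil hgs
        obtain ⟨t', ts, rfl⟩ : ∃ t' ts', ts = t' :: ts' :=
          List.exists_cons_of_ne_nil (by rintro rfl; simp at h2)
        simp only [List.map_cons, List.cons.injEq] at h2
        refine ⟨t', ts, (t, []) :: L, ?_, ?_, ?_, h5 t' (by simp), fun t ht => h5 t (by simp [ht]),
          ?_, ?_, fun τ hτ => ?_⟩
        · simp [pushPop, h2.1]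
        · simp [pushPop, h2.2]
        · intro p hp
          rcases List.mem_cons.1 hp with rfl | hp
          · simp [← h1]
          · exact h3 p hp
        · simp only [List.length_cons]
          omega
        · simp only [List.map_cons, List.sum_cons, List.length_cons, List.length_nil]
          omega
        · have e1 := h8 τ fun p hp => hτ p (by simp [hp])
          have e2 := hτ (t, []) (by simp)
          rw [hcons, hm, e1, e2]
          simp only [value, sub_nil, groupValue_nil, one_mul, List.map_cons, tailValue]
          rw [← mul_assoc, ← mul_assoc, hmm, one_mul]
      · have hpp : pushPop (g, gs) = (1, g :: gs) := by
          cases gs with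
          | nil => rfl
          | cons w gs =>
            have : g ≠ 1 := fun h => hpop ⟨h, by simp⟩
            simp [pushPop, this]
        refine ⟨[], t :: ts, L, ?_, ?_, h3, by simp, ?_, ?_, ?_, fun τ hτ => ?_⟩
        · simp [hpp]
        · simpa [hpp] using ⟨h1, h2⟩
        · intro t' ht'
          rcases List.mem_cons.1 ht' with rfl | ht'
          exacts [h4, h5 _ ht']
        · simp only [List.length_cons]
          omega
        · simp only [List.length_cons]
          omega
        · rw [hcons, hm, h8 τ hτ]
          simp only [value, sub_nil, groupValue_nil, one_mul, List.map_cons, tailValue, mul_assoc]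
    · have hpure : ∀ z ∈ img s' y, z.1 ≠ none := by
        intro z hz hzn
        obtain ⟨z', hz', h⟩ := mem_img hz
        obtain ⟨d | i, q⟩ := y
        · simp only [s', letter, Sum.elim_inl, id, List.mem_singleton] at hz'
          subst hz'
          exact hy (by rw [← h] at hzn; exact congrArg Sum.inl hzn)
        · exact hp i z' hz' (h.trans hzn)
      rw [stackAct_backWord e hpure]
      obtain ⟨f1, f2, f3⟩ := hf (y :: l) y l rfl
      let V : Fin 3 → Bool → (Option G' ⊕ StackVar G' I n) × Bool :=
        fun i q => (Sum.inr (Sum.inr (⟨y :: l, hl⟩, i)), q)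
      let y' : (Option G' ⊕ StackVar G' I n) × Bool := (Sum.map id Sum.inl y.1, y.2)
      have hy' : ∀ τ : StackVar G' I n → SW (Option G'),
          value τ [y'] = value (fun i => τ (Sum.inl i)) [y] := by
        intro τ
        rw [← value_map_inl]
        simp [y']
      have hy'' : value ρ [y'] = img s' y := by
        rw [hy']
        exact sub_singleton _ _
      -- The symbol equals `V 0 V 1`, the old top equals the inverse of `V 1` followed by `V 2`, and
      -- so the new top is `V 0 V 2`. The two equations have lengths `3` and at most `4`, whence the
      -- factor `7`; tops never exceed two symbols.
      refine ⟨[V 0 true, V 2 true], ts, ([y'], [V 0 true, V 1 true]) ::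
        (t, [V 1 false, V 2 true]) :: L, ?_, h2, ?_, by simp, h5, ?_, ?_, fun τ hτ => ?_⟩
      · rw [f1, mk_mul_eq_of_cancel f2 f3]
        simp [V, ρ]
      · intro p hp
        rcases List.mem_cons.1 hp with rfl | hp
        · rw [hy'']
          refine ⟨?_, isReduced_img (hs' y.1)⟩
          rw [f1]
          simp [V, ρ]
        rcases List.mem_cons.1 hp with rfl | hp
        · rw [← h1]
          refine ⟨?_, FreeGroup.isReduced_toWord⟩
          rw [f2]
          simp [V, ρ]
        · exact h3 p hp
      · simp only [List.length_cons]
        omega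
      · simp only [List.map_cons, List.sum_cons, List.length_cons, List.length_nil]
        omega
      · have e1 := h8 τ fun p hp => hτ p (by simp [hp])
        have e2 := hτ ([y'], [V 0 true, V 1 true]) (by simp)
        have e3 := hτ (t, [V 1 false, V 2 true]) (by simp)
        simp only at e2 e3
        rw [hcons, ← hy', e1, e2, e3]
        simp only [value, V, sub_cons, sub_nil, List.append_nil, groupValue_append, img_true,
          img_false, Sum.elim_inr]
        rw [← mul_assoc]
        congr 1
        rw [mul_assoc, ← mul_assoc (groupValue e _) (groupValue e (invRev _)),
          groupValue_mul_invRev, one_mul]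

/-- An equation over the group is equivalent to systems of reduced words. -/
theorem exists_group_system [DecidableEq G'] (u v : SW (Option G' ⊕ I)) (s : I → SW (Option G'))
    (hs : ∀ i, FreeGroup.IsReduced (s i)) (hp : ∀ i, ∀ z ∈ s i, z.1 ≠ none)
    (h : groupValue e (value s u) = groupValue e (value s v)) :
    ∃ (ρ : StackVar G' I (u ++ invRev v).length → SW (Option G'))
      (L : List (SW (Option G' ⊕ StackVar G' I (u ++ invRev v).length) ×
        SW (Option G' ⊕ StackVar G' I (u ++ invRev v).length))),
      (∀ i, ρ (Sum.inl i) = s i) ∧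
      (∀ p ∈ L, value ρ p.1 = value ρ p.2 ∧ FreeGroup.IsReduced (value ρ p.1)) ∧
      L.length ≤ 2 * (u.length + v.length) + 1 ∧
      (L.map fun p => p.1.length + p.2.length).sum ≤ 7 * (u.length + v.length) + 2 ∧
      ∀ τ : StackVar G' I (u ++ invRev v).length → SW (Option G'),
        (∀ p ∈ L, value τ p.1 = value τ p.2) →
        groupValue e (value (fun i => τ (Sum.inl i)) u) =
          groupValue e (value (fun i => τ (Sum.inl i)) v) := by
  obtain ⟨ρ, hρ, H⟩ := exists_stack_system e (u ++ invRev v).length s hs hp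
  obtain ⟨t, ts, L, h1, h2, h3, h4, h5, h6, h7, h8⟩ := H _ le_rfl
  have hval : ∀ σ : I → SW (Option G'),
      value σ (u ++ invRev v) = value σ u ++ invRev (value σ v) := by
    intro σ
    simp only [value, sub_append, sub_invRev]
  -- The word `u v⁻¹` represents `1` and acts trivially. The stack at the end is therefore one empty
  -- word, and stating this costs one more equation of length at most two.
  have hone : stackAct e (backWord e (value s (u ++ invRev v))) = 1 := by
    rw [← map_one (stackAct e)]
    apply stackAct_eq_of_mk_eq
    change groupValue e _ = _
    rw [hval, groupValue_append, h, groupValue_mul_invRev, map_one]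
  rw [hone] at h1 h2
  change FreeGroup.toWord 1 = _ at h1
  change [] = _ at h2
  obtain rfl : ts = [] := by simpa using h2.symm
  have hlen : (u ++ invRev v).length = u.length + v.length := by simp
  refine ⟨ρ, (t, []) :: L, hρ, ?_, ?_, ?_, fun τ hτ => ?_⟩
  · intro p hp
    rcases List.mem_cons.1 hp with rfl | hp
    · simp [← h1]
    · exact h3 p hp
  · simp only [List.length_cons]
    omega
  · simp only [List.map_cons, List.sum_cons, List.length_nil]
    omega
  · have e1 := h8 τ fun p hp => hτ p (by simp [hp])
    have e2 := hτ (t, []) (by simp)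
    rw [e2, hval, groupValue_append] at e1
    simp only [value, sub_nil, groupValue_nil, List.map_nil, tailValue, mul_one] at e1
    have := congrArg (· * groupValue e (value (fun i => τ (Sum.inl i)) v)) e1
    simpa only [value, mul_assoc, groupValue_invRev_mul, mul_one, one_mul] using this

end GroupSystem

/-! ## The solutions of an equation in signed words -/

section Equation

variable {G : Type*} {G' I : Type} (e : G ≃ G')

/-- Equality of the values of signed words. -/
def SignedEq : Ambient → SW (Option G') → SW (Option G') → Prop
  | .freeMonoid, a, b => a = b
  | .freeGroup, a, b => groupValue e a = groupValue e b

variable {e}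

theorem SignedEq.backWord {k : Ambient} {a b : SW (Option G')} (h : SignedEq e k a b) :
    k.Eq (backWord e a) (backWord e b) := by
  cases k with
  | freeMonoid => exact congrArg _ h
  | freeGroup => exact h

variable (e)

/-- The signed words are reduced and do not contain the marker. -/
def PureReduced (w : SW (Option G')) : Prop := FreeGroup.IsReduced w ∧ ∀ z ∈ w, z.1 ≠ none

/-- Over the free monoid the auxiliary variables are idle and set to the empty word. In the last
clause `τ` need not be reduced, since paths of the graph may decode to arbitrary assignments. -/
theorem exists_system [DecidableEq G'] (k : Ambient) (u v : SW (Option G' ⊕ I))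
    (s : I → SW (Option G')) (hs : ∀ i, PureReduced (s i))
    (h : SignedEq e k (value s u) (value s v)) :
    ∃ (ρ : StackVar G' I (u ++ invRev v).length → SW (Option G'))
      (L : List (SW (Option G' ⊕ StackVar G' I (u ++ invRev v).length) ×
        SW (Option G' ⊕ StackVar G' I (u ++ invRev v).length))),
      (∀ i, ρ (Sum.inl i) = s i) ∧
      (∀ p ∈ L, value ρ p.1 = value ρ p.2 ∧ FreeGroup.IsReduced (value ρ p.1)) ∧
      L.length ≤ 2 * (u.length + v.length) + 1 ∧
      (L.map fun p => p.1.length + p.2.length).sum ≤ 7 * (u.length + v.length) + 2 ∧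
      ∀ τ : StackVar G' I (u ++ invRev v).length → SW (Option G'),
        (∀ p ∈ L, value τ p.1 = value τ p.2) →
        SignedEq e k (value (fun i => τ (Sum.inl i)) u) (value (fun i => τ (Sum.inl i)) v) := by
  cases k with
  | freeGroup => exact exists_group_system e u v s (fun i => (hs i).1) (fun i => (hs i).2) h
  | freeMonoid =>
    let emb : SW (Option G' ⊕ I) → SW (Option G' ⊕ StackVar G' I (u ++ invRev v).length) :=
      sub (letter (Sum.map id Sum.inl))
    have hemb : ∀ w, (emb w).length = w.length := fun w => by simp [emb, sub_letter]
    let ρ : StackVar G' I (u ++ invRev v).length → SW (Option G') := Sum.elim s fun _ => []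
    have hρ : ∀ x, FreeGroup.IsReduced (ρ x) := by
      rintro (i | x)
      · exact (hs i).1
      · exact List.isChain_nil
    obtain ⟨L, h1, h2, h3, h4⟩ := exists_reduced_pieces hρ (u := emb u) (v := emb v) (by
      rw [value_map_inl, value_map_inl]
      exact h)
    refine ⟨ρ, L, fun i => rfl, h4, ?_, ?_, fun τ hτ => ?_⟩
    · rw [hemb] at h3
      omega
    · have e1 := congrArg List.length h1
      have e2 := congrArg List.length h2
      rw [hemb, List.length_flatten, List.map_map] at e1 e2
      have : (L.map fun p => p.1.length + p.2.length).sum =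
          (L.map (List.length ∘ Prod.fst)).sum + (L.map (List.length ∘ Prod.snd)).sum :=
        List.sum_map_add
      omega
    · change value _ u = value _ v
      rw [← value_map_inl, ← value_map_inl]
      change value τ (emb u) = value τ (emb v)
      rw [← h1, ← h2]
      simp only [value, sub_flatten, List.map_map]
      congr 1
      exact List.map_congr_left fun p hp => hτ p hp

/-- Padding with trivial equations gives all systems the same index set without adding length. -/
theorem sum_getD {A : Type*} (f : A → ℕ) {d : A} (hd : f d = 0) (L : List A) {K : ℕ}
    (hK : L.length ≤ K) : ∑ j : Fin K, f (L.getD j d) = (L.map f).sum := by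
  rw [Fin.sum_univ_eq_sum_range (fun j => f (L.getD j d))]
  induction L generalizing K with
  | nil => simp [hd]
  | cons a L ih =>
    obtain ⟨K, rfl⟩ : ∃ K', K = K' + 1 := ⟨K - 1, by simp only [List.length_cons] at hK; omega⟩
    rw [Finset.sum_range_succ']
    simp only [List.getD_cons_succ, List.getD_cons_zero, List.map_cons, List.sum_cons]
    rw [ih (by simpa using hK), add_comm]

/-- The words of a system: the variables of the equation and the sides of auxiliary equations. -/
abbrev SystemIndex (I : Type) (n : ℕ) := I ⊕ (Fin (2 * n + 1) × Bool)

/-- The size of the pools of letters. -/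
def poolSize (r n : ℕ) : ℕ := 20 * (r + 7 * n + 2) + (r + 2 * (2 * n + 1))

/-- Different solutions lead to different systems, but all of them obey one length bound and can
serve as starting points of a single graph. Each variable is itself a word of the system, so its
value appears at a seed. -/
theorem exists_ratIn_of_equation [Finite G'] [Finite I] (k : Ambient) (u v : SW (Option G' ⊕ I)) :
    ∃ R : Set (SSub (Ltr (Option G') (Fin (poolSize (Nat.card I) (u.length + v.length)))
        (SystemIndex I (u.length + v.length)))),
      RatIn (fixing Ltr.base) R ∧
      (∀ m ∈ R, ∃ τ : I → SW (Option G'),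
        (∀ i, m (.seed (Sum.inl i)) = sub (letter Ltr.base) (τ i)) ∧
        SignedEq e k (value τ u) (value τ v)) ∧
      (∀ s : I → SW (Option G'), (∀ i, PureReduced (s i)) → SignedEq e k (value s u) (value s v) →
        ∃ m ∈ R, ∀ i, m (.seed (Sum.inl i)) = sub (letter Ltr.base) (s i)) := by
  classical
  have := Fintype.ofFinite I
  have := Fintype.ofFinite G'
  set n := u.length + v.length with hn
  let X := StackVar G' I (u ++ invRev v).length
  have hXfin : Finite {l : SW (Option G' ⊕ I) // l.length ≤ (u ++ invRev v).length} :=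
    (List.finite_length_le (α := (Option G' ⊕ I) × Bool) _).to_subtype
  -- One symbol for each variable and `7 * n + 2` for the equations. This bounds the total length,
  -- and therefore also the number of occurrences of variables.
  let N := Nat.card I + 7 * n + 2
  let E : SystemIndex I n → SystemIndex I n → Prop := fun j j' =>
    ∃ a, j = Sum.inr (a, true) ∧ j' = Sum.inr (a, false)
  let 𝒲 : Set (SystemIndex I n → SW (Option G' ⊕ X)) := {W | ∑ j, (W j).length ≤ N ∧
    (∀ i, W (Sum.inl i) = [(Sum.inr (Sum.inl i), true)]) ∧
    ∀ τ : X → SW (Option G'), (∀ j j', E j j' → value τ (W j) = value τ (W j')) →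
      SignedEq e k (value (fun i => τ (Sum.inl i)) u) (value (fun i => τ (Sum.inl i)) v)}
  have hJ : Fintype.card (SystemIndex I n) = Nat.card I + 2 * (2 * n + 1) := by
    simp [mul_comm]
  obtain ⟨R, hR, hsound, hcomplete⟩ := exists_ratIn_of_systems
    (P := Fin (poolSize (Nat.card I) n)) (J := SystemIndex I n) (N := N)
    (by rw [hJ]; simp [poolSize, N]) E 𝒲 (fun W hW => hW.1.trans (by omega))
    (fun W hW => (Finset.sum_le_sum fun j _ => List.countP_le_length).trans hW.1)
  refine ⟨R, hR, fun m hm => ?_, fun s hs h => ?_⟩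
  · obtain ⟨W, hW, τ, hτ, hE⟩ := hsound m hm
    refine ⟨fun i => τ (Sum.inl i), fun i => ?_, hW.2.2 τ hE⟩
    rw [hτ, hW.2.1]
    simp [value]
  · obtain ⟨ρ, L, h1, h2, h3, h4, h5⟩ := exists_system e k u v s hs h
    let W : SystemIndex I n → SW (Option G' ⊕ X) := fun j =>
      match j with
      | Sum.inl i => [(Sum.inr (Sum.inl i), true)]
      | Sum.inr (a, true) => (L.getD a ([], [])).1
      | Sum.inr (a, false) => (L.getD a ([], [])).2
    have hWmem : W ∈ 𝒲 := by
      refine ⟨?_, fun i => rfl, fun τ hτ => h5 τ fun p hp => ?_⟩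
      · have h6 := sum_getD (fun p : SW (Option G' ⊕ X) × SW (Option G' ⊕ X) =>
          p.1.length + p.2.length) (d := ([], [])) rfl L h3
        rw [Fintype.sum_sum_type, Fintype.sum_prod_type]
        simp only [Fintype.sum_bool, W, List.length_singleton, Finset.sum_const, Finset.card_univ,
          smul_eq_mul, mul_one]
        refine le_trans (Nat.add_le_add_left (h6.trans_le h4) _) ?_
        rw [← Nat.card_eq_fintype_card]
        omega
      · obtain ⟨a, ha, rfl⟩ := List.getElem_of_mem hp
        have := hτ (Sum.inr (⟨a, ha.trans_le h3⟩, true)) (Sum.inr (⟨a, ha.trans_le h3⟩, false))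
          ⟨_, rfl, rfl⟩
        simpa [W, ha] using this
    have hpair : ∀ a, value ρ (L.getD a ([], [])).1 = value ρ (L.getD a ([], [])).2 ∧
        FreeGroup.IsReduced (value ρ (L.getD a ([], [])).1) := by
      intro a
      by_cases ha : a < L.length
      · have := h2 _ (List.getElem_mem ha)
        simpa [ha] using this
      · have : L.getD a ([], []) = ([], []) := List.getD_eq_default _ _ (by omega)
        rw [this]
        exact ⟨rfl, List.isChain_nil⟩
    obtain ⟨m, hm, hm'⟩ := hcomplete W hWmem ρ
      (by rintro _ _ ⟨a, rfl, rfl⟩; exact (hpair a).1)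
      (by
        rintro (i | ⟨a, _ | _⟩)
        · simpa [W, value, h1] using (hs i).1
        · exact (hpair a).1 ▸ (hpair a).2
        · exact (hpair a).2)
    refine ⟨m, hm, fun i => ?_⟩
    rw [hm' (Sum.inl i)]
    simp [W, value, h1]

end Equation

/-! ### Reducedness as a recognizable condition -/

section Recognizable

variable {D : Type} (p : D × Bool → Prop)

open Classical in
/-- The automaton that recognizes reduced words over the letters with property `p`. -/
noncomputable def reducedStep (z : D × Bool) : Option (Option (D × Bool)) → Option (Option (D × Bool))
  | some none => if p z then some (some z) else none
  | some (some y) => if p z ∧ z ≠ flip y then some (some z) else none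
  | none => none

/-- The transitions of a word. -/
def runWord {Q : Type} (ψ : D × Bool → Q → Q) (w : SW D) (q : Q) : Q := w.foldl (fun q z => ψ z q) q

theorem runWord_sub {Q : Type} (ψ : D × Bool → Q → Q) (m : SSub D) (w : SW D) (q : Q) :
    runWord ψ (sub m w) q = runWord (fun z => runWord ψ (img m z)) w q := by
  induction w generalizing q with
  | nil => rfl
  | cons z w ih =>
    rw [sub_cons, runWord, List.foldl_append]
    exact ih _

theorem runWord_none (w : SW D) : runWord (reducedStep p) w none = none := by
  induction w with
  | nil => rfl
  | cons z w ih => exact ih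

theorem runWord_reducedStep (w : SW D) (o : Option (D × Bool)) :
    runWord (reducedStep p) w (some o) ≠ none ↔
      FreeGroup.IsReduced (o.toList ++ w) ∧ ∀ z ∈ w, p z := by
  induction w generalizing o with
  | nil => cases o <;> simp [runWord]
  | cons z w ih =>
    have hcons : runWord (reducedStep p) (z :: w) (some o) =
        runWord (reducedStep p) w (reducedStep p z (some o)) := rfl
    rw [hcons]
    cases o with
    | none =>
      by_cases hz : p z
      · have := ih (some z)
        simp only [reducedStep, hz, if_true] at this ⊢
        rw [this]
        simp [hz]
      · simp [reducedStep, hz, runWord_none]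
    | some y =>
      have hflip : z ≠ flip y ↔ (y.1 = z.1 → y.2 = z.2) := by
        obtain ⟨y, b⟩ := y
        obtain ⟨z, c⟩ := z
        cases b <;> cases c <;> simp [SW.flip, eq_comm]
      by_cases hz : p z ∧ z ≠ flip y
      · have := ih (some z)
        simp only [reducedStep, hz, if_true, ne_eq, not_false_eq_true, and_self] at this ⊢
        rw [this]
        have h2 := hflip.1 hz.2
        simp only [FreeGroup.IsReduced, Option.toList_some, List.singleton_append,
          List.isChain_cons_cons, List.mem_cons, forall_eq_or_imp, hz.1, true_and]
        exact ⟨fun h => ⟨⟨h2, h.1⟩, h.2⟩, fun h => ⟨h.1.2, h.2⟩⟩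
      · simp only [reducedStep, hz, if_false, runWord_none, ne_eq, not_true_eq_false, false_iff]
        rintro ⟨h1, h2⟩
        refine hz ⟨h2 z (by simp), hflip.2 ?_⟩
        have := (List.isChain_cons_cons.1 h1).1
        exact this

/-- Substitutions act from the right on the finitely many transition tables of an automaton for
reduced words: a new table runs the old one along the image of each letter. The final table tells
whether the images of the letters in `T` are accepted. -/
theorem RatIn.filter_reduced [Finite D] {P R : Set (SSub D)} (h : RatIn P R) (T : Set D) :
    RatIn P {m ∈ R | ∀ d ∈ T, FreeGroup.IsReduced (m d) ∧ ∀ z ∈ m d, p z} := by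
  have h1 := h.filter (S := D × Bool → Option (Option (D × Bool)) → Option (Option (D × Bool)))
    (fun ψ m z => runWord ψ (img m z)) (fun ψ => by
      funext z q
      have : img (1 : SSub D) z = [z] := by
        rw [← sub_singleton]
        exact SSub.sub_one _
      rw [this]
      rfl) (fun ψ a b => by
      funext z q
      rw [← runWord_sub]
      congr 1
      exact (sub_img a b z).symm) (reducedStep p) {ψ | ∀ d ∈ T, ψ (d, true) (some none) ≠ none}
  convert h1 using 1
  ext m
  simp only [Set.mem_ofPred_eq, img_true, runWord_reducedStep, Option.toList_none, List.nil_append]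

end Recognizable

/-! ## Translation between words with involution and signed words -/

section Translation

variable {G I : Type*} {G' I' : Type} (e : G ≃ G') (eI : I ≃ I')

/-- Words of the alphabet with involution as signed words. -/
def signedWord (w : FreeMonoid (Letter G)) : SW (Option G') := w.toList.map (signedLetter e)

/-- The words of an equation as signed words. -/
def signedEqWord (U : EqWord G I) : SW (Option G' ⊕ I') :=
  U.toList.map (Sum.elim (fun a => (Sum.inl (signedLetter e a).1, (signedLetter e a).2))
    fun X => (Sum.inr (eI X.1), X.2))

/-- The assignment given by signed words. -/
def toAssignment (τ : I' → SW (Option G')) : Variable I → FreeMonoid (Letter G) :=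
  fun X => backWord e (img τ (eI X.1, X.2))

theorem toList_barWord {C : Type*} (bar : C → C) (w : FreeMonoid C) :
    (barWord bar w).toList = (w.toList.map bar).reverse := rfl

theorem backWord_signedWord (w : FreeMonoid (Letter G)) : backWord e (signedWord e w) = w := by
  simp only [backWord, signedWord, List.map_map]
  rw [show backLetter e ∘ signedLetter e = id from funext (backLetter_signedLetter e), List.map_id]
  exact FreeMonoid.ofList_toList w

theorem backWord_invRev (w : SW (Option G')) :
    backWord e (invRev w) = barWord Letter.bar (backWord e w) := by
  apply FreeMonoid.toList.injective
  simp only [backWord, toList_barWord, invRev_eq, FreeMonoid.toList_ofList, List.map_reverse,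
    List.map_map]
  congr 2
  funext z
  exact backLetter_flip e z

theorem backWord_value (τ : I' → SW (Option G')) (U : EqWord G I) :
    backWord e (value τ (signedEqWord e eI U)) = evalWord (toAssignment e eI τ) U := by
  induction U using FreeMonoid.inductionOn' with
  | one => rfl
  | of_mul x U ih =>
    rw [map_mul, ← ih]
    simp only [signedEqWord, FreeMonoid.toList_mul, FreeMonoid.toList_of, List.map_append, value,
      sub_append, backWord_append]
    congr 1
    rcases x with (_ | ⟨g, q⟩) | X
    · rfl
    · cases q <;> simp [signedLetter, letter, backWord, backLetter, evalWord, FreeGroup.invRev]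
    · simp [toAssignment, evalWord, img]

/-- The marker must be excluded: it is its own bar as a letter, but not its own inverse as a signed
letter. -/
theorem signedWord_barWord {w : FreeMonoid (Letter G)} (hw : marker ∉ w.toList) :
    signedWord e (barWord Letter.bar w) = invRev (signedWord e w) := by
  simp only [signedWord, toList_barWord, invRev_eq, List.map_reverse, List.map_map]
  congr 1
  refine List.map_congr_left fun a ha => ?_
  rcases a with _ | ⟨g, q⟩
  · exact absurd ha hw
  · rfl

theorem isReducedWord_backWord {w : SW (Option G')} :
    IsReducedWord (backWord e w) ↔ PureReduced w := by
  constructor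
  · rintro ⟨h1, h2⟩
    refine ⟨?_, ?_⟩
    · rw [FreeGroup.IsReduced, List.isChain_iff_forall_rel_of_append_cons_cons]
      rintro a b l₁ l₂ rfl hab
      by_contra hne
      have hb : b = flip a := by
        refine Prod.ext hab.symm ?_
        cases ha : a.2 <;> cases hb : b.2 <;> simp_all
      refine h2 (backLetter e a) ⟨l₁.map (backLetter e), l₂.map (backLetter e), ?_⟩
      rw [← backLetter_flip, ← hb]
      simp [backWord]
    · rintro ⟨_ | g, q⟩ hz h0
      · exact h1 (List.mem_map_of_mem (f := backLetter e) hz)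
      · cases h0
  · rintro ⟨h1, h2⟩
    refine ⟨fun hm => ?_, fun a ha => ?_⟩
    · obtain ⟨⟨_ | g, q⟩, hz, h0⟩ := List.mem_map.1 hm
      · exact h2 _ hz rfl
      · cases h0
    · obtain ⟨s, t, hst⟩ := ha
      rw [List.append_assoc] at hst
      obtain ⟨l₁, l', rfl, rfl, h3⟩ := List.map_eq_append_iff.1 hst.symm
      obtain ⟨z₁, l'', rfl, hz₁, h4⟩ := List.map_eq_cons_iff.1 h3
      obtain ⟨z₂, l₂, rfl, hz₂, h5⟩ := List.map_eq_cons_iff.1 h4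
      have hc := (List.isChain_cons_cons.1 (List.isChain_append.1 h1).2.1).1
      rw [← hz₁, ← backLetter_flip] at hz₂
      obtain ⟨_ | g₁, q₁⟩ := z₁
      · exact h2 (none, q₁) (by simp) rfl
      obtain ⟨_ | g₂, q₂⟩ := z₂
      · exact h2 (none, q₂) (by simp) rfl
      simp only [backLetter, SW.flip, Option.some.injEq, Prod.mk.injEq,
        EmbeddingLike.apply_eq_iff_eq] at hz₂
      have := hc (by rw [hz₂.1])
      simp [hz₂.2] at this

theorem solves_toAssignment {k : Ambient} {U V : EqWord G I} {τ : I' → SW (Option G')}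
    (hτ : ∀ i, PureReduced (τ i))
    (h : SignedEq e k (value τ (signedEqWord e eI U)) (value τ (signedEqWord e eI V))) :
    SolvesReduced k U V (toAssignment e eI τ) where
  map_bar X := by
    rw [toAssignment, toAssignment, ← backWord_invRev, ← img_flip]
    rfl
  reduced X := by
    rw [toAssignment, isReducedWord_backWord]
    obtain ⟨i, _ | _⟩ := X
    · refine ⟨isReduced_invRev (hτ _).1, fun z hz => ?_⟩
      exact (hτ (eI i)).2 (flip z) (mem_invRev.1 hz)
    · exact hτ _
  eq := by
    rw [← backWord_value, ← backWord_value]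
    exact h.backWord

/-- Solutions contain no marker, and markers of the equation always receive the positive sign. So
nothing is lost by giving the marker a formal inverse, and equal words become equal signed words. -/
theorem SolvesReduced.exists_signed {k : Ambient} {U V : EqWord G I}
    {σ : Variable I → FreeMonoid (Letter G)} (h : SolvesReduced k U V σ) :
    ∃ s : I' → SW (Option G'), (∀ i, PureReduced (s i)) ∧
      SignedEq e k (value s (signedEqWord e eI U)) (value s (signedEqWord e eI V)) ∧
      toAssignment e eI s = σ := by
  let s : I' → SW (Option G') := fun i => signedWord e (σ (eI.symm i, true))
  have hσ : toAssignment e eI s = σ := by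
    funext ⟨i, b⟩
    cases b
    · simp only [toAssignment, img_false, s, Equiv.symm_apply_apply, backWord_invRev,
        backWord_signedWord]
      exact (h.map_bar (i, true)).symm
    · simp only [toAssignment, img_true, s, Equiv.symm_apply_apply, backWord_signedWord]
  have hval : ∀ U : EqWord G I, signedWord e (evalWord σ U) = value s (signedEqWord e eI U) := by
    intro U
    induction U using FreeMonoid.inductionOn' with
    | one => rfl
    | of_mul x U ih =>
      rw [map_mul]
      have h1 : ∀ a b : FreeMonoid (Letter G), signedWord e (a * b) =
          signedWord e a ++ signedWord e b := fun a b => by simp [signedWord]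
      rw [h1, ih]
      simp only [signedEqWord, FreeMonoid.toList_mul, FreeMonoid.toList_of, List.map_append, value,
        sub_append]
      congr 1
      rcases x with (_ | ⟨g, q⟩) | ⟨i, q⟩
      · rfl
      · cases q <;> rfl
      · cases q
        · have : signedWord e (σ (i, false)) = invRev (signedWord e (σ (i, true))) := by
            rw [← signedWord_barWord e (h.reduced _).1]
            exact congrArg _ (h.map_bar (i, true))
          simp [evalWord, s, this]
        · simp [evalWord, s]
  refine ⟨s, fun i => ?_, ?_, hσ⟩
  · rw [← isReducedWord_backWord e, backWord_signedWord]
    exact h.reduced _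
  · rw [← hval, ← hval]
    cases k with
    | freeMonoid => exact congrArg _ h.eq
    | freeGroup =>
      simp only [SignedEq, groupValue, backWord_signedWord]
      exact h.eq

end Translation

/-! ## The automaton for the solutions -/

section Endomorphisms

variable {D : Type}

/-- Signed words as words over the alphabet with involution and marker. -/
def plainWord (w : SW D) : FreeMonoid (Letter D) := FreeMonoid.ofList (w.map some)

theorem plainWord_injective : Function.Injective (plainWord : SW D → FreeMonoid (Letter D)) :=
  fun _ _ h => List.map_injective_iff.2 (Option.some_injective _) (FreeMonoid.ofList.injective h)

theorem plainWord_append (u v : SW D) : plainWord (u ++ v) = plainWord u * plainWord v := by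
  simp [plainWord]

theorem plainWord_invRev (w : SW D) : plainWord (invRev w) = barWord Letter.bar (plainWord w) := by
  apply FreeMonoid.toList.injective
  simp only [plainWord, toList_barWord, invRev_eq, FreeMonoid.toList_ofList, List.map_reverse,
    List.map_map]
  rfl

theorem barWord_mul {C : Type*} (bar : C → C) (u v : FreeMonoid C) :
    barWord bar (u * v) = barWord bar v * barWord bar u := by
  rw [barWord, map_mul, FreeMonoid.reverse_mul]
  rfl

/-- A signed substitution as an endomorphism of the free monoid. -/
def endOf (h : SSub D) : FreeMonoid (Letter D) →* FreeMonoid (Letter D) :=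
  FreeMonoid.lift fun a => match a with
    | none => FreeMonoid.of none
    | some z => plainWord (img h z)

theorem endOf_some (h : SSub D) (z : D × Bool) :
    endOf h (FreeMonoid.of (some z)) = plainWord (img h z) := FreeMonoid.lift_eval_of _ _

theorem endOf_none (h : SSub D) : endOf h (FreeMonoid.of none) = FreeMonoid.of none :=
  FreeMonoid.lift_eval_of _ _

theorem endOf_plainWord (h : SSub D) (w : SW D) : endOf h (plainWord w) = plainWord (sub h w) := by
  induction w with
  | nil => exact map_one _
  | cons z w ih =>
    rw [show z :: w = [z] ++ w from rfl, plainWord_append, map_mul, ih, sub_append, plainWord_append,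
      sub_singleton]
    congr 1

/-- The passage to endomorphisms is multiplicative. -/
def endHom : SSub D →* Monoid.End (FreeMonoid (Letter D)) where
  toFun := endOf
  map_one' := by
    refine FreeMonoid.hom_eq fun a => ?_
    rcases a with _ | ⟨d, _ | _⟩
    · exact endOf_none _
    · exact endOf_some _ _
    · exact endOf_some _ _
  map_mul' h g := by
    have key : ∀ a, endOf (h * g) (FreeMonoid.of a) = endOf h (endOf g (FreeMonoid.of a)) := by
      rintro (_ | z)
      · rw [endOf_none, endOf_none, endOf_none]
      · rw [endOf_some, endOf_some, endOf_plainWord]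
        congr 1
        exact (sub_img h g z).symm
    exact FreeMonoid.hom_eq key

theorem endOf_barWord (h : SSub D) (w : FreeMonoid (Letter D)) :
    endOf h (barWord Letter.bar w) = barWord Letter.bar (endOf h w) := by
  induction w using FreeMonoid.inductionOn' with
  | one =>
    change endOf h 1 = barWord _ (endOf h 1)
    rw [map_one]
    rfl
  | of_mul a w ih =>
    rw [barWord_mul, map_mul, map_mul, barWord_mul, ih]
    congr 1
    rcases a with _ | z
    · change endOf h (FreeMonoid.of none) = barWord _ (endOf h (FreeMonoid.of none))
      rw [endOf_none]
      rfl
    · change endOf h (FreeMonoid.of (some (flip z))) = _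
      rw [endOf_some, endOf_some, img_flip, plainWord_invRev]

end Endomorphisms

/-! ### From sets of substitutions to automata of endomorphisms -/

section Automaton

variable {G I : Type*} {G' I' D : Type} (e : G ≃ G') (eI : I ≃ I')
  (base : Option G' ↪ D) (seed : I' → D)

/-- The inclusion of the letters of the equation. -/
def letterIncl : Letter G ↪ Letter D where
  toFun := Option.map fun p => (base (some (e p.1)), p.2)
  inj' := Option.map_injective fun p q h => by
    obtain ⟨g, b⟩ := p
    obtain ⟨g', b'⟩ := q
    simpa using h

/-- The extended alphabet with an automaton. -/
def seedAutomaton [Finite D] (𝒜 : MonoidNFA (Monoid.End (FreeMonoid (Letter D)))) : EndoAutomaton G I where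
  C := Letter D
  bar := Letter.bar
  bar_bar := Letter.bar_bar
  incl := letterIncl e base
  incl_bar a := by rcases a with _ | a <;> rfl
  seed i := some (seed (eI i), true)
  nfa := 𝒜

theorem map_letterIncl_backWord {w : SW (Option G')} (hw : ∀ z ∈ w, z.1 ≠ none) :
    FreeMonoid.map (letterIncl e base) (backWord e w) = plainWord (sub (letter base) w) := by
  apply FreeMonoid.toList.injective
  simp only [backWord, plainWord, sub_letter, FreeMonoid.toList_map, FreeMonoid.toList_ofList,
    List.map_map]
  refine List.map_congr_left fun z hz => ?_
  obtain ⟨_ | g, q⟩ := z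
  · exact absurd rfl (hw _ hz)
  · simp [backLetter, letterIncl]

/-- A set of substitutions yields the solutions of an equation. -/
structure Describes (k : Ambient) (U V : EqWord G I) (R : Set (SSub D)) : Prop where
  sound : ∀ m ∈ R, ∃ s : I' → SW (Option G'), (∀ i, PureReduced (s i)) ∧
    SolvesReduced k U V (toAssignment e eI s) ∧ ∀ i, m (seed i) = sub (letter base) (s i)
  complete : ∀ σ, SolvesReduced k U V σ → ∃ m ∈ R, ∃ s : I' → SW (Option G'),
    (∀ i, PureReduced (s i)) ∧ toAssignment e eI s = σ ∧ ∀ i, m (seed i) = sub (letter base) (s i)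

variable {e eI base seed}

theorem Describes.produces [Finite D] {k : Ambient} {U V : EqWord G I} {R : Set (SSub D)}
    (H : Describes e eI base seed k U V R) {𝒜 : MonoidNFA (Monoid.End (FreeMonoid (Letter D)))}
    (hP : ∀ p a q, (p, a, q) ∈ 𝒜.edges → a ∈ endHom '' fixing base)
    (hR : 𝒜.accepted = endHom '' R) (htrim : 𝒜.IsTrim)
    (hne : Nonempty 𝒜.State ↔ ∃ σ, SolvesReduced k U V σ)
    (hcycle : 𝒜.HasCycle ↔ {σ | SolvesReduced k U V σ}.Infinite) :
    (seedAutomaton e eI base seed 𝒜).Produces k U V where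
  label_fix p h q hh a := by
    obtain ⟨m, hm, rfl⟩ := hP p h q hh
    rcases a with _ | ⟨g, b⟩
    · exact endOf_none m
    · refine (endOf_some m (base (some (e g)), b)).trans ?_
      cases b <;> simp [hm (some (e g)), plainWord, FreeGroup.invRev] <;> rfl
  label_bar p h q hh w := by
    obtain ⟨m, hm, rfl⟩ := hP p h q hh
    exact endOf_barWord m w
  trim := htrim
  tuples := by
    have key : ∀ (s : I' → SW (Option G')), (∀ i, PureReduced (s i)) → ∀ m : SSub D,
        (∀ i, m (seed i) = sub (letter base) (s i)) → ∀ i,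
        FreeMonoid.map (letterIncl e base) (toAssignment e eI s (i, true)) =
          endHom m (FreeMonoid.of (some (seed (eI i), true))) := by
      intro s hs m hm i
      change _ = endOf m _
      rw [endOf_some, img_true, hm, toAssignment, img_true, map_letterIncl_backWord _ _ (hs _).2]
    ext t
    constructor
    · rintro ⟨σ, hσ, ht⟩
      obtain ⟨m, hm, s, h1, rfl, hm'⟩ := H.complete σ hσ
      refine ⟨endHom m, hR ▸ ⟨m, hm, rfl⟩, fun i => ?_⟩
      rw [ht]
      exact key s h1 m hm' i
    · rintro ⟨h, hh, ht⟩
      change h ∈ 𝒜.accepted at hh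
      rw [hR] at hh
      obtain ⟨m, hm, rfl⟩ := hh
      obtain ⟨s, h1, h2, h3⟩ := H.sound m hm
      refine ⟨_, h2, fun i => ?_⟩
      rw [ht]
      exact (key s h1 m h3 i).symm
  nonempty_iff := hne
  cycle_iff := hcycle

/-- An endomorphism determines the assignment, which can be read off from its values at the seeds.
The default value `1` occurs only for endomorphisms that describe no assignment. -/
theorem Describes.infinite {k : Ambient} {U V : EqWord G I} {R : Set (SSub D)}
    (H : Describes e eI base seed k U V R) (h : {σ | SolvesReduced k U V σ}.Infinite) :
    (endHom '' R).Infinite := by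
  intro hfin
  refine h ?_
  have hinj : Function.Injective fun z : Option G' × Bool => (base z.1, z.2) := by
    rintro ⟨x, b⟩ ⟨y, c⟩ hxy
    simpa using hxy
  let val : Monoid.End (FreeMonoid (Letter D)) → Variable I → FreeMonoid (Letter G) := fun f =>
    open Classical in
    if hs : ∃ s : I' → SW (Option G'), ∀ i, f (FreeMonoid.of (some (seed i, true))) =
      plainWord (sub (letter base) (s i)) then toAssignment e eI hs.choose else fun _ => 1
  refine (hfin.image val).subset ?_
  intro σ hσ
  obtain ⟨m, hm, s, h1, rfl, hm'⟩ := H.complete σ hσ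
  have hs : ∀ i, endHom m (FreeMonoid.of (some (seed i, true))) =
      plainWord (sub (letter base) (s i)) := by
    intro i
    change endOf m _ = _
    rw [endOf_some, img_true, hm']
  refine ⟨endHom m, ⟨m, hm, rfl⟩, ?_⟩
  have hex : ∃ s : I' → SW (Option G'), ∀ i, endHom m (FreeMonoid.of (some (seed i, true))) =
      plainWord (sub (letter base) (s i)) := ⟨s, hs⟩
  simp only [val]
  rw [dif_pos hex]
  congr 1
  funext i
  have := plainWord_injective ((hex.choose_spec i).symm.trans (hs i))
  rw [sub_letter, sub_letter] at this
  exact List.map_injective_iff.2 hinj this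

end Automaton

/-! ## Automata of linear size that produce the solutions -/

theorem MonoidNFA.Path.eq_or_exists {M : Type*} [Monoid M] {𝒜 : MonoidNFA M} {p q : 𝒜.State} {m : M}
    (h : 𝒜.Path p m q) : (m = 1 ∧ p = q) ∨
      ∃ a r m', (p, a, r) ∈ 𝒜.edges ∧ 𝒜.Path r m' q ∧ m = a * m' := by
  cases h with
  | nil => exact Or.inl ⟨rfl, rfl⟩
  | cons h h' => exact Or.inr ⟨_, _, _, h, h', rfl⟩

/-- Two states suffice, with one edge for each element. For the empty set there must be no states at
all, since otherwise the automaton would not be trim. -/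
theorem MonoidNFA.exists_of_finite {M : Type*} [Monoid M] {S : Set M} (hS : S.Finite) :
    ∃ 𝒜 : MonoidNFA M, (∀ p a q, (p, a, q) ∈ 𝒜.edges → a ∈ S) ∧ 𝒜.accepted = S ∧ 𝒜.IsTrim ∧
      ¬ 𝒜.HasCycle ∧ (Nonempty 𝒜.State ↔ S.Nonempty) := by
  by_cases hne : S.Nonempty
  · let 𝒜 : MonoidNFA M :=
      { State := Bool
        edges := (fun a => (false, a, true)) '' S
        finEdges := hS.image _
        initial := {false}
        final := {true} }
    have hedge : ∀ {p a q}, (p, a, q) ∈ 𝒜.edges ↔ p = false ∧ a ∈ S ∧ q = true := by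
      intro p a q
      constructor
      · rintro ⟨b, hb, h⟩
        cases h
        exact ⟨rfl, hb, rfl⟩
      · rintro ⟨rfl, hb, rfl⟩
        exact ⟨a, hb, rfl⟩
    have htrue : ∀ {m q}, 𝒜.Path true m q → m = 1 ∧ q = true := by
      intro m q h
      rcases h.eq_or_exists with ⟨rfl, rfl⟩ | ⟨a, r, m', h, -, -⟩
      · exact ⟨rfl, rfl⟩
      · cases (hedge.1 h).1
    have hpath : ∀ {a}, a ∈ S → 𝒜.Path false a true := by
      intro a ha
      exact Path.single (hedge.2 ⟨rfl, ha, rfl⟩)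
    refine ⟨𝒜, fun p a q h => (hedge.1 h).2.1, ?_, ?_, ?_, iff_of_true ⟨true⟩ hne⟩
    · ext m
      constructor
      · rintro ⟨p, hp, q, hq, h⟩
        change p = false at hp
        change q = true at hq
        subst hp hq
        rcases h.eq_or_exists with ⟨-, h⟩ | ⟨a, r, m', he, h', hm⟩
        · cases h
        · obtain ⟨-, ha, rfl⟩ := hedge.1 he
          rw [hm, (htrue h').1, mul_one]
          exact ha
      · exact fun hm => ⟨false, rfl, true, rfl, hpath hm⟩
    · obtain ⟨a, ha⟩ := hne
      rintro (_ | _)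
      · exact ⟨⟨false, rfl, 1, Path.nil _⟩, true, rfl, a, hpath ha⟩
      · exact ⟨⟨false, rfl, a, hpath ha⟩, true, rfl, 1, Path.nil _⟩
    · rintro ⟨p, q, a, m, h, h'⟩
      obtain ⟨rfl, -, rfl⟩ := hedge.1 h
      cases (htrue h').2
  · obtain rfl := Set.not_nonempty_iff_eq_empty.1 hne
    refine ⟨{ State := Empty, edges := ∅, finEdges := Set.finite_empty, initial := ∅, final := ∅ },
      fun p => p.elim, ?_, fun p => p.elim, fun ⟨p, _⟩ => p.elim, by simp⟩
    ext m
    simp [accepted]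

section Linear

variable {G I : Type*}

theorem card_le_length [Finite I] {U V : EqWord G I} (h : AllOccur U V) :
    Nat.card I ≤ (U * V).length := by
  choose b hb using h
  have h1 : ∀ i, ∃ n : Fin (U * V).toList.length, (U * V).toList.get n = Sum.inr (i, b i) :=
    fun i => List.get_of_mem (hb i)
  choose f hf using h1
  have : Function.Injective f := by
    intro i j hij
    have := (hf i).symm.trans (hij ▸ hf j)
    simp only [Sum.inr.injEq, Prod.mk.injEq] at this
    exact this.1
  have := Nat.card_le_card_of_injective f this
  rwa [Nat.card_fin] at this

theorem card_letter {D : Type*} [Finite D] : Nat.card (Letter D) = 2 * Nat.card D + 1 := by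
  rw [Finite.card_option, Nat.card_prod]
  simp [mul_comm]

/-- The linear bound for the size of the alphabet. -/
theorem exists_produces [Finite G] [Finite I] (k : Ambient) {U V : EqWord G I} (h : AllOccur U V) :
    ∃ D : EndoAutomaton G I, D.Produces k U V ∧ Nat.card D.C ≤ 1000 * inputSize U V := by
  classical
  let e := Finite.equivFin G
  let eI := Finite.equivFin I
  let u := signedEqWord e eI U
  let v := signedEqWord e eI V
  have hlen : u.length + v.length = (U * V).length := by
    simp [u, v, signedEqWord, FreeMonoid.length]
  have hr : Nat.card (Fin (Nat.card I)) ≤ u.length + v.length := by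
    rw [Nat.card_fin, hlen]
    exact card_le_length h
  let D := Ltr (Option (Fin (Nat.card G))) (Fin (poolSize (Nat.card (Fin (Nat.card I)))
    (u.length + v.length))) (SystemIndex (Fin (Nat.card I)) (u.length + v.length))
  let base : Option (Fin (Nat.card G)) ↪ D := ⟨Ltr.base, fun _ _ h => by cases h; rfl⟩
  let seed : Fin (Nat.card I) → D := fun i => .seed (Sum.inl i)
  have hbase : Function.Injective fun z : Option (Fin (Nat.card G)) × Bool => (base z.1, z.2) := by
    rintro ⟨x, b⟩ ⟨y, c⟩ hxy
    simpa using hxy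
  have hcard : Nat.card (Letter D) ≤ 1000 * inputSize U V := by
    have h1 : Nat.card D = Nat.card G + 1 + 2 * poolSize (Nat.card (Fin (Nat.card I)))
        (u.length + v.length) + (Nat.card (Fin (Nat.card I)) + (2 * (u.length + v.length) + 1) * 2) := by
      rw [Ltr.card_eq, Finite.card_option]
      simp
    have h2 : inputSize U V = 2 * Nat.card G + 1 + (u.length + v.length) := by
      rw [inputSize, card_letter, hlen]
    -- With `n` the length of `UV`, `hr` bounds the number of letters by `2 * |G| + 670 * n + 175`;
    -- the constant `1000` is generous.
    rw [card_letter, h1, h2, poolSize]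
    omega
  -- Infinitely many accepted endomorphisms force a cycle, but the recompression argument gives no
  -- converse. A finite set of solutions is therefore listed by an acyclic automaton instead.
  by_cases hinf : {σ | SolvesReduced k U V σ}.Infinite
  · obtain ⟨R, hR, hsound, hcomplete⟩ := exists_ratIn_of_equation e k u v
    -- Some paths decode to assignments that are not reduced or contain the marker; these are
    -- filtered out.
    let R' : Set (SSub D) := {m ∈ R | ∀ d ∈ Set.range seed,
      FreeGroup.IsReduced (m d) ∧ ∀ z ∈ m d, ∃ g, z.1 = base (some g)}
    have hR' : RatIn (fixing base) R' := hR.filter_reduced _ _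
    have H : Describes e eI base seed k U V R' := by
      constructor
      · rintro m ⟨hm, hm'⟩
        obtain ⟨τ, hτ, heq⟩ := hsound m hm
        have hpure : ∀ i, PureReduced (τ i) := by
          intro i
          obtain ⟨h1, h2⟩ := hm' (seed i) ⟨i, rfl⟩
          rw [hτ, sub_letter] at h1 h2
          refine ⟨?_, fun z hz h0 => ?_⟩
          · rw [FreeGroup.IsReduced, List.isChain_map] at h1
            exact h1.imp fun a b hab hne => hab (by rw [hne])
          · obtain ⟨g, hg⟩ := h2 _ (List.mem_map_of_mem hz)
            have := base.injective hg
            rw [h0] at this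
            cases this
        exact ⟨τ, hpure, solves_toAssignment e eI hpure heq, hτ⟩
      · intro σ hσ
        obtain ⟨s, h1, h2, h3⟩ := hσ.exists_signed e eI
        obtain ⟨m, hm, hm'⟩ := hcomplete s h1 h2
        refine ⟨m, ⟨hm, ?_⟩, s, h1, h3, hm'⟩
        rintro _ ⟨i, rfl⟩
        have : m (seed i) = sub (letter base) (s i) := hm' i
        rw [this, sub_letter]
        refine ⟨?_, fun z hz => ?_⟩
        · rw [FreeGroup.IsReduced, List.isChain_map]
          exact (h1 i).1.imp fun a b hab hne => hab (base.injective hne)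
        · obtain ⟨⟨_ | g, b⟩, hz', rfl⟩ := List.mem_map.1 hz
          · exact absurd rfl ((h1 i).2 _ hz')
          · exact ⟨g, rfl⟩
    obtain ⟨𝒜, hP, hacc, htrim⟩ := (hR'.map endHom).exists_trim
    have hinf' := H.infinite hinf
    refine ⟨seedAutomaton e eI base seed 𝒜, H.produces hP hacc htrim (iff_of_true ?_ hinf.nonempty)
      (iff_of_true ?_ hinf), hcard⟩
    · rw [← hacc] at hinf'
      obtain ⟨m, p, _⟩ := hinf'.nonempty
      exact ⟨p⟩
    · by_contra hc
      exact hinf' (hacc ▸ 𝒜.finite_accepted hc)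
  · rw [Set.not_infinite] at hinf
    have hex : ∀ σ : {σ | SolvesReduced k U V σ}, ∃ s : Fin (Nat.card I) →
        SW (Option (Fin (Nat.card G))), (∀ i, PureReduced (s i)) ∧ toAssignment e eI s = σ := by
      rintro ⟨σ, hσ⟩
      obtain ⟨s, h1, -, h3⟩ := SolvesReduced.exists_signed e eI hσ
      exact ⟨s, h1, h3⟩
    choose s hs hs' using hex
    have := hinf.to_subtype
    let m : {σ | SolvesReduced k U V σ} → SSub D := fun σ d =>
      match d with
      | .seed (Sum.inl i) => sub (letter base) (s σ i)
      | d => [(d, true)]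
    have H : Describes e eI base seed k U V (Set.range m) := by
      constructor
      · rintro _ ⟨σ, rfl⟩
        exact ⟨s σ, hs σ, (hs' σ).symm ▸ σ.2, fun i => rfl⟩
      · intro σ hσ
        exact ⟨_, ⟨⟨σ, hσ⟩, rfl⟩, s ⟨σ, hσ⟩, hs _, hs' _, fun i => rfl⟩
    obtain ⟨𝒜, hP, hacc, htrim, hcyc, hne⟩ := MonoidNFA.exists_of_finite
      ((Set.finite_range m).image endHom)
    refine ⟨seedAutomaton e eI base seed 𝒜, H.produces (fun p a q h => ?_) hacc htrim ?_
      (iff_of_false hcyc (Set.not_infinite.2 hinf)), hcard⟩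
    · obtain ⟨_, ⟨σ, rfl⟩, rfl⟩ := hP p a q h
      exact ⟨_, fun b => rfl, rfl⟩
    · rw [hne]
      constructor
      · rintro ⟨_, _, ⟨σ, rfl⟩, rfl⟩
        exact ⟨σ.1, σ.2⟩
      · rintro ⟨σ, hσ⟩
        exact ⟨_, _, ⟨⟨σ, hσ⟩, rfl⟩, rfl⟩

end Linear

/-! ## EDT0L languages are indexed -/

section Indexed

variable {T : Type*} {C : Type} (ι : T ↪ C) (𝒜 : MonoidNFA (Monoid.End (FreeMonoid C)))
  (c : C)

/-- The grammar that first guesses a path of the automaton, stores it as a flag string, and then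
applies its labels to a letter. -/
def pathGrammar [Finite C] : IndexedGrammar T :=
  haveI := 𝒜.finState
  haveI := 𝒜.finEdges.to_subtype
  haveI : Finite T := Finite.of_injective ι ι.injective
  { N := Option 𝒜.State ⊕ C
    F := Option 𝒜.edges
    start := Sum.inl none
    rules := (fun p => (Sum.inl none, [Sum.inl (Sum.inl (some p), [none])])) '' 𝒜.initial ∪
      (Set.range fun e : 𝒜.edges =>
        (Sum.inl (some e.1.1), [Sum.inl (Sum.inl (some e.1.2.2), [some e])])) ∪
      (fun q => (Sum.inl (some q), [Sum.inl (Sum.inr c, [])])) '' 𝒜.final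
    finRules := ((Set.toFinite _).union (Set.finite_range _)).union (Set.toFinite _)
    flagRules := (Set.range fun p : 𝒜.edges × C => (some p.1, Sum.inr p.2,
        (p.1.1.2.1 (FreeMonoid.of p.2)).toList.map fun d => Sum.inl (Sum.inr d))) ∪
      Set.range fun a : T => (none, Sum.inr (ι a), [Sum.inr a])
    finFlagRules := (Set.finite_range _).union (Set.finite_range _) }

/-- The terminal words derived from a letter with a flag string. -/
def letterLang : List (Option 𝒜.edges) → C → Language T
  | [], _ => ⊥
  | none :: _, d => {w | w.map ι = [d]}
  | some e :: ζ, d => FreeMonoid.lift (letterLang ζ) (e.1.2.1 (FreeMonoid.of d))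

/-- The terminal words derived from a nonterminal with a flag string. -/
def nonterminalLang : Option 𝒜.State ⊕ C → List (Option 𝒜.edges) → Language T
  | Sum.inl none, ζ => {w | ∃ p ∈ 𝒜.initial, ∃ m, ∃ r ∈ 𝒜.final, 𝒜.Path p m r ∧
      w ∈ FreeMonoid.lift (letterLang ι 𝒜 (none :: ζ)) (m (FreeMonoid.of c))}
  | Sum.inl (some q), ζ => {w | ∃ m, ∃ r ∈ 𝒜.final, 𝒜.Path q m r ∧
      w ∈ FreeMonoid.lift (letterLang ι 𝒜 ζ) (m (FreeMonoid.of c))}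
  | Sum.inr d, ζ => letterLang ι 𝒜 ζ d

/-- The terminal words derived from a symbol. -/
def symbolLang : ((Option 𝒜.State ⊕ C) × List (Option 𝒜.edges)) ⊕ T → Language T :=
  Sum.elim (fun p => nonterminalLang ι 𝒜 c p.1 p.2) fun a => {[a]}

variable {ι 𝒜 c}

theorem lift_letterLang_some (e : 𝒜.edges) (ζ : List (Option 𝒜.edges)) (u : FreeMonoid C) :
    FreeMonoid.lift (letterLang ι 𝒜 (some e :: ζ)) u =
      FreeMonoid.lift (letterLang ι 𝒜 ζ) (e.1.2.1 u) := by
  have : FreeMonoid.lift (letterLang ι 𝒜 (some e :: ζ)) =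
      (FreeMonoid.lift (letterLang ι 𝒜 ζ)).comp e.1.2.1 :=
    FreeMonoid.hom_eq fun d => rfl
  rw [this]
  rfl

theorem mem_lift_letterLang_none {ζ : List (Option 𝒜.edges)} {u : FreeMonoid C} {w : List T} :
    w ∈ FreeMonoid.lift (letterLang ι 𝒜 (none :: ζ)) u ↔ w.map ι = u.toList := by
  induction u using FreeMonoid.inductionOn' generalizing w with
  | one =>
    rw [map_one, Language.mem_one]
    simp
  | of_mul d u ih =>
    rw [map_mul, Language.mem_mul, FreeMonoid.lift_eval_of]
    constructor
    · rintro ⟨a, ha, b, hb, rfl⟩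
      have ha : a.map ι = [d] := ha
      rw [List.map_append, ha, ih.1 hb]
      rfl
    · intro h
      obtain ⟨a, b, rfl, ha, hb⟩ := List.map_eq_cons_iff.1 h
      exact ⟨[a], (by rw [← ha]; rfl : List.map ι [a] = [d]), b, ih.2 hb, rfl⟩

theorem prod_symbolLang_letters (ζ : List (Option 𝒜.edges)) (u : FreeMonoid C) :
    ((u.toList.map fun d => Sum.inl (Sum.inr d, ζ)).map (symbolLang ι 𝒜 c)).prod =
      FreeMonoid.lift (letterLang ι 𝒜 ζ) u := by
  rw [List.map_map, FreeMonoid.lift_apply]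
  rfl

theorem prod_symbolLang_terminal (w : List T) :
    ((w.map Sum.inr).map (symbolLang ι 𝒜 c)).prod = {w} := by
  induction w with
  | nil => rfl
  | cons a w ih =>
    rw [List.map_cons, List.map_cons, List.prod_cons, ih]
    ext x
    rw [Language.mem_mul]
    constructor
    · rintro ⟨_, rfl, _, rfl, rfl⟩
      rfl
    · rintro rfl
      exact ⟨[a], rfl, w, rfl, rfl⟩

theorem mem_of_mem_prod_singleton {s : ((Option 𝒜.State ⊕ C) × List (Option 𝒜.edges)) ⊕ T} {w : List T}
    (h : w ∈ ([s].map (symbolLang ι 𝒜 c)).prod) : w ∈ symbolLang ι 𝒜 c s := by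
  rwa [List.map_cons, List.map_nil, List.prod_singleton] at h

variable [Finite C]

theorem IndexedGrammar.Step.append {g : IndexedGrammar T} {x y : List ((g.N × List g.F) ⊕ T)}
    (h : g.Step x y) (a b : List ((g.N × List g.F) ⊕ T)) : g.Step (a ++ x ++ b) (a ++ y ++ b) := by
  cases h with
  | rule hw ζ u v => simpa [List.append_assoc] using IndexedGrammar.Step.rule hw ζ (a ++ u) (v ++ b)
  | flag hw ζ u v => simpa [List.append_assoc] using IndexedGrammar.Step.flag hw ζ (a ++ u) (v ++ b)

theorem IndexedGrammar.reflTransGen_append {g : IndexedGrammar T}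
    {x x' y y' : List ((g.N × List g.F) ⊕ T)} (h : Relation.ReflTransGen g.Step x x')
    (h' : Relation.ReflTransGen g.Step y y') :
    Relation.ReflTransGen g.Step (x ++ y) (x' ++ y') := by
  refine (Relation.ReflTransGen.lift (fun z => z ++ y) (fun a b hab => ?_) _ _ h).trans
    (Relation.ReflTransGen.lift (fun z => x' ++ z) (fun a b hab => ?_) _ _ h')
  · simpa using hab.append [] y
  · simpa using hab.append x' []

theorem IndexedGrammar.Step.exists_rule {g : IndexedGrammar T} {x y : List ((g.N × List g.F) ⊕ T)}
    (h : g.Step x y) : ∃ A ζ u v w, x = u ++ [Sum.inl (A, ζ)] ++ v ∧ y = u ++ w ++ v ∧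
      ((∃ w', (A, w') ∈ g.rules ∧ w = w'.map (Sum.map (fun p => (p.1, p.2 ++ ζ)) id)) ∨
        ∃ f ζ' w', ζ = f :: ζ' ∧ (f, A, w') ∈ g.flagRules ∧
          w = w'.map (Sum.map (fun B => (B, ζ')) id)) := by
  cases h with
  | rule hw ζ u v => exact ⟨_, _, u, v, _, rfl, rfl, Or.inl ⟨_, hw, rfl⟩⟩
  | flag hw ζ u v => exact ⟨_, _, u, v, _, rfl, rfl, Or.inr ⟨_, _, _, rfl, hw, rfl⟩⟩

/-- Attaching to every symbol the language it should derive, each production replaces a symbol by a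
form with a smaller language. So derivations never leave the language of the start symbol. -/
theorem prod_symbolLang_le_of_step
    {x y : List (((Option 𝒜.State ⊕ C) × List (Option 𝒜.edges)) ⊕ T)}
    (h : (pathGrammar ι 𝒜 c).Step x y) :
    (y.map (symbolLang ι 𝒜 c)).prod ≤ (x.map (symbolLang ι 𝒜 c)).prod := by
  have key : ∀ (u v w : List (((Option 𝒜.State ⊕ C) × List (Option 𝒜.edges)) ⊕ T)) A ζ,
      (w.map (symbolLang ι 𝒜 c)).prod ≤ nonterminalLang ι 𝒜 c A ζ →
      ((u ++ w ++ v).map (symbolLang ι 𝒜 c)).prod ≤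
        ((u ++ [Sum.inl (A, ζ)] ++ v).map (symbolLang ι 𝒜 c)).prod := by
    intro u v w A ζ h
    simp only [List.map_append, List.prod_append, List.map_cons, List.map_nil, List.prod_singleton]
    exact mul_le_mul' (mul_le_mul' le_rfl h) le_rfl
  obtain ⟨A, ζ, u, v, w, rfl, rfl, hw⟩ := h.exists_rule
  refine key u v w A ζ ?_
  rcases hw with ⟨w, hw, rfl⟩ | ⟨f, ζ, w, rfl, hw, rfl⟩
  · rcases hw with (⟨p, hp, h⟩ | ⟨e, h⟩) | ⟨q, hq, h⟩ <;> cases h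
    · rintro w hw
      obtain ⟨m, r, hr, hpath, hw⟩ := mem_of_mem_prod_singleton hw
      exact ⟨p, hp, m, r, hr, hpath, hw⟩
    · rintro w hw
      obtain ⟨m, r, hr, hpath, hw⟩ := mem_of_mem_prod_singleton hw
      refine ⟨e.1.2.1 * m, r, hr, MonoidNFA.Path.cons e.2 hpath, ?_⟩
      exact (lift_letterLang_some e ζ _).le hw
    · rintro w hw
      exact ⟨1, q, hq, MonoidNFA.Path.nil _, mem_of_mem_prod_singleton hw⟩
  · rcases hw with ⟨⟨e, d⟩, h⟩ | ⟨a, h⟩ <;> cases h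
    · refine le_trans (le_of_eq ?_) (prod_symbolLang_letters (c := c) ζ _).le
      exact congrArg (fun l => (List.map (symbolLang ι 𝒜 c) l).prod) List.map_map
    · rintro w hw
      obtain rfl : w = [a] := mem_of_mem_prod_singleton hw
      rfl

theorem reflTransGen_letters {ζ : List (Option 𝒜.edges)}
    (h : ∀ d, ∀ w ∈ letterLang ι 𝒜 ζ d, Relation.ReflTransGen (pathGrammar ι 𝒜 c).Step
      [Sum.inl (Sum.inr d, ζ)] (w.map Sum.inr)) {u : FreeMonoid C} {w : List T}
    (hw : w ∈ FreeMonoid.lift (letterLang ι 𝒜 ζ) u) :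
    Relation.ReflTransGen (pathGrammar ι 𝒜 c).Step
      (u.toList.map fun d => Sum.inl (Sum.inr d, ζ)) (w.map Sum.inr) := by
  induction u using FreeMonoid.inductionOn' generalizing w with
  | one =>
    rw [map_one, Language.mem_one] at hw
    subst hw
    exact Relation.ReflTransGen.refl
  | of_mul d u ih =>
    rw [map_mul, Language.mem_mul, FreeMonoid.lift_eval_of] at hw
    obtain ⟨a, ha, b, hb, rfl⟩ := hw
    rw [List.map_append]
    exact IndexedGrammar.reflTransGen_append (h d a ha) (ih hb)

theorem reflTransGen_letter (ζ : List (Option 𝒜.edges)) :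
    ∀ d, ∀ w ∈ letterLang ι 𝒜 ζ d, Relation.ReflTransGen (pathGrammar ι 𝒜 c).Step
      [Sum.inl (Sum.inr d, ζ)] (w.map Sum.inr) := by
  induction ζ with
  | nil => exact fun d w hw => hw.elim
  | cons f ζ ih =>
    intro d w hw
    rcases f with _ | e
    · have hw : w.map ι = [d] := hw
      obtain ⟨a, l, rfl, rfl, hl⟩ := List.map_eq_cons_iff.1 hw
      obtain rfl := List.map_eq_nil_iff.1 hl
      exact Relation.ReflTransGen.single (IndexedGrammar.Step.flag (g := pathGrammar ι 𝒜 c)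
        (f := none) (A := Sum.inr (ι a)) (w := [Sum.inr a]) (Or.inr ⟨a, rfl⟩) ζ [] [])
    · have := IndexedGrammar.Step.flag (g := pathGrammar ι 𝒜 c) (f := some e) (A := Sum.inr d)
        (Or.inl ⟨(e, d), rfl⟩) ζ [] []
      refine Relation.ReflTransGen.head this ?_
      have := reflTransGen_letters ih (u := e.1.2.1 (FreeMonoid.of d)) hw
      refine Eq.subst (motive := fun x => Relation.ReflTransGen (pathGrammar ι 𝒜 c).Step x
        (w.map Sum.inr)) ?_ this
      refine Eq.trans ?_ (List.append_nil _).symm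
      exact (List.map_map (g := Sum.map (fun B => (B, ζ)) id)
        (f := fun d => Sum.inl (Sum.inr d))).symm

/-- Edges are pushed in the order of the path, so the last label lies on top and is applied first,
in agreement with the product of endomorphisms. -/
theorem reflTransGen_state {q r : 𝒜.State} {m : Monoid.End (FreeMonoid C)} (h : 𝒜.Path q m r)
    (hr : r ∈ 𝒜.final) {ζ : List (Option 𝒜.edges)} {w : List T}
    (hw : w ∈ FreeMonoid.lift (letterLang ι 𝒜 ζ) (m (FreeMonoid.of c))) :
    Relation.ReflTransGen (pathGrammar ι 𝒜 c).Step
      [Sum.inl (Sum.inl (some q), ζ)] (w.map Sum.inr) := by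
  induction h generalizing ζ with
  | nil p =>
    exact Relation.ReflTransGen.head (IndexedGrammar.Step.rule (g := pathGrammar ι 𝒜 c)
      (A := Sum.inl (some p)) (Or.inr ⟨p, hr, rfl⟩) ζ [] []) (reflTransGen_letter ζ c w hw)
  | @cons p q r a m he _ ih =>
    refine Relation.ReflTransGen.head (IndexedGrammar.Step.rule (g := pathGrammar ι 𝒜 c)
      (A := Sum.inl (some p)) (Or.inl (Or.inr ⟨⟨_, he⟩, rfl⟩)) ζ [] [])
      (ih hr (ζ := some ⟨_, he⟩ :: ζ) ?_)
    rw [lift_letterLang_some]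
    exact hw

theorem language_pathGrammar : (pathGrammar ι 𝒜 c).language =
    {w | ∃ h ∈ 𝒜.accepted, FreeMonoid.map ι w = h (FreeMonoid.of c)} := by
  ext w
  constructor
  · intro hw
    have hw : Relation.ReflTransGen (pathGrammar ι 𝒜 c).Step [Sum.inl (Sum.inl none, [])]
      (w.toList.map Sum.inr) := hw
    have key : ∀ x y, Relation.ReflTransGen (pathGrammar ι 𝒜 c).Step x y →
        (y.map (symbolLang ι 𝒜 c)).prod ≤ (x.map (symbolLang ι 𝒜 c)).prod := by
      intro x y h
      induction h with
      | refl => exact le_rfl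
      | tail _ h ih => exact (prod_symbolLang_le_of_step h).trans ih
    have h1 := (prod_symbolLang_terminal w.toList).ge.trans (key _ _ hw)
    obtain ⟨p, hp, m, r, hr, hpath, hm⟩ := mem_of_mem_prod_singleton (h1 rfl)
    exact ⟨m, ⟨p, hp, r, hr, hpath⟩, mem_lift_letterLang_none.1 hm⟩
  · rintro ⟨m, ⟨p, hp, r, hr, hpath⟩, hm⟩
    refine Relation.ReflTransGen.head (IndexedGrammar.Step.rule (g := pathGrammar ι 𝒜 c)
      (A := Sum.inl none) (Or.inl (Or.inl ⟨p, hp, rfl⟩)) [] [] [])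
      (reflTransGen_state hpath hr (ζ := [none]) ?_)
    exact mem_lift_letterLang_none.2 hm

theorem IsEDT0L.isIndexed {L : Set (FreeMonoid T)} (h : IsEDT0L L) : IsIndexed L := by
  obtain ⟨C, _, ι, _, c, ⟨𝒜, rfl⟩, hL⟩ := h
  refine ⟨pathGrammar ι 𝒜 c, ?_⟩
  rw [language_pathGrammar]
  ext w
  have hinj : Function.Injective (FreeMonoid.map ι) :=
    fun _ _ h => List.map_injective_iff.2 ι.injective h
  rw [← hinj.mem_set_image (s := L), hL]
  exact ⟨fun ⟨h, hh, e⟩ => ⟨h, hh, e.symm⟩, fun ⟨h, hh, e⟩ => ⟨h, hh, e.symm⟩⟩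

end Indexed

/-! ## Languages of solutions -/

section Join

variable {C C' : Type*}

theorem joinWith_cons_cons (s : C) (w w' : FreeMonoid C) (l : List (FreeMonoid C)) :
    joinWith s (w :: w' :: l) = w * FreeMonoid.of s * joinWith s (w' :: l) := by
  apply FreeMonoid.toList.injective
  simp [joinWith, List.intercalate]

theorem joinWith_singleton (s : C) (w : FreeMonoid C) : joinWith s [w] = w := by
  apply FreeMonoid.toList.injective
  simp [joinWith, List.intercalate]

theorem map_joinWith (f : FreeMonoid C →* FreeMonoid C') {s : C} {s' : C'}
    (hs : f (FreeMonoid.of s) = FreeMonoid.of s') (l : List (FreeMonoid C)) :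
    f (joinWith s l) = joinWith s' (l.map f) := by
  induction l with
  | nil => exact map_one f
  | cons w l ih =>
    cases l with
    | nil => rw [joinWith_singleton, List.map_cons, List.map_nil, joinWith_singleton]
    | cons w' l =>
      rw [joinWith_cons_cons, map_mul, map_mul, ih, hs]
      exact (joinWith_cons_cons _ _ _ _).symm

end Join

section Solutions

variable {G I : Type*} {k : Ambient} {U V : EqWord G I} {D : EndoAutomaton G I}

theorem EndoAutomaton.Produces.map_incl (H : D.Produces k U V)
    {h : Monoid.End (FreeMonoid D.C)} (hh : h ∈ D.nfa.accepted) (a : Letter G) :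
    h (FreeMonoid.of (D.incl a)) = FreeMonoid.of (D.incl a) := by
  obtain ⟨p, -, q, -, hp⟩ := hh
  induction hp with
  | nil => rfl
  | @cons p q r x m he _ ih =>
    change x (m _) = _
    rw [ih, H.label_fix _ _ _ he]

theorem EndoAutomaton.Produces.map_barWord (H : D.Produces k U V)
    {h : Monoid.End (FreeMonoid D.C)} (hh : h ∈ D.nfa.accepted) (w : FreeMonoid D.C) :
    h (barWord D.bar w) = barWord D.bar (h w) := by
  obtain ⟨p, -, q, -, hp⟩ := hh
  induction hp with
  | nil => rfl
  | @cons p q r x m he _ ih =>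
    change x (m _) = barWord _ (x (m _))
    rw [ih, H.label_bar _ _ _ he]

/-- The letter for a variable or its inverse. -/
def EndoAutomaton.letterOf (D : EndoAutomaton G I) (X : Variable I) : D.C :=
  if X.2 then D.seed X.1 else D.bar (D.seed X.1)

theorem map_incl_barWord (w : FreeMonoid (Letter G)) :
    FreeMonoid.map D.incl (barWord Letter.bar w) = barWord D.bar (FreeMonoid.map D.incl w) := by
  apply FreeMonoid.toList.injective
  simp only [FreeMonoid.toList_map, toList_barWord, List.map_reverse, List.map_map]
  congr 2
  funext a
  exact D.incl_bar a

theorem EndoAutomaton.Produces.map_letterOf (H : D.Produces k U V)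
    {σ : Variable I → FreeMonoid (Letter G)} (hσ : SolvesReduced k U V σ)
    {h : Monoid.End (FreeMonoid D.C)} (hh : h ∈ D.nfa.accepted)
    (hs : ∀ i, FreeMonoid.map D.incl (σ (i, true)) = h (FreeMonoid.of (D.seed i))) (X : Variable I) :
    h (FreeMonoid.of (D.letterOf X)) = FreeMonoid.map D.incl (σ X) := by
  obtain ⟨i, _ | _⟩ := X
  · have h1 : σ (i, false) = barWord Letter.bar (σ (i, true)) := hσ.map_bar (i, true)
    have h2 : FreeMonoid.of (D.letterOf (i, false)) =
        barWord D.bar (FreeMonoid.of (D.seed i)) := rfl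
    rw [h2, H.map_barWord hh, ← hs, h1, map_incl_barWord]
  · exact (hs i).symm

/-- Accepted endomorphisms fix the marker and commute with the involution, as their labels do. The
values at the seeds therefore determine those at the letters of inverse variables, and the joined
words follow from the tuples. -/
theorem EndoAutomaton.Produces.image_solSet (H : D.Produces k U V) (Z : List (Variable I)) :
    FreeMonoid.map D.incl '' SolSet k U V Z =
      (fun h => h (joinWith (D.incl marker) ((Z.map D.letterOf).map FreeMonoid.of))) ''
        D.nfa.accepted := by
  have key : ∀ {σ} {h : Monoid.End (FreeMonoid D.C)}, SolvesReduced k U V σ → h ∈ D.nfa.accepted →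
      (∀ i, FreeMonoid.map D.incl (σ (i, true)) = h (FreeMonoid.of (D.seed i))) →
      FreeMonoid.map D.incl (joinWith marker (Z.map σ)) =
        h (joinWith (D.incl marker) ((Z.map D.letterOf).map FreeMonoid.of)) := by
    intro σ h hσ hh hs
    rw [map_joinWith (FreeMonoid.map D.incl) (s' := D.incl marker) (FreeMonoid.map_of _ _)]
    refine Eq.trans ?_ (map_joinWith h (H.map_incl hh marker) _).symm
    congr 1
    simp only [List.map_map]
    exact List.map_congr_left fun X _ => (H.map_letterOf hσ hh hs X).symm
  have htuples := H.tuples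
  ext w
  constructor
  · rintro ⟨_, ⟨σ, hσ, rfl⟩, rfl⟩
    obtain ⟨h, hh, hs⟩ := htuples.le ⟨σ, hσ, fun i => rfl⟩
    exact ⟨h, hh, (key hσ hh hs).symm⟩
  · rintro ⟨h, hh, rfl⟩
    obtain ⟨σ, hσ, hs⟩ := htuples.ge ⟨h, hh, fun i => rfl⟩
    exact ⟨_, ⟨σ, hσ, rfl⟩, key hσ hh fun i => (hs i).symm⟩

end Solutions

/-! ### Replacing the joined word by a single letter -/

section EDT0L

variable {C : Type}

/-- The extension of an endomorphism by a new fixed letter. -/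
def extendEnd : Monoid.End (FreeMonoid C) →* Monoid.End (FreeMonoid (Option C)) where
  toFun h := FreeMonoid.lift fun x => match x with
    | none => FreeMonoid.of none
    | some c => FreeMonoid.map some (h (FreeMonoid.of c))
  map_one' := by
    refine FreeMonoid.hom_eq fun x => ?_
    rcases x with _ | c <;> rfl
  map_mul' h g := by
    have key : ∀ (h : FreeMonoid C →* FreeMonoid C) (w : FreeMonoid C),
        FreeMonoid.lift (fun x : Option C => match x with
          | none => FreeMonoid.of none
          | some c => FreeMonoid.map some (h (FreeMonoid.of c))) (FreeMonoid.map some w) =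
        FreeMonoid.map some (h w) := by
      intro h w
      induction w using FreeMonoid.inductionOn' with
      | one => rw [map_one, map_one, map_one, map_one]
      | of_mul c w ih => rw [map_mul, map_mul, ih, map_mul, map_mul]; rfl
    refine FreeMonoid.hom_eq fun x => ?_
    rcases x with _ | c
    · rfl
    · exact (key h (g (FreeMonoid.of c))).symm

theorem extendEnd_map_some (h : Monoid.End (FreeMonoid C)) (w : FreeMonoid C) :
    extendEnd h (FreeMonoid.map some w) = FreeMonoid.map some (h w) := by
  induction w using FreeMonoid.inductionOn' with
  | one => rw [map_one, map_one, map_one, map_one]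
  | of_mul c w ih => rw [map_mul, map_mul, ih, map_mul, map_mul]; rfl

theorem RatIn.mul_singleton {M : Type*} [Monoid M] {P R : Set M} {a : M} (h1 : 1 ∈ P)
    (hR : RatIn P R) (ha : a ∈ P) : RatIn P ((fun m => m * a) '' R) := by
  let R' : Option Bool → Option Bool → Set M := fun p q =>
    match p, q with
    | none, some false => R
    | some false, some true => {a}
    | _, _ => ∅
  have hR' : ∀ p q, RatIn P (R' p q) := by
    rintro (_ | _ | _) (_ | _ | _)
    case none.some.false => exact hR
    case some.false.some.true =>
      exact RatIn.of_finite (Set.finite_singleton a) (Set.singleton_subset_iff.2 ha)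
    all_goals exact RatIn.of_finite Set.finite_empty (Set.empty_subset _)
  convert RatIn.chainProd h1 hR' {none} {some true} using 1
  ext m
  constructor
  · rintro ⟨r, hr, rfl⟩
    refine ⟨none, rfl, some true, rfl, ?_⟩
    have h2 : a ∈ R' (some false) (some true) := rfl
    have h3 : r ∈ R' none (some false) := hr
    simpa using ChainProd.cons h3 (ChainProd.cons h2 (ChainProd.nil _))
  · rintro ⟨_, rfl, _, rfl, h⟩
    cases h with
    | @cons _ q _ r m hr h =>
      rcases q with _ | _ | _
      · exact hr.elim
      · cases h with
        | @cons _ q _ b m hb h =>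
          rcases q with _ | _ | _
          · exact hb.elim
          · exact hb.elim
          · obtain rfl : b = a := hb
            cases h with
            | nil => exact ⟨r, hr, by simp⟩
            | @cons _ q _ b m hb h => exact hb.elim
      · exact hr.elim

/-- The images of a word under a rational set of endomorphisms form an EDT0L language. -/
theorem isEDT0L_of_image {α : Type*} [Finite C] (ι : α ↪ C) {R : Set (Monoid.End (FreeMonoid C))}
    (hR : IsRationalSet R) {L : Set (FreeMonoid α)} {w : FreeMonoid C}
    (h : FreeMonoid.map ι '' L = (fun h => h w) '' R) : IsEDT0L L := by
  -- The new letter `none` is sent to `w` by a factor on the right, which acts first; the extended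
  -- endomorphisms then act on `w` as before.
  let f : Monoid.End (FreeMonoid (Option C)) := FreeMonoid.lift fun x => match x with
    | none => FreeMonoid.map some w
    | some c => FreeMonoid.of (some c)
  have h1 : RatIn Set.univ R := by
    obtain ⟨𝒜, h𝒜⟩ := hR
    exact ⟨𝒜, fun _ _ _ _ => trivial, h𝒜⟩
  have h2 : RatIn Set.univ ((fun m => m * f) '' (extendEnd '' R)) := by
    refine RatIn.mul_singleton trivial ?_ trivial
    obtain ⟨𝒜, -, h𝒜⟩ := h1.map extendEnd
    exact ⟨𝒜, fun _ _ _ _ => trivial, h𝒜⟩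
  obtain ⟨𝒜, -, h𝒜⟩ := h2
  refine ⟨Option C, inferInstance, ι.trans Function.Embedding.some, _, none, ⟨𝒜, h𝒜⟩, ?_⟩
  have hmap : ∀ v : FreeMonoid α, FreeMonoid.map (ι.trans Function.Embedding.some) v =
      FreeMonoid.map some (FreeMonoid.map ι v) := by
    intro v
    apply FreeMonoid.toList.injective
    simp [FreeMonoid.toList_map]
  have hval : ∀ m : Monoid.End (FreeMonoid C), (extendEnd m * f) (FreeMonoid.of none) =
      FreeMonoid.map some (m w) := fun m => extendEnd_map_some m w
  rw [Set.image_image, Set.image_image]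
  simp only [hval]
  rw [← Set.image_image (FreeMonoid.map some), ← h, Set.image_image]
  exact Set.image_congr' hmap

end EDT0L

/-- Let `(U, V)` be an equation over a finitely generated free group or free monoid with involution.
There is an NFA of endomorphisms over an extended alphabet of size linear in the input size
that produces the solutions in reduced words. For every such NFA and every list `Z₁, …, Zₖ` of
variables there are letters `c'₁, …, c'ₖ` with
`{σ(Z₁) # ⋯ # σ(Zₖ) | σ solves (U, V) in reduced words} = {h(c'₁ # ⋯ # c'ₖ) | h ∈ L(𝒜)}`,
and this set is EDT0L, hence indexed. -/
theorem corollary2 :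
    ∃ K : ℕ, ∀ (G I : Type*) [Finite G] [Finite I] (k : Ambient) (U V : EqWord G I),
      AllOccur U V →
      (∃ D : EndoAutomaton G I, D.Produces k U V ∧ Nat.card D.C ≤ K * inputSize U V) ∧
      (∀ D : EndoAutomaton G I, D.Produces k U V →
        ∀ Z : List (Variable I), ∃ c' : List D.C, c'.length = Z.length ∧
          FreeMonoid.map D.incl '' SolSet k U V Z =
            (fun h => h (joinWith (D.incl marker) (c'.map FreeMonoid.of))) '' D.nfa.accepted) ∧
      (∀ Z : List (Variable I), IsEDT0L (SolSet k U V Z) ∧ IsIndexed (SolSet k U V Z)) := by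
  refine ⟨1000, fun G I _ _ k U V h => ⟨exists_produces k h, fun D H Z =>
    ⟨Z.map D.letterOf, by simp, H.image_solSet Z⟩, fun Z => ?_⟩⟩
  obtain ⟨D, H, -⟩ := exists_produces k h
  have := D.finC
  have hE : IsEDT0L (SolSet k U V Z) := isEDT0L_of_image D.incl ⟨D.nfa, rfl⟩ (H.image_solSet Z)
  exact ⟨hE, hE.isIndexed⟩
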